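/- Let $F$ be a field and let $V=F^2\otimes F^3\otimes F^3$. A fundamental tensor of $V$ is a tensor $a\otimes b\otimes c$ with $a,b,c\neq 0$. Let $G$ be the setwise stabiliser in $\mathrm{GL}(V)$ of the set of fundamental tensors, and let $H\le G$ be the image of $\mathrm{GL}(F^2)\times \mathrm{GL}(F^3)\times \mathrm{GL}(F^3)$ acting by $(g_1,g_2,g_3):v_1\otimes v_2\otimes v_3\mapsto g_1v_1\otimes g_2v_2\otimes g_3v_3$. The first contraction space of $A\in V$ is the subspace $A_1=\langle w(A): w\in (F^2)^\vee\rangle$ of $F^3\otimes F^3$, where $w(v_1\otimes v_2\otimes v_3)=w(v_1)\,v_2\otimes v_3$. The rank of $t\in F^3\otimes F^3$ is the least $k$ such that $t$ lies in the span of $k$ tensors $b_i\otimes c_i$ with $b_i,c_i\ne 0$; a tensor in $F^3\otimes F^3$ is singular if it is nonzero and has rank at most $2$. Let $$\Omega=\{A\in V:\ \dim A_1=2 \text{ and } A_1 \text{ contains a singular tensor}\}.$$ For subspaces $U,W\le F^3$ let $\sigma(U\times W)=\{\langle u\otimes w\rangle: 0\neq u\in U,\ 0\neq w\in W\}$, a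 set of points of $\mathrm{PG}(F^3\otimes F^3)$. Let $S_{3,3}=\sigma(F^3\times F^3)$ (the points of rank one); a subvariety $S_{2,2}$, $S_{2,3}$ or $S_{3,2}$ is a set $\sigma(U\times W)$ with $(\dim U,\dim W)=(2,2)$, $(2,3)$ or $(3,2)$ respectively. For a point $x$ of rank two let $Q(x)$ be the unique subvariety $S_{2,2}$ whose span contains $x$. For $A\in\Omega$ let $L=\mathrm{PG}(A_1)$, a projective line, and let $a,b$ be the numbers of points of rank $1$ and $2$ on $L$. Define subsets of $\Omega$ by the following conditions on $A$: - $o_4$: $L=\sigma(U\times W)$ with $\dim U=1$, $\dim W=2$; $o_4^T$: the same with $\dim U=2$, $\dim W=1$. - $o_5$: $a=2$. - $o_6$: $a=1$, and $L$ has points $x_1$ of rank one and $x_2$ of rank two with $x_1\in Q(x_2)$. - $o_7$ (resp. $o_7^T$): $a=1$, and $L$ has points $x_1$ of rank one and $x_2$ of rank two such that $x_1\notin Q(x_2)$ but $x_1$ lies in some subvariety $S_{2,3}$ (resp. $S_{3,2}$) containing $Q(x_2)$. - $o_8$: $a=1$, and $L$ has points $x_1$ of rank one and $x_2$ of rank two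 such that $x_1$ lies in no subvariety $S_{2,3}$ or $S_{3,2}$ containing $Q(x_2)$. - $o_9$: $a=1$ and $b=0$. - $o_{10}$: $L$ is contained in the span of some subvariety $S_{2,2}$ and is disjoint from that subvariety. - $o_{11}$ (resp. $o_{11}^T$): $L$ is disjoint from $S_{3,3}$ and contained in the span of some subvariety $S_{2,3}$ (resp. $S_{3,2}$), but not in the span of any $S_{2,2}$. - $o_{12}$, $o_{13}$, $o_{14}$: $a=0$, $L$ is not contained in the span of any $S_{2,3}$ or $S_{3,2}$, and $L$ has two distinct points $x_1,x_2$ of rank two such that $Q(x_1)\cap Q(x_2)$ is a single point $z$ and such that, respectively, none, exactly one, or both of $x_1,x_2$ lie on a secant of $S_{3,3}$ through $z$ (a line joining $z$ to another point of $S_{3,3}$). - $o_{15}$ (resp. $o_{16}$): $a=0$, $b=1$, and $L$ has points $x_1$ of rank three and $x_2$ of rank two such that there exist (resp. do not exist) points $y_1$ of rank one and $y_2$ of rank two with $x_1\in\langle y_1,y_2\rangle$ and $Q(y_2)=Q(x_2)$. (i) If $F$ is finite or real closed, there are exactly $16$ $H$-orbits and exactly $13$ $G$-orbits on $\Omega$.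 The $H$-orbits are the sets $o_4,o_4^T,o_5,o_6,o_7,o_7^T,o_8,o_9,o_{10},o_{11},o_{11}^T,o_{12},o_{13},o_{14},o_{15},o_{16}$, and the $G$-orbits are $o_4\cup o_4^T$, $o_7\cup o_7^T$, $o_{11}\cup o_{11}^T$ and $o_5,o_6,o_8,o_9,o_{10},o_{12},o_{13},o_{14},o_{15},o_{16}$. (ii) If $F$ is algebraically closed, there are exactly $14$ $H$-orbits and exactly $11$ $G$-orbits on $\Omega$: the sets $o_{10}$ and $o_{15}$ are empty, and the orbits are the remaining sets listed in (i). -/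

import Mathlib

namespace Tensor233

open scoped TensorProduct Pointwise LinearAlgebra.Projectivization

noncomputable section

/-- The space `F³ ⊗ F³`. -/
abbrev M (F : Type*) [Field F] : Type _ := (Fin 3 → F) ⊗[F] (Fin 3 → F)

/-- The space `F² ⊗ F³ ⊗ F³`. -/
abbrev V (F : Type*) [Field F] : Type _ := (Fin 2 → F) ⊗[F] M F

/-! ### The groups -/

/-- The fundamental (rank one) tensors of `F² ⊗ F³ ⊗ F³`. -/
def fundamentalTensors (F : Type*) [Field F] : Set (V F) :=
  {A | ∃ (a : Fin 2 → F) (b c : Fin 3 → F), a ≠ 0 ∧ b ≠ 0 ∧ c ≠ 0 ∧ A = a ⊗ₜ[F] (b ⊗ₜ[F] c)}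

/-- The group `G`: the setwise stabiliser in `GL(V)` of the set of fundamental tensors. -/
def G (F : Type*) [Field F] : Subgroup (V F ≃ₗ[F] V F) :=
  MulAction.stabilizer (V F ≃ₗ[F] V F) (fundamentalTensors F)

/-- The homomorphism `GL(F²) × GL(F³) × GL(F³) → GL(V)` with
`(g₁, g₂, g₃) : v₁ ⊗ v₂ ⊗ v₃ ↦ g₁ v₁ ⊗ g₂ v₂ ⊗ g₃ v₃`. -/
def hHom (F : Type*) [Field F] :
    ((Fin 2 → F) ≃ₗ[F] (Fin 2 → F)) × ((Fin 3 → F) ≃ₗ[F] (Fin 3 → F)) ×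
      ((Fin 3 → F) ≃ₗ[F] (Fin 3 → F)) →* (V F ≃ₗ[F] V F) where
  toFun g := TensorProduct.congr g.1 (TensorProduct.congr g.2.1 g.2.2)
  map_one' := by
    apply LinearEquiv.toLinearMap_injective
    ext
    simp
  map_mul' g h := by
    apply LinearEquiv.toLinearMap_injective
    ext
    simp

/-- The group `H`: the image of `GL(F²) × GL(F³) × GL(F³)` in `GL(V)`. -/
def H (F : Type*) [Field F] : Subgroup (V F ≃ₗ[F] V F) := (hHom F).range

/-- The set of orbits of `K ≤ GL(V)` of the tensors in `X`. -/
def orbitsOn {F : Type*} [Field F] (K : Subgroup (V F ≃ₗ[F] V F)) (X : Set (V F)) :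
    Set (Set (V F)) :=
  {O | ∃ A ∈ X, O = MulAction.orbit K A}

/-! ### Contraction, rank, and the set `Ω` -/

/-- The contraction by a linear form, with `w (v₁ ⊗ v₂ ⊗ v₃) = w v₁ • (v₂ ⊗ v₃)`. -/
def contract {F : Type*} [Field F] (w : Module.Dual F (Fin 2 → F)) : V F →ₗ[F] M F :=
  (TensorProduct.lid F (M F)).toLinearMap ∘ₗ LinearMap.rTensor (M F) w

/-- The first contraction space `A₁` of `A`. -/
def contractionSpace {F : Type*} [Field F] (A : V F) : Submodule F (M F) :=
  Submodule.span F (Set.range fun w : Module.Dual F (Fin 2 → F) => contract w A)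

/-- The tensor rank on `F³ ⊗ F³`: the least `k` such that the tensor lies in the span of `k`
fundamental tensors. -/
def rk {F : Type*} [Field F] (t : M F) : ℕ :=
  sInf {k | ∃ b c : Fin k → (Fin 3 → F), (∀ i, b i ≠ 0 ∧ c i ≠ 0) ∧
    t ∈ Submodule.span F (Set.range fun i => b i ⊗ₜ[F] c i)}

/-- A tensor in `F³ ⊗ F³` is singular if it is nonzero and of rank at most two. -/
def IsSingular {F : Type*} [Field F] (t : M F) : Prop := t ≠ 0 ∧ rk t ≤ 2

/-- The tensors whose first contraction space is two-dimensional and contains a singular tensor. -/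
def Omega (F : Type*) [Field F] : Set (V F) :=
  {A | Module.finrank F (contractionSpace A) = 2 ∧ ∃ t ∈ contractionSpace A, IsSingular t}

/-! ### The projective geometry of `PG(F³ ⊗ F³)` -/

/-- The rank of a projective point is the rank of any tensor representing it. -/
def pointRk {F : Type*} [Field F] (x : ℙ F (M F)) : ℕ := rk x.rep

/-- The points of `PG(A₁)`. -/
def line {F : Type*} [Field F] (A : V F) : Set (ℙ F (M F)) :=
  {x | x.submodule ≤ contractionSpace A}

/-- The number of points of rank `j` of `PG(A₁)`, i.e. an entry of the rank distribution of `A`. -/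
def rankDist {F : Type*} [Field F] (A : V F) (j : ℕ) : ℕ∞ :=
  Set.encard {x ∈ line A | pointRk x = j}

/-- The Segre subvariety `σ(PG(U) × PG(W))` of `S₃,₃(F)`. -/
def segre {F : Type*} [Field F] (U W : Submodule F (Fin 3 → F)) : Set (ℙ F (M F)) :=
  {x | ∃ u ∈ U, ∃ w ∈ W, u ≠ 0 ∧ w ≠ 0 ∧ x.submodule = Submodule.span F {u ⊗ₜ[F] w}}

/-- The subspace of `F³ ⊗ F³` spanned by `σ(PG(U) × PG(W))`. -/
def segreSpan {F : Type*} [Field F] (U W : Submodule F (Fin 3 → F)) : Submodule F (M F) :=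
  Submodule.span F {t | ∃ u ∈ U, ∃ w ∈ W, t = u ⊗ₜ[F] w}

/-- `segre U W` is a subvariety `S₂,₂(F)` whose span contains `x`. For a point `x` of rank two there
is exactly one such subvariety, denoted `Q(x)`. -/
def IsQ {F : Type*} [Field F] (x : ℙ F (M F)) (U W : Submodule F (Fin 3 → F)) : Prop :=
  Module.finrank F U = 2 ∧ Module.finrank F W = 2 ∧ x.submodule ≤ segreSpan U W

/-- `PG(A₁)` lies in the span of some subvariety `S₂,₂(F)` of `S₃,₃(F)`. -/
def InS22 {F : Type*} [Field F] (A : V F) : Prop :=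
  ∃ U W : Submodule F (Fin 3 → F), Module.finrank F U = 2 ∧ Module.finrank F W = 2 ∧
    contractionSpace A ≤ segreSpan U W

/-- `PG(A₁)` lies in the span of some subvariety `S₂,₃(F)` of `S₃,₃(F)`. -/
def InS23 {F : Type*} [Field F] (A : V F) : Prop :=
  ∃ U : Submodule F (Fin 3 → F), Module.finrank F U = 2 ∧ contractionSpace A ≤ segreSpan U ⊤

/-- `PG(A₁)` lies in the span of some subvariety `S₃,₂(F)` of `S₃,₃(F)`. -/
def InS32 {F : Type*} [Field F] (A : V F) : Prop :=
  ∃ W : Submodule F (Fin 3 → F), Module.finrank F W = 2 ∧ contractionSpace A ≤ segreSpan ⊤ W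

/-- `x` and the subvariety `segre U W` lie in a common subvariety `S₂,₃(F)` of `S₃,₃(F)`. -/
def CommonS23 {F : Type*} [Field F] (x : ℙ F (M F)) (U W : Submodule F (Fin 3 → F)) : Prop :=
  ∃ U' : Submodule F (Fin 3 → F), Module.finrank F U' = 2 ∧ segre U W ⊆ segre U' ⊤ ∧
    x ∈ segre U' ⊤

/-- `x` and the subvariety `segre U W` lie in a common subvariety `S₃,₂(F)` of `S₃,₃(F)`. -/
def CommonS32 {F : Type*} [Field F] (x : ℙ F (M F)) (U W : Submodule F (Fin 3 → F)) : Prop :=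
  ∃ W' : Submodule F (Fin 3 → F), Module.finrank F W' = 2 ∧ segre U W ⊆ segre ⊤ W' ∧
    x ∈ segre ⊤ W'

/-- The point `x` lies on the line joining `y` and `z`. -/
def OnJoin {F : Type*} [Field F] (x y z : ℙ F (M F)) : Prop :=
  x.submodule ≤ y.submodule ⊔ z.submodule

/-- The point `x` lies on a secant of the Segre variety `S₃,₃(F)` through `z`. (It is applied to
points `x` of rank two and `z` of rank one, so the line is not contained in the variety.) -/
def OnSecantThrough {F : Type*} [Field F] (z x : ℙ F (M F)) : Prop :=
  ∃ y ∈ segre (⊤ : Submodule F (Fin 3 → F)) ⊤, y ≠ z ∧ OnJoin x z y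

/-! ### The sixteen geometric types of tensors in `Ω` -/

/-- `PG(A₁) = σ(point × line)`. -/
def o4 (F : Type*) [Field F] : Set (V F) :=
  {A ∈ Omega F | ∃ U W : Submodule F (Fin 3 → F), Module.finrank F U = 1 ∧
    Module.finrank F W = 2 ∧ line A = segre U W}

/-- `PG(A₁) = σ(line × point)`. -/
def o4T (F : Type*) [Field F] : Set (V F) :=
  {A ∈ Omega F | ∃ U W : Submodule F (Fin 3 → F), Module.finrank F U = 2 ∧
    Module.finrank F W = 1 ∧ line A = segre U W}

/-- `PG(A₁)` has exactly two points of rank one. -/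
def o5 (F : Type*) [Field F] : Set (V F) := {A ∈ Omega F | rankDist A 1 = 2}

/-- `PG(A₁)` has exactly one point `x₁` of rank one, and `x₁ ∈ Q(x₂)` for a point `x₂` of rank two
of `PG(A₁)`. -/
def o6 (F : Type*) [Field F] : Set (V F) :=
  {A ∈ Omega F | rankDist A 1 = 1 ∧ ∃ x₁ ∈ line A, ∃ x₂ ∈ line A, pointRk x₁ = 1 ∧
    pointRk x₂ = 2 ∧ ∃ U W, IsQ x₂ U W ∧ x₁ ∈ segre U W}

/-- `PG(A₁)` has exactly one point `x₁` of rank one, and a point `x₂` of rank two such that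
`x₁ ∉ Q(x₂)`, but `x₁` lies in a subvariety `S₂,₃(F)` containing `Q(x₂)`. -/
def o7 (F : Type*) [Field F] : Set (V F) :=
  {A ∈ Omega F | rankDist A 1 = 1 ∧ ∃ x₁ ∈ line A, ∃ x₂ ∈ line A, pointRk x₁ = 1 ∧
    pointRk x₂ = 2 ∧ ∃ U W, IsQ x₂ U W ∧ x₁ ∉ segre U W ∧ CommonS23 x₁ U W}

/-- As `o7`, with `S₃,₂(F)` in place of `S₂,₃(F)`. -/
def o7T (F : Type*) [Field F] : Set (V F) :=
  {A ∈ Omega F | rankDist A 1 = 1 ∧ ∃ x₁ ∈ line A, ∃ x₂ ∈ line A, pointRk x₁ = 1 ∧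
    pointRk x₂ = 2 ∧ ∃ U W, IsQ x₂ U W ∧ x₁ ∉ segre U W ∧ CommonS32 x₁ U W}

/-- `PG(A₁)` has exactly one point `x₁` of rank one, and a point `x₂` of rank two such that `x₁` lies
in no subvariety `S₂,₃(F)` or `S₃,₂(F)` containing `Q(x₂)`. -/
def o8 (F : Type*) [Field F] : Set (V F) :=
  {A ∈ Omega F | rankDist A 1 = 1 ∧ ∃ x₁ ∈ line A, ∃ x₂ ∈ line A, pointRk x₁ = 1 ∧
    pointRk x₂ = 2 ∧ ∃ U W, IsQ x₂ U W ∧ ¬ CommonS23 x₁ U W ∧ ¬ CommonS32 x₁ U W}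

/-- `PG(A₁)` has exactly one point of rank one and no point of rank two. -/
def o9 (F : Type*) [Field F] : Set (V F) :=
  {A ∈ Omega F | rankDist A 1 = 1 ∧ rankDist A 2 = 0}

/-- `PG(A₁)` lies in the solid spanned by a subvariety `S₂,₂(F)` and is disjoint from it. -/
def o10 (F : Type*) [Field F] : Set (V F) :=
  {A ∈ Omega F | ∃ U W : Submodule F (Fin 3 → F), Module.finrank F U = 2 ∧
    Module.finrank F W = 2 ∧ contractionSpace A ≤ segreSpan U W ∧ Disjoint (line A) (segre U W)}

/-- `PG(A₁)` is disjoint from `S₃,₃(F)` and lies in the span of a subvariety `S₂,₃(F)`, but in the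
span of no subvariety `S₂,₂(F)`. -/
def o11 (F : Type*) [Field F] : Set (V F) :=
  {A ∈ Omega F | Disjoint (line A) (segre ⊤ ⊤) ∧ InS23 A ∧ ¬ InS22 A}

/-- As `o11`, with `S₃,₂(F)` in place of `S₂,₃(F)`. -/
def o11T (F : Type*) [Field F] : Set (V F) :=
  {A ∈ Omega F | Disjoint (line A) (segre ⊤ ⊤) ∧ InS32 A ∧ ¬ InS22 A}

/-- `PG(A₁)` has no point of rank one, lies in the span of no `S₂,₃(F)` or `S₃,₂(F)`, and contains
two points `x₁`, `x₂` of rank two such that `Q(x₁)` and `Q(x₂)` meet in exactly one point `z`, where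
`x₁`, `x₂`, `z` satisfy the condition `C z x₁ x₂`. -/
def twoSingularPoints {F : Type*} [Field F]
    (C : ℙ F (M F) → ℙ F (M F) → ℙ F (M F) → Prop) : Set (V F) :=
  {A ∈ Omega F | rankDist A 1 = 0 ∧ ¬ InS23 A ∧ ¬ InS32 A ∧
    ∃ x₁ ∈ line A, ∃ x₂ ∈ line A, x₁ ≠ x₂ ∧ pointRk x₁ = 2 ∧ pointRk x₂ = 2 ∧
      ∃ U₁ W₁ U₂ W₂ z, IsQ x₁ U₁ W₁ ∧ IsQ x₂ U₂ W₂ ∧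
        segre U₁ W₁ ∩ segre U₂ W₂ = {z} ∧ C z x₁ x₂}

/-- None of `x₁`, `x₂` lies on a secant through `z`. -/
def o12 (F : Type*) [Field F] : Set (V F) :=
  twoSingularPoints fun z x₁ x₂ => ¬ OnSecantThrough z x₁ ∧ ¬ OnSecantThrough z x₂

/-- Exactly one of `x₁`, `x₂` lies on a secant through `z`. -/
def o13 (F : Type*) [Field F] : Set (V F) :=
  twoSingularPoints fun z x₁ x₂ => Xor (OnSecantThrough z x₁) (OnSecantThrough z x₂)

/-- Both `x₁` and `x₂` lie on a secant through `z`. -/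
def o14 (F : Type*) [Field F] : Set (V F) :=
  twoSingularPoints fun z x₁ x₂ => OnSecantThrough z x₁ ∧ OnSecantThrough z x₂

/-- `x₁` lies on a line joining a point `y₁` of rank one to a point `y₂` of rank two with
`Q(y₂) = Q(x₂)`. -/
def Splits {F : Type*} [Field F] (x₁ x₂ : ℙ F (M F)) : Prop :=
  ∃ y₁ y₂ : ℙ F (M F), pointRk y₁ = 1 ∧ pointRk y₂ = 2 ∧ OnJoin x₁ y₁ y₂ ∧
    ∃ U W, IsQ x₂ U W ∧ IsQ y₂ U W

/-- `PG(A₁)` has no point of rank one and exactly one point `x₂` of rank two, and it has a point `x₁`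
of rank three on a line joining points `y₁`, `y₂` of ranks one and two with `Q(y₂) = Q(x₂)`. -/
def o15 (F : Type*) [Field F] : Set (V F) :=
  {A ∈ Omega F | rankDist A 1 = 0 ∧ rankDist A 2 = 1 ∧ ∃ x₁ ∈ line A, ∃ x₂ ∈ line A,
    pointRk x₁ = 3 ∧ pointRk x₂ = 2 ∧ Splits x₁ x₂}

/-- `PG(A₁)` has no point of rank one and exactly one point `x₂` of rank two, and it has a point `x₁`
of rank three on no line joining points `y₁`, `y₂` of ranks one and two with `Q(y₂) = Q(x₂)`. -/
def o16 (F : Type*) [Field F] : Set (V F) :=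
  {A ∈ Omega F | rankDist A 1 = 0 ∧ rankDist A 2 = 1 ∧ ∃ x₁ ∈ line A, ∃ x₂ ∈ line A,
    pointRk x₁ = 3 ∧ pointRk x₂ = 2 ∧ ¬ Splits x₁ x₂}

end

end Tensor233

open Tensor233

/-!
A tensor `A ∈ F² ⊗ F³ ⊗ F³` with `dim A₁ = 2` is determined by the pencil `A₁ ≤ F³ ⊗ F³` up to the
action of `GL(F²)` (`exists_smul_tens_eq`). Hence the `H`-orbits on `Ω` correspond to the
two-dimensional spaces of `3 × 3` matrices that contain a singular matrix, up to changes of bases on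
both sides. The classification rests on three facts.

* The sixteen geometric types cover `Ω` (`exists_type`). This is a case distinction on the numbers of
  points of ranks one and two on the line and on their position relative to the quadrics `Q(x)`.
* Each type is contained in the orbit of one explicit tensor `canon γ δ i` (the lemmas
  `o4_subset_orbit` to `o16_subset_orbit`): the geometric condition provides bases in which the
  generators of the pencil are sums of basis tensors. The basic tool is `secant_or_tangent`, which
  describes a matrix of rank two relative to a pure tensor of the span of its quadric. For `o10` and
  `o15` the pencil contains a nonsingular pencil of `2 × 2` matrices without pure tensors, that is, an
  anisotropic binary quadratic form. All these forms are equivalent over a finite or real closed field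
  (`exists_isUniversal`), and there are none over an algebraically closed field (`not_anisotropic`).
* The canonical tensors are pairwise inequivalent: common kernels, pure tensors, the number of singular
  points and the multiplicities of the zeros of the determinant are invariants of pencils, and
  together they distinguish the canonical tensors (`code_map`, `code_canon`).

Since `Ω` is `H`-invariant and contains the canonical tensors, it follows that every nonempty type is
a whole `H`-orbit (`oType_eq_orbit`).

The group `G` is generated by `H` and the interchange of the two three-dimensional factors
(`mem_H_or_mul_swap_mem_H`). Indeed, a linear map with pure values only has a constant first or a
constant second factor (`exists_const_factor`), because a vector space is not the union of two proper
subspaces. As `F³` does not embed in `F²`, an element of `G` therefore maps each `a ⊗ F³ ⊗ F³` into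
some `x ⊗ F³ ⊗ F³`, which splits off the factor `F²`; the two ways in which an automorphism of
`F³ ⊗ F³` can preserve pure tensors cannot be mixed. The interchange permutes the canonical tensors,
joining each of `o4`, `o7`, `o11` to its transpose and fixing the other types.
-/

namespace Tensor233

open scoped TensorProduct Pointwise LinearAlgebra.Projectivization

/-! ### Tensor rank -/

section Rank

variable {F E₁ E₂ : Type*} [Field F] [AddCommGroup E₁] [Module F E₁] [AddCommGroup E₂] [Module F E₂]

/-- A linear relation between the second factors eliminates one summand. -/
theorem exists_shorter_of_not_linearIndependent {k : ℕ} (u : Fin (k + 1) → E₁)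
    (w : Fin (k + 1) → E₂) (hw : ¬ LinearIndependent F w) :
    ∃ (u' : Fin k → E₁) (w' : Fin k → E₂), ∑ i, u i ⊗ₜ[F] w i = ∑ i, u' i ⊗ₜ[F] w' i := by
  obtain ⟨c, hc, i, hi⟩ := Fintype.not_linearIndependent_iff.1 hw
  -- solve the relation for `w i` and collect its terms with the other summands
  rw [Fin.sum_univ_succAbove _ i] at hc
  have hwi : w i = ∑ j, (-(c i)⁻¹ * c (i.succAbove j)) • w (i.succAbove j) := by
    have h1 : c i • w i = -∑ j, c (i.succAbove j) • w (i.succAbove j) := eq_neg_of_add_eq_zero_left hc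
    calc w i = (c i)⁻¹ • (c i • w i) := by rw [smul_smul, inv_mul_cancel₀ hi, one_smul]
      _ = _ := by
        rw [h1, smul_neg, Finset.smul_sum, ← Finset.sum_neg_distrib]
        refine Finset.sum_congr rfl fun j _ => ?_
        rw [smul_smul, neg_mul, neg_smul]
  refine ⟨fun j => u (i.succAbove j) + (-(c i)⁻¹ * c (i.succAbove j)) • u i,
    fun j => w (i.succAbove j), ?_⟩
  rw [Fin.sum_univ_succAbove _ i]
  conv_lhs => rw [hwi]
  rw [TensorProduct.tmul_sum, ← Finset.sum_add_distrib]
  refine Finset.sum_congr rfl fun j _ => ?_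
  rw [TensorProduct.add_tmul, TensorProduct.tmul_smul, TensorProduct.smul_tmul', add_comm]

/-- A sum of `k` pure tensors can be shortened until both families of factors are independent. -/
theorem exists_linearIndependent_sum (k : ℕ) : ∀ (u : Fin k → E₁) (w : Fin k → E₂),
    ∃ k' ≤ k, ∃ (u' : Fin k' → E₁) (w' : Fin k' → E₂), LinearIndependent F u' ∧
      LinearIndependent F w' ∧ ∑ i, u i ⊗ₜ[F] w i = ∑ i, u' i ⊗ₜ[F] w' i ∧
      (k' = k → LinearIndependent F u ∧ LinearIndependent F w) := by
  induction k with
  | zero =>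
    intro u w
    exact ⟨0, le_rfl, u, w, linearIndependent_empty_type, linearIndependent_empty_type, rfl,
      fun _ => ⟨linearIndependent_empty_type, linearIndependent_empty_type⟩⟩
  | succ k ih =>
    intro u w
    by_cases h : LinearIndependent F u ∧ LinearIndependent F w
    · exact ⟨k + 1, le_rfl, u, w, h.1, h.2, rfl, fun _ => h⟩
    have key : ∃ (u' : Fin k → E₁) (w' : Fin k → E₂),
        ∑ i, u i ⊗ₜ[F] w i = ∑ i, u' i ⊗ₜ[F] w' i := by
      by_cases hw : LinearIndependent F w
      · have hu : ¬ LinearIndependent F u := fun hu => h ⟨hu, hw⟩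
        obtain ⟨w', u', e⟩ := exists_shorter_of_not_linearIndependent w u hu
        refine ⟨u', w', (TensorProduct.comm F E₁ E₂).injective ?_⟩
        simpa [map_sum] using e
      · exact exists_shorter_of_not_linearIndependent u w hw
    obtain ⟨u', w', e⟩ := key
    obtain ⟨k', hk, u'', w'', h1, h2, h3, -⟩ := ih u' w'
    exact ⟨k', by omega, u'', w'', h1, h2, e.trans h3, fun h => by omega⟩

/-- Contraction of the first factor shows that the second factors lie in the span of the second
factors of any other expression of the same tensor. -/
theorem le_of_mem_span_tmul {k m : ℕ} {u : Fin k → E₁} {w : Fin k → E₂}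
    (hu : LinearIndependent F u) (hw : LinearIndependent F w) {b : Fin m → E₁} {c : Fin m → E₂}
    (h : ∑ i, u i ⊗ₜ[F] w i ∈ Submodule.span F (Set.range fun j => b j ⊗ₜ[F] c j)) : k ≤ m := by
  obtain ⟨a, ha⟩ := (Submodule.mem_span_range_iff_exists_fun F).1 h
  have hmem : ∀ i, w i ∈ Submodule.span F (Set.range c) := by
    intro i
    -- contract with a functional dual to `u i` on the span of the `u j`
    obtain ⟨f, hf⟩ := (Module.Basis.span hu).coord i |>.exists_extend
    have hfu : ∀ j, f (u j) = if j = i then 1 else 0 := by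
      intro j
      have h1 : u j = (Submodule.span F (Set.range u)).subtype (Module.Basis.span hu j) := by
        simp [Module.Basis.span_apply]
      rw [h1, ← LinearMap.comp_apply, hf]
      simp [Finsupp.single_apply, eq_comm]
    have h2 := congrArg (fun t => (TensorProduct.lid F E₂) (LinearMap.rTensor E₂ f t)) ha
    simp only [map_sum, map_smul, LinearMap.rTensor_tmul, TensorProduct.lid_tmul, hfu, ite_smul,
      one_smul, zero_smul, Finset.sum_ite_eq', Finset.mem_univ, if_true] at h2
    rw [← h2]
    exact Submodule.sum_mem _ fun j _ => Submodule.smul_mem _ _ (Submodule.smul_mem _ _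
      (Submodule.subset_span ⟨j, rfl⟩))
  have hle : Submodule.span F (Set.range w) ≤ Submodule.span F (Set.range c) :=
    Submodule.span_le.2 (by rintro _ ⟨i, rfl⟩; exact hmem i)
  have : Module.Finite F (Submodule.span F (Set.range c)) :=
    Module.Finite.span_of_finite F (Set.finite_range c)
  calc k = Module.finrank F (Submodule.span F (Set.range w)) := by
        rw [finrank_span_eq_card hw, Fintype.card_fin]
    _ ≤ Module.finrank F (Submodule.span F (Set.range c)) := Submodule.finrank_mono hle
    _ ≤ m := (finrank_range_le_card (R := F) c).trans (by simp)

end Rank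

section

variable {F : Type*} [Field F]

/-- Independence of both families of factors makes an expression as a sum of pure tensors minimal,
so that `rk` is the usual matrix rank. -/
theorem rk_sum_eq {k : ℕ} {u w : Fin k → (Fin 3 → F)} (hu : LinearIndependent F u)
    (hw : LinearIndependent F w) : rk (F := F) (∑ i, u i ⊗ₜ[F] w i) = k := by
  have hmem : k ∈ {k | ∃ b c : Fin k → (Fin 3 → F), (∀ i, b i ≠ 0 ∧ c i ≠ 0) ∧
      ∑ i, u i ⊗ₜ[F] w i ∈ Submodule.span F (Set.range fun i => b i ⊗ₜ[F] c i)} :=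
    ⟨u, w, fun i => ⟨hu.ne_zero i, hw.ne_zero i⟩,
      Submodule.sum_mem _ fun i _ => Submodule.subset_span ⟨i, rfl⟩⟩
  refine le_antisymm (Nat.sInf_le hmem) ?_
  obtain ⟨b, c, -, h⟩ := Nat.sInf_mem ⟨k, hmem⟩
  exact le_of_mem_span_tmul hu hw h

theorem rk_sum_le {k : ℕ} (u w : Fin k → (Fin 3 → F)) : rk (F := F) (∑ i, u i ⊗ₜ[F] w i) ≤ k := by
  obtain ⟨k', hk, u', w', h1, h2, h3, -⟩ := exists_linearIndependent_sum (F := F) k u w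
  rw [h3, rk_sum_eq h1 h2]
  exact hk

theorem linearIndependent_of_rk_eq {k : ℕ} {u w : Fin k → (Fin 3 → F)}
    (h : rk (F := F) (∑ i, u i ⊗ₜ[F] w i) = k) : LinearIndependent F u ∧ LinearIndependent F w := by
  obtain ⟨k', hk, u', w', h1, h2, h3, h4⟩ := exists_linearIndependent_sum (F := F) k u w
  rw [h3, rk_sum_eq h1 h2] at h
  exact h4 h

theorem exists_eq_sum_three (t : M F) : ∃ w : Fin 3 → (Fin 3 → F),
    t = ∑ i, (Pi.single i 1 : Fin 3 → F) ⊗ₜ[F] w i := by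
  induction t using TensorProduct.induction_on with
  | zero => exact ⟨0, by simp⟩
  | tmul u w =>
    refine ⟨fun i => u i • w, ?_⟩
    conv_lhs => rw [pi_eq_sum_univ' u]
    rw [TensorProduct.sum_tmul]
    refine Finset.sum_congr rfl fun i _ => ?_
    rw [TensorProduct.tmul_smul, TensorProduct.smul_tmul']
  | add x y hx hy =>
    obtain ⟨a, ha⟩ := hx
    obtain ⟨b, hb⟩ := hy
    exact ⟨a + b, by simp [ha, hb, TensorProduct.tmul_add, Finset.sum_add_distrib]⟩

theorem exists_eq_sum_of_rk_eq {t : M F} {k : ℕ} (h : rk t = k) :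
    ∃ u w : Fin k → (Fin 3 → F), LinearIndependent F u ∧ LinearIndependent F w ∧
      t = ∑ i, u i ⊗ₜ[F] w i := by
  obtain ⟨w, hw⟩ := exists_eq_sum_three t
  obtain ⟨k', hk, u', w', h1, h2, h3, -⟩ := exists_linearIndependent_sum (F := F) 3
    (fun i => (Pi.single i 1 : Fin 3 → F)) w
  have e : t = ∑ i, u' i ⊗ₜ[F] w' i := hw.trans h3
  have : k = k' := by rw [← h, e, rk_sum_eq h1 h2]
  subst this
  exact ⟨u', w', h1, h2, e⟩

theorem rk_le_three (t : M F) : rk t ≤ 3 := by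
  obtain ⟨w, hw⟩ := exists_eq_sum_three t
  rw [hw]
  exact rk_sum_le _ _

@[simp] theorem rk_zero : rk (0 : M F) = 0 := by
  have := rk_sum_le (F := F) (k := 0) (fun _ => 0) (fun _ => 0)
  simpa using this

theorem rk_eq_zero {t : M F} : rk t = 0 ↔ t = 0 := by
  refine ⟨fun h => ?_, fun h => h ▸ rk_zero⟩
  obtain ⟨u, w, -, -, e⟩ := exists_eq_sum_of_rk_eq h
  simpa using e

theorem rk_tmul_le (u w : Fin 3 → F) : rk (u ⊗ₜ[F] w) ≤ 1 := by
  have := rk_sum_le (k := 1) (fun _ => u) (fun _ => w)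
  simpa using this

theorem tmul_ne_zero {E₁ E₂ : Type*} [AddCommGroup E₁] [Module F E₁] [AddCommGroup E₂] [Module F E₂]
    {u : E₁} {w : E₂} (hu : u ≠ 0) (hw : w ≠ 0) : u ⊗ₜ[F] w ≠ 0 := by
  intro h
  have := le_of_mem_span_tmul (F := F) (k := 1) (m := 0) (u := fun _ => u) (w := fun _ => w)
    (linearIndependent_unique_iff.2 hu) (linearIndependent_unique_iff.2 hw)
    (b := fun _ => 0) (c := fun _ => 0) (by simp [h])
  omega

theorem rk_tmul {u w : Fin 3 → F} (hu : u ≠ 0) (hw : w ≠ 0) : rk (u ⊗ₜ[F] w) = 1 := by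
  refine le_antisymm (rk_tmul_le u w) (Nat.one_le_iff_ne_zero.2 fun h => ?_)
  exact tmul_ne_zero hu hw (rk_eq_zero.1 h)

theorem rk_eq_one {t : M F} (h : rk t = 1) : ∃ u w : Fin 3 → F, u ≠ 0 ∧ w ≠ 0 ∧ t = u ⊗ₜ w := by
  obtain ⟨u, w, hu, hw, e⟩ := exists_eq_sum_of_rk_eq h
  exact ⟨u 0, w 0, hu.ne_zero 0, hw.ne_zero 0, by simpa using e⟩

theorem rk_add_le (u₁ u₂ w₁ w₂ : Fin 3 → F) : rk (u₁ ⊗ₜ[F] w₁ + u₂ ⊗ₜ[F] w₂) ≤ 2 := by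
  have := rk_sum_le ![u₁, u₂] ![w₁, w₂]
  simpa [Fin.sum_univ_two] using this

theorem rk_eq_two_iff {u₁ u₂ w₁ w₂ : Fin 3 → F} : rk (u₁ ⊗ₜ[F] w₁ + u₂ ⊗ₜ[F] w₂) = 2 ↔
    LinearIndependent F ![u₁, u₂] ∧ LinearIndependent F ![w₁, w₂] := by
  have e : u₁ ⊗ₜ[F] w₁ + u₂ ⊗ₜ[F] w₂ = ∑ i, (![u₁, u₂] i) ⊗ₜ[F] (![w₁, w₂] i) := by
    simp [Fin.sum_univ_two]
  rw [e]
  exact ⟨linearIndependent_of_rk_eq, fun h => rk_sum_eq h.1 h.2⟩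

theorem rk_eq_three_iff {u₁ u₂ u₃ w₁ w₂ w₃ : Fin 3 → F} :
    rk (u₁ ⊗ₜ[F] w₁ + u₂ ⊗ₜ[F] w₂ + u₃ ⊗ₜ[F] w₃) = 3 ↔
    LinearIndependent F ![u₁, u₂, u₃] ∧ LinearIndependent F ![w₁, w₂, w₃] := by
  have e : u₁ ⊗ₜ[F] w₁ + u₂ ⊗ₜ[F] w₂ + u₃ ⊗ₜ[F] w₃ =
      ∑ i, (![u₁, u₂, u₃] i) ⊗ₜ[F] (![w₁, w₂, w₃] i) := by
    simp [Fin.sum_univ_three]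
  rw [e]
  exact ⟨linearIndependent_of_rk_eq, fun h => rk_sum_eq h.1 h.2⟩

theorem exists_of_rk_le_two {t : M F} (h : rk t ≤ 2) :
    ∃ u₁ u₂ w₁ w₂ : Fin 3 → F, t = u₁ ⊗ₜ w₁ + u₂ ⊗ₜ w₂ := by
  rcases Nat.lt_or_ge (rk t) 2 with h2 | h2
  · rcases Nat.lt_or_ge (rk t) 1 with h1 | h1
    · have : t = 0 := rk_eq_zero.1 (by omega)
      exact ⟨0, 0, 0, 0, by simp [this]⟩
    · obtain ⟨u, w, -, -, e⟩ := rk_eq_one (t := t) (by omega)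
      exact ⟨u, 0, w, 0, by simp [e]⟩
  · obtain ⟨u, w, -, -, e⟩ := exists_eq_sum_of_rk_eq (t := t) (k := 2) (by omega)
    exact ⟨u 0, u 1, w 0, w 1, by rw [e, Fin.sum_univ_two]⟩

theorem rk_congr (g h : (Fin 3 → F) ≃ₗ[F] (Fin 3 → F)) (t : M F) :
    rk (TensorProduct.congr g h t) = rk t := by
  obtain ⟨u, w, hu, hw, e⟩ := exists_eq_sum_of_rk_eq (t := t) rfl
  have e' : TensorProduct.congr g h t = ∑ i, g (u i) ⊗ₜ[F] h (w i) := by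
    conv_lhs => rw [e]
    simp [map_sum]
  rw [e']
  exact rk_sum_eq (hu.map' g.toLinearMap g.ker) (hw.map' h.toLinearMap h.ker)

theorem rk_smul {c : F} (hc : c ≠ 0) (t : M F) : rk (c • t) = rk t := by
  obtain ⟨u, w, hu, hw, e⟩ := exists_eq_sum_of_rk_eq (t := t) rfl
  have e' : c • t = ∑ i, (c • u i) ⊗ₜ[F] w i := by
    conv_lhs => rw [e]
    simp [Finset.smul_sum, TensorProduct.smul_tmul']
  rw [e']
  refine rk_sum_eq ?_ hw
  exact hu.map' (LinearMap.lsmul F (Fin 3 → F) c) (by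
    rw [LinearMap.ker_eq_bot]; exact smul_right_injective _ hc)

/-! ### Points and vectors -/

theorem pointRk_mk {t : M F} (ht : t ≠ 0) : pointRk (Projectivization.mk F t ht) = rk t := by
  obtain ⟨a, ha⟩ := Projectivization.exists_smul_eq_mk_rep F t ht
  rw [pointRk, ← ha]
  exact rk_smul a.ne_zero t

theorem mk_mem_line {A : V F} {t : M F} (ht : t ≠ 0) :
    Projectivization.mk F t ht ∈ line A ↔ t ∈ contractionSpace A := by
  simp [line, Projectivization.submodule_mk, Submodule.span_singleton_le_iff_mem]

theorem rep_mem_of_mem_line {A : V F} {x : ℙ F (M F)} (h : x ∈ line A) :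
    x.rep ∈ contractionSpace A := by
  have h : x.submodule ≤ _ := h
  rwa [Projectivization.submodule_eq, Submodule.span_singleton_le_iff_mem] at h

theorem rankDist_eq_zero_iff {A : V F} {j : ℕ} :
    rankDist A j = 0 ↔ ∀ t ∈ contractionSpace A, t ≠ 0 → rk t ≠ j := by
  rw [rankDist, Set.encard_eq_zero, Set.eq_empty_iff_forall_notMem]
  constructor
  · intro h t ht h0 hj
    exact h (Projectivization.mk F t h0) ⟨(mk_mem_line h0).2 ht, by rw [pointRk_mk, hj]⟩
  · rintro h x ⟨hx, hj⟩
    exact h _ (rep_mem_of_mem_line hx) x.rep_nonzero hj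

theorem rankDist_eq_one_iff {A : V F} {j : ℕ} :
    rankDist A j = 1 ↔ ∃ t ∈ contractionSpace A, t ≠ 0 ∧ rk t = j ∧
      ∀ s ∈ contractionSpace A, s ≠ 0 → rk s = j → ∃ c : F, c ≠ 0 ∧ s = c • t := by
  rw [rankDist, Set.encard_eq_one]
  constructor
  · rintro ⟨x, hx⟩
    have hx' : x ∈ {x ∈ line A | pointRk x = j} := hx ▸ rfl
    refine ⟨x.rep, rep_mem_of_mem_line hx'.1, x.rep_nonzero, hx'.2, fun s hs h0 hj => ?_⟩
    have : Projectivization.mk F s h0 ∈ {x ∈ line A | pointRk x = j} :=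
      ⟨(mk_mem_line h0).2 hs, by rw [pointRk_mk, hj]⟩
    rw [hx, Set.mem_singleton_iff, ← x.mk_rep, Projectivization.mk_eq_mk_iff] at this
    obtain ⟨a, ha⟩ := this
    exact ⟨a, a.ne_zero, ha.symm⟩
  · rintro ⟨t, ht, h0, hj, huniq⟩
    refine ⟨Projectivization.mk F t h0, Set.eq_singleton_iff_unique_mem.2
      ⟨⟨(mk_mem_line h0).2 ht, by rw [pointRk_mk, hj]⟩, ?_⟩⟩
    rintro x ⟨hx, hxj⟩
    obtain ⟨c, hc, e⟩ := huniq _ (rep_mem_of_mem_line hx) x.rep_nonzero hxj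
    rw [← x.mk_rep, Projectivization.mk_eq_mk_iff']
    exact ⟨c, e.symm⟩

theorem mk_mem_segre {u w : Fin 3 → F} (hu : u ≠ 0) (hw : w ≠ 0)
    {U W : Submodule F (Fin 3 → F)} (huU : u ∈ U) (hwW : w ∈ W) :
    Projectivization.mk F (u ⊗ₜ[F] w) (tmul_ne_zero hu hw) ∈ segre U W :=
  ⟨u, huU, w, hwW, hu, hw, Projectivization.submodule_mk _ _⟩

theorem exists_smul_of_tmul_eq_left {E₁ E₂ : Type*} [AddCommGroup E₁] [Module F E₁]
    [AddCommGroup E₂] [Module F E₂] {u u' : E₁} {w w' : E₂} (hu : u ≠ 0) (hw : w ≠ 0)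
    (h : u ⊗ₜ[F] w = u' ⊗ₜ[F] w') : ∃ c : F, c ≠ 0 ∧ w = c • w' := by
  obtain ⟨f, hf⟩ : ∃ f : Module.Dual F E₁, f u ≠ 0 := by
    by_contra! hf
    exact hu ((Module.forall_dual_apply_eq_zero_iff F u).1 hf)
  have h1 := congrArg (fun t => (TensorProduct.lid F E₂) (LinearMap.rTensor E₂ f t)) h
  simp only [LinearMap.rTensor_tmul, TensorProduct.lid_tmul] at h1
  have h2 : w = ((f u)⁻¹ * f u') • w' := by
    rw [mul_smul, ← h1, smul_smul, inv_mul_cancel₀ hf, one_smul]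
  refine ⟨_, fun h0 => hw ?_, h2⟩
  rw [h2, h0, zero_smul]

theorem exists_smul_of_tmul_eq_right {E₁ E₂ : Type*} [AddCommGroup E₁] [Module F E₁]
    [AddCommGroup E₂] [Module F E₂] {u u' : E₁} {w w' : E₂} (hu : u ≠ 0) (hw : w ≠ 0)
    (h : u ⊗ₜ[F] w = u' ⊗ₜ[F] w') : ∃ c : F, c ≠ 0 ∧ u = c • u' :=
  exists_smul_of_tmul_eq_left hw hu (by simpa using congrArg (TensorProduct.comm F E₁ E₂) h)

theorem exists_of_mem_segre {t : M F} (ht : t ≠ 0) {U W : Submodule F (Fin 3 → F)}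
    (h : Projectivization.mk F t ht ∈ segre U W) :
    ∃ u ∈ U, ∃ w ∈ W, u ≠ 0 ∧ w ≠ 0 ∧ t = u ⊗ₜ w := by
  obtain ⟨u, hu, w, hw, hu0, hw0, e⟩ := h
  have : t ∈ (Projectivization.mk F t ht).submodule := by
    rw [Projectivization.submodule_mk]; exact Submodule.mem_span_singleton_self t
  rw [e, Submodule.mem_span_singleton] at this
  obtain ⟨c, hc⟩ := this
  refine ⟨c • u, U.smul_mem c hu, w, hw, smul_ne_zero ?_ hu0, hw0, by
    rw [← hc, TensorProduct.smul_tmul']⟩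
  rintro rfl
  exact ht (by rw [← hc, zero_smul])

/-! ### Linear algebra in small dimension -/

theorem linearIndependent_triple_iff {E : Type*} [AddCommGroup E] [Module F E] {x y z : E} :
    LinearIndependent F ![x, y, z] ↔
      ∀ r s t : F, r • x + s • y + t • z = 0 → r = 0 ∧ s = 0 ∧ t = 0 := by
  rw [Fintype.linearIndependent_iff]
  constructor
  · intro h r s t e
    have := h ![r, s, t] (by simpa [Fin.sum_univ_three] using e)
    exact ⟨this 0, this 1, this 2⟩
  · intro h g e i
    have := h (g 0) (g 1) (g 2) (by simpa [Fin.sum_univ_three] using e)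
    fin_cases i
    exacts [this.1, this.2.1, this.2.2]

theorem linearIndependent_triple_of_notMem {E : Type*} [AddCommGroup E] [Module F E] {x y z : E}
    (hxy : LinearIndependent F ![x, y]) {U : Submodule F E} (hx : x ∈ U) (hy : y ∈ U)
    (hz : z ∉ U) : LinearIndependent F ![x, y, z] := by
  rw [linearIndependent_triple_iff]
  intro r s t e
  have ht : t = 0 := by
    by_contra ht
    apply hz
    have : z = (-(t⁻¹ * r)) • x + (-(t⁻¹ * s)) • y := by
      have h1 : t • z = -(r • x + s • y) := by rw [← sub_eq_zero, sub_neg_eq_add, ← e]; abel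
      have h2 : z = t⁻¹ • (t • z) := by rw [smul_smul, inv_mul_cancel₀ ht, one_smul]
      rw [h2, h1]; module
    rw [this]
    exact U.add_mem (U.smul_mem _ hx) (U.smul_mem _ hy)
  subst ht
  have := LinearIndependent.pair_iff.1 hxy r s (by simpa using e)
  exact ⟨this.1, this.2, rfl⟩

theorem range_pair {E : Type*} (x y : E) : Set.range ![x, y] = {x, y} := by
  ext z
  simp [eq_comm, or_comm]

theorem eq_span_pair_of_finrank_eq_two {E : Type*} [AddCommGroup E] [Module F E]
    {U : Submodule F E} (hU : Module.finrank F U = 2) {x y : E} (hx : x ∈ U) (hy : y ∈ U)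
    (h : LinearIndependent F ![x, y]) : U = Submodule.span F {x, y} := by
  have : FiniteDimensional F U := Module.finite_of_finrank_pos (by omega)
  symm
  apply Submodule.eq_of_le_of_finrank_eq
  · rw [Submodule.span_le]
    rintro _ (rfl | rfl) <;> assumption
  · have := finrank_span_eq_card h
    rw [range_pair, Fintype.card_fin] at this
    rw [hU, this]

theorem exists_pair_of_finrank_eq_two {E : Type*} [AddCommGroup E] [Module F E]
    {U : Submodule F E} (hU : Module.finrank F U = 2) {x : E} (hx0 : x ≠ 0) :
    ∃ y ∈ U, LinearIndependent F ![x, y] := by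
  by_contra! h
  have hle : U ≤ Submodule.span F {x} := by
    intro y hy
    have := h y hy
    rw [LinearIndependent.pair_iff' hx0] at this
    push Not at this
    obtain ⟨a, rfl⟩ := this
    exact Submodule.smul_mem _ _ (Submodule.mem_span_singleton_self x)
  have h1 := Submodule.finrank_mono hle
  rw [hU, finrank_span_singleton hx0] at h1
  omega

theorem exists_ne_zero_of_finrank_pos {E : Type*} [AddCommGroup E] [Module F E]
    {U : Submodule F E} (hU : 0 < Module.finrank F U) : ∃ x ∈ U, x ≠ 0 := by
  have : U ≠ ⊥ := by rintro rfl; simp at hU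
  exact Submodule.exists_mem_ne_zero_of_ne_bot this

theorem finrank_span_pair {E : Type*} [AddCommGroup E] [Module F E] {x y : E}
    (h : LinearIndependent F ![x, y]) : Module.finrank F (Submodule.span F {x, y}) = 2 := by
  have := finrank_span_eq_card h
  rwa [range_pair, Fintype.card_fin] at this

theorem exists_notMem_of_finrank_eq_two {U : Submodule F (Fin 3 → F)}
    (hU : Module.finrank F U = 2) : ∃ x, x ∉ U := by
  by_contra! h
  have : U = ⊤ := Submodule.eq_top_iff'.2 h
  subst this
  simp at hU

theorem exists_triple_of_pair {x y : Fin 3 → F} (h : LinearIndependent F ![x, y]) :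
    ∃ z, LinearIndependent F ![x, y, z] := by
  have h2 : Module.finrank F (Submodule.span F {x, y}) = 2 := finrank_span_pair h
  obtain ⟨z, hz⟩ := exists_notMem_of_finrank_eq_two h2
  have hx : x ∈ Submodule.span F {x, y} := Submodule.subset_span (Set.mem_insert _ _)
  have hy : y ∈ Submodule.span F {x, y} :=
    Submodule.subset_span (Set.mem_insert_of_mem _ (Set.mem_singleton _))
  exact ⟨z, linearIndependent_triple_of_notMem h hx hy hz⟩

theorem exists_pair_of_ne_zero {x : Fin 3 → F} (h : x ≠ 0) :
    ∃ y, LinearIndependent F ![x, y] := by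
  by_contra! h'
  have hle : (⊤ : Submodule F (Fin 3 → F)) ≤ Submodule.span F {x} := by
    intro y _
    have := h' y
    rw [LinearIndependent.pair_iff' h] at this
    push Not at this
    obtain ⟨a, rfl⟩ := this
    exact Submodule.smul_mem _ _ (Submodule.mem_span_singleton_self x)
  have h1 := Submodule.finrank_mono hle
  rw [finrank_span_singleton h] at h1
  simp at h1

theorem exists_linearEquiv_single {n : ℕ} {u : Fin n → (Fin n → F)}
    (hu : LinearIndependent F u) :
    ∃ g : (Fin n → F) ≃ₗ[F] (Fin n → F), ∀ i, g (Pi.single i 1) = u i := by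
  refine ⟨(Pi.basisFun F (Fin n)).equiv
    (basisOfLinearIndependentOfCardEqFinrank' u hu (by simp)) (Equiv.refl _), fun i => ?_⟩
  rw [← Pi.basisFun_apply, Module.Basis.equiv_apply]
  simp

/-! ### Pencils -/

/-- The tensor `e₀ ⊗ x + e₁ ⊗ y`. -/
noncomputable def tens (x y : M F) : V F :=
  (Pi.single 0 1 : Fin 2 → F) ⊗ₜ[F] x + (Pi.single 1 1 : Fin 2 → F) ⊗ₜ[F] y

theorem exists_eq_tens (A : V F) : ∃ x y, A = tens x y := by
  induction A using TensorProduct.induction_on with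
  | zero => exact ⟨0, 0, by simp [tens]⟩
  | tmul a t =>
    refine ⟨a 0 • t, a 1 • t, ?_⟩
    have : a = a 0 • (Pi.single 0 1 : Fin 2 → F) + a 1 • (Pi.single 1 1 : Fin 2 → F) := by
      ext i; fin_cases i <;> simp
    conv_lhs => rw [this]
    simp [tens, TensorProduct.add_tmul, TensorProduct.smul_tmul]
  | add x y hx hy =>
    obtain ⟨a, b, rfl⟩ := hx
    obtain ⟨c, d, rfl⟩ := hy
    exact ⟨a + c, b + d, by simp only [tens, TensorProduct.tmul_add]; abel⟩

theorem contract_tens (w : Module.Dual F (Fin 2 → F)) (x y : M F) :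
    contract w (tens x y) = w (Pi.single 0 1) • x + w (Pi.single 1 1) • y := by
  simp [contract, tens]

theorem contractionSpace_tens (x y : M F) :
    contractionSpace (tens x y) = Submodule.span F {x, y} := by
  apply le_antisymm
  · rw [contractionSpace, Submodule.span_le]
    rintro _ ⟨w, rfl⟩
    simp only [contract_tens, SetLike.mem_coe]
    exact Submodule.mem_span_pair.2 ⟨_, _, rfl⟩
  · rw [Submodule.span_le]
    rintro _ (rfl | rfl)
    · refine Submodule.subset_span ⟨LinearMap.proj 0, ?_⟩
      simp [contract_tens]
    · refine Submodule.subset_span ⟨LinearMap.proj 1, ?_⟩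
      simp [contract_tens]

theorem contractionSpace_smul (g : (Fin 2 → F) ≃ₗ[F] (Fin 2 → F))
    (g₂ g₃ : (Fin 3 → F) ≃ₗ[F] (Fin 3 → F)) (A : V F) :
    contractionSpace (hHom F (g, g₂, g₃) • A) =
      (contractionSpace A).map (TensorProduct.congr g₂ g₃).toLinearMap := by
  have key : ∀ w : Module.Dual F (Fin 2 → F), contract w (hHom F (g, g₂, g₃) • A) =
      TensorProduct.congr g₂ g₃ (contract (w ∘ₗ g.toLinearMap) A) := by
    intro w
    have h : contract w ∘ₗ (TensorProduct.congr g (TensorProduct.congr g₂ g₃)).toLinearMap =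
        (TensorProduct.congr g₂ g₃).toLinearMap ∘ₗ contract (w ∘ₗ g.toLinearMap) := by
      ext
      simp [contract]
    exact LinearMap.congr_fun h A
  rw [contractionSpace, contractionSpace, Submodule.map_span]
  congr 1
  ext t
  constructor
  · rintro ⟨w, rfl⟩
    exact ⟨_, ⟨w ∘ₗ g.toLinearMap, rfl⟩, (key w).symm⟩
  · rintro ⟨_, ⟨w, rfl⟩, rfl⟩
    refine ⟨w ∘ₗ g.symm.toLinearMap, ?_⟩
    have h : (w ∘ₗ g.symm.toLinearMap) ∘ₗ g.toLinearMap = w := by ext; simp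
    simp only [key, h]
    rfl

/-- A tensor with two-dimensional first contraction space is determined by that space up to the
action of `GL(F²)`. -/
theorem exists_smul_tens_eq {A : V F} (hA : Module.finrank F (contractionSpace A) = 2) {x y : M F}
    (hx : x ∈ contractionSpace A) (hy : y ∈ contractionSpace A)
    (hxy : LinearIndependent F ![x, y]) :
    ∃ g : (Fin 2 → F) ≃ₗ[F] (Fin 2 → F),
      hHom F (g, LinearEquiv.refl F _, LinearEquiv.refl F _) • tens x y = A := by
  obtain ⟨s, t, rfl⟩ := exists_eq_tens A
  have hspan := eq_span_pair_of_finrank_eq_two hA hx hy hxy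
  rw [contractionSpace_tens] at hspan hA
  have hst : LinearIndependent F ![s, t] := by
    rw [linearIndependent_iff_card_eq_finrank_span, Set.finrank, range_pair, hA, Fintype.card_fin]
  obtain ⟨a, b, hs⟩ := Submodule.mem_span_pair.1 (hspan ▸ Submodule.subset_span (by simp) :
    s ∈ Submodule.span F {x, y})
  obtain ⟨c, d, ht⟩ := Submodule.mem_span_pair.1 (hspan ▸ Submodule.subset_span (by simp) :
    t ∈ Submodule.span F {x, y})
  -- `(a, b; c, d)` is the transition matrix from the basis `x, y` to the basis `s, t`
  have hdet : a * d - b * c ≠ 0 := by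
    intro h0
    have h1 := LinearIndependent.pair_iff.1 hst d (-b) (by
      rw [← hs, ← ht]
      rw [show d • (a • x + b • y) + -b • (c • x + d • y) = (a * d - b * c) • x by module, h0,
        zero_smul])
    have h2 := LinearIndependent.pair_iff.1 hst (-c) a (by
      rw [← hs, ← ht]
      rw [show -c • (a • x + b • y) + a • (c • x + d • y) = (a * d - b * c) • y by module, h0,
        zero_smul])
    have hs0 : s = 0 := by
      rw [← hs, h2.2, neg_eq_zero.1 h1.2]; simp
    exact hst.ne_zero 0 hs0
  have hv : LinearIndependent F ![(![a, c] : Fin 2 → F), ![b, d]] := by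
    rw [LinearIndependent.pair_iff]
    intro p q e
    have e0 := congrFun e 0
    have e1 := congrFun e 1
    simp at e0 e1
    constructor
    · apply (mul_eq_zero.1 (_ : p * (a * d - b * c) = 0)).resolve_right hdet
      linear_combination d * e0 - b * e1
    · apply (mul_eq_zero.1 (_ : q * (a * d - b * c) = 0)).resolve_right hdet
      linear_combination a * e1 - c * e0
  obtain ⟨g, hg⟩ := exists_linearEquiv_single hv
  refine ⟨g, ?_⟩
  change TensorProduct.congr g _ (tens x y) = _
  have h0 := hg 0
  have h1 := hg 1
  simp only [Matrix.cons_val_zero, Matrix.cons_val_one] at h0 h1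
  have ha : (![a, c] : Fin 2 → F) = a • Pi.single 0 1 + c • Pi.single 1 1 := by
    ext i; fin_cases i <;> simp
  have hb : (![b, d] : Fin 2 → F) = b • Pi.single 0 1 + d • Pi.single 1 1 := by
    ext i; fin_cases i <;> simp
  simp only [tens, map_add, TensorProduct.congr_tmul, h0, h1, ha, hb, TensorProduct.congr_refl_refl,
    LinearEquiv.refl_apply, ← hs, ← ht, TensorProduct.add_tmul, TensorProduct.tmul_add,
    TensorProduct.smul_tmul]
  abel

theorem linearIndependent_pair_map {E E' : Type*} [AddCommGroup E] [Module F E] [AddCommGroup E']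
    [Module F E'] {x y : E} (h : LinearIndependent F ![x, y]) (g : E ≃ₗ[F] E') :
    LinearIndependent F ![g x, g y] := by
  rw [LinearIndependent.pair_iff] at h ⊢
  intro s t e
  rw [← map_smul, ← map_smul, ← map_add, g.map_eq_zero_iff] at e
  exact h s t e

/-- To recognise the orbit of `tens X Y` it suffices to find the images of `X` and `Y` under a change
of bases in the contraction space. -/
theorem mem_orbit_tens {A : V F} (hA : Module.finrank F (contractionSpace A) = 2)
    {u w : Fin 3 → (Fin 3 → F)} (hu : LinearIndependent F u) (hw : LinearIndependent F w)
    {X Y : M F} (hXY : LinearIndependent F ![X, Y])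
    (h : ∀ g k : (Fin 3 → F) ≃ₗ[F] (Fin 3 → F), (∀ i, g (Pi.single i 1) = u i) →
      (∀ i, k (Pi.single i 1) = w i) → TensorProduct.congr g k X ∈ contractionSpace A ∧
        TensorProduct.congr g k Y ∈ contractionSpace A) :
    A ∈ MulAction.orbit (H F) (tens X Y) := by
  obtain ⟨g, hg⟩ := exists_linearEquiv_single hu
  obtain ⟨k, hk⟩ := exists_linearEquiv_single hw
  obtain ⟨h1, h2⟩ := h g k hg hk
  obtain ⟨f, hf⟩ := exists_smul_tens_eq hA h1 h2 (linearIndependent_pair_map hXY _)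
  refine ⟨⟨hHom F (f, g, k), ⟨_, rfl⟩⟩, ?_⟩
  rw [← hf]
  change TensorProduct.congr f (TensorProduct.congr g k) (_ + _) = TensorProduct.congr f _ (_ + _)
  rw [LinearEquiv.map_add, LinearEquiv.map_add]
  simp

/-! ### Coordinates -/

/-- The value of a tensor of `F³ ⊗ F³`, seen as a bilinear form on the dual spaces. -/
noncomputable def pair (f g : Module.Dual F (Fin 3 → F)) : M F →ₗ[F] F :=
  (TensorProduct.lid F F).toLinearMap ∘ₗ TensorProduct.map f g

@[simp] theorem pair_tmul (f g : Module.Dual F (Fin 3 → F)) (u w : Fin 3 → F) :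
    pair f g (u ⊗ₜ[F] w) = f u * g w := by
  simp [pair]

/-- The basis tensor `eᵢ ⊗ eⱼ`. -/
noncomputable def E (i j : Fin 3) : M F := Pi.single i 1 ⊗ₜ Pi.single j 1

@[simp] theorem pair_E (f g : Module.Dual F (Fin 3 → F)) (i j : Fin 3) :
    pair f g (E i j) = f (Pi.single i 1) * g (Pi.single j 1) := by
  simp [E]

/-- A `2 × 2` minor certifies linear independence. -/
theorem linearIndependent_of_minor (i j k l : Fin 3) {X Y : M F}
    (h : pair (LinearMap.proj i) (LinearMap.proj j) X * pair (LinearMap.proj k) (LinearMap.proj l) Y -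
      pair (LinearMap.proj k) (LinearMap.proj l) X * pair (LinearMap.proj i) (LinearMap.proj j) Y ≠ 0) :
    LinearIndependent F ![X, Y] := by
  rw [LinearIndependent.pair_iff]
  intro s t e
  have h1 := congrArg (pair (LinearMap.proj i) (LinearMap.proj j)) e
  have h2 := congrArg (pair (LinearMap.proj k) (LinearMap.proj l)) e
  simp only [map_add, map_smul, map_zero, smul_eq_mul] at h1 h2
  constructor
  · refine (mul_eq_zero.1 ?_).resolve_right h
    linear_combination (pair (LinearMap.proj k) (LinearMap.proj l) Y) * h1 -
      (pair (LinearMap.proj i) (LinearMap.proj j) Y) * h2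
  · refine (mul_eq_zero.1 ?_).resolve_right h
    linear_combination (pair (LinearMap.proj i) (LinearMap.proj j) X) * h2 -
      (pair (LinearMap.proj k) (LinearMap.proj l) X) * h1

/-! ### Points, spans and normal forms of tensors of rank two -/

theorem rep_mem_segreSpan {x : ℙ F (M F)} {U W : Submodule F (Fin 3 → F)} (h : IsQ x U W) :
    x.rep ∈ segreSpan U W := by
  have := h.2.2
  rwa [Projectivization.submodule_eq, Submodule.span_singleton_le_iff_mem] at this

theorem mem_segre_iff {x : ℙ F (M F)} {U W : Submodule F (Fin 3 → F)} {u w : Fin 3 → F}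
    (h : x.rep = u ⊗ₜ w) : x ∈ segre U W ↔ u ∈ U ∧ w ∈ W := by
  have hu : u ≠ 0 := by rintro rfl; exact x.rep_nonzero (by simpa using h)
  have hw : w ≠ 0 := by rintro rfl; exact x.rep_nonzero (by simpa using h)
  constructor
  · intro hx
    rw [← x.mk_rep] at hx
    obtain ⟨u', hu', w', hw', -, -, e⟩ := exists_of_mem_segre x.rep_nonzero hx
    rw [h] at e
    obtain ⟨c, -, rfl⟩ := exists_smul_of_tmul_eq_left hu hw e
    obtain ⟨d, -, rfl⟩ := exists_smul_of_tmul_eq_right hu hw e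
    exact ⟨U.smul_mem _ hu', W.smul_mem _ hw'⟩
  · rintro ⟨hu', hw'⟩
    exact ⟨u, hu', w, hw', hu, hw, by rw [Projectivization.submodule_eq, h]⟩

theorem exists_rep_eq_tmul {x : ℙ F (M F)} (h : pointRk x = 1) :
    ∃ u w : Fin 3 → F, u ≠ 0 ∧ w ≠ 0 ∧ x.rep = u ⊗ₜ w := rk_eq_one h

theorem tmul_mem_segreSpan {U W : Submodule F (Fin 3 → F)} {u w : Fin 3 → F} (hu : u ∈ U)
    (hw : w ∈ W) : u ⊗ₜ w ∈ segreSpan U W := Submodule.subset_span ⟨u, hu, w, hw, rfl⟩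

theorem exists_of_mem_segreSpan_left {U W : Submodule F (Fin 3 → F)}
    (hU : Module.finrank F U = 2) {u₁ u₂ : Fin 3 → F} (h₁ : u₁ ∈ U) (h₂ : u₂ ∈ U)
    (hu : LinearIndependent F ![u₁, u₂]) {t : M F} (ht : t ∈ segreSpan U W) :
    ∃ w₁ ∈ W, ∃ w₂ ∈ W, t = u₁ ⊗ₜ w₁ + u₂ ⊗ₜ w₂ := by
  induction ht using Submodule.span_induction with
  | mem t ht =>
    obtain ⟨u, huU, w, hw, rfl⟩ := ht
    rw [eq_span_pair_of_finrank_eq_two hU h₁ h₂ hu] at huU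
    obtain ⟨a, b, rfl⟩ := Submodule.mem_span_pair.1 huU
    exact ⟨a • w, W.smul_mem _ hw, b • w, W.smul_mem _ hw, by
      simp [TensorProduct.add_tmul, TensorProduct.smul_tmul]⟩
  | zero => exact ⟨0, W.zero_mem, 0, W.zero_mem, by simp⟩
  | add x y _ _ hx hy =>
    obtain ⟨a, ha, b, hb, rfl⟩ := hx
    obtain ⟨c, hc, d, hd, rfl⟩ := hy
    exact ⟨a + c, W.add_mem ha hc, b + d, W.add_mem hb hd, by
      simp only [TensorProduct.tmul_add]; abel⟩
  | smul r x _ hx =>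
    obtain ⟨a, ha, b, hb, rfl⟩ := hx
    exact ⟨r • a, W.smul_mem _ ha, r • b, W.smul_mem _ hb, by simp⟩

theorem exists_of_mem_segreSpan_right {U W : Submodule F (Fin 3 → F)}
    (hW : Module.finrank F W = 2) {w₁ w₂ : Fin 3 → F} (h₁ : w₁ ∈ W) (h₂ : w₂ ∈ W)
    (hw : LinearIndependent F ![w₁, w₂]) {t : M F} (ht : t ∈ segreSpan U W) :
    ∃ u₁ ∈ U, ∃ u₂ ∈ U, t = u₁ ⊗ₜ w₁ + u₂ ⊗ₜ w₂ := by
  induction ht using Submodule.span_induction with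
  | mem t ht =>
    obtain ⟨u, huU, w, hwW, rfl⟩ := ht
    rw [eq_span_pair_of_finrank_eq_two hW h₁ h₂ hw] at hwW
    obtain ⟨a, b, rfl⟩ := Submodule.mem_span_pair.1 hwW
    exact ⟨a • u, U.smul_mem _ huU, b • u, U.smul_mem _ huU, by
      simp [TensorProduct.tmul_add, TensorProduct.smul_tmul]⟩
  | zero => exact ⟨0, U.zero_mem, 0, U.zero_mem, by simp⟩
  | add x y _ _ hx hy =>
    obtain ⟨a, ha, b, hb, rfl⟩ := hx
    obtain ⟨c, hc, d, hd, rfl⟩ := hy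
    exact ⟨a + c, U.add_mem ha hc, b + d, U.add_mem hb hd, by
      simp only [TensorProduct.add_tmul]; abel⟩
  | smul r x _ hx =>
    obtain ⟨a, ha, b, hb, rfl⟩ := hx
    exact ⟨r • a, U.smul_mem _ ha, r • b, U.smul_mem _ hb, by simp [TensorProduct.smul_tmul']⟩

/-- A tensor of rank two in `U ⊗ W`, where `U` and `W` are planes, compared with a pure tensor
`e ⊗ f` of `U ⊗ W`: either it lies on a secant of the Segre variety through `e ⊗ f`, or on a
tangent line. -/
theorem secant_or_tangent {U W : Submodule F (Fin 3 → F)} (hU : Module.finrank F U = 2)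
    {e f : Fin 3 → F} (he : e ∈ U) (hf : f ∈ W) (he0 : e ≠ 0)
    (hf0 : f ≠ 0) {t : M F} (ht : t ∈ segreSpan U W) (h2 : rk t = 2)
    (hW : Module.finrank F W = 2) :
    (∃ α : F, α ≠ 0 ∧ ∃ u ∈ U, ∃ w ∈ W, LinearIndependent F ![e, u] ∧ LinearIndependent F ![f, w] ∧
      t = α • (e ⊗ₜ f + u ⊗ₜ w)) ∨
    ∃ u ∈ U, ∃ w ∈ W, LinearIndependent F ![e, u] ∧ LinearIndependent F ![f, w] ∧
      t = e ⊗ₜ w + u ⊗ₜ f := by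
  obtain ⟨u₂, hu₂, heu⟩ := exists_pair_of_finrank_eq_two hU he0
  obtain ⟨w', hw', w'', hw'', rfl⟩ := exists_of_mem_segreSpan_left hU he hu₂ heu ht
  have hww := (rk_eq_two_iff.1 h2).2
  rw [eq_span_pair_of_finrank_eq_two hW hw' hw'' hww] at hf
  obtain ⟨a, b, rfl⟩ := Submodule.mem_span_pair.1 hf
  -- If `f` is a multiple of `w''`, the second summand has the factor `f`, which is the tangent case.
  -- Otherwise completing `a • w'` to `f` splits off a multiple of `e ⊗ f`.
  by_cases ha : a = 0
  · right
    subst ha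
    have hb : b ≠ 0 := by rintro rfl; simp at hf0
    have e' : e ⊗ₜ[F] w' + u₂ ⊗ₜ[F] w'' = e ⊗ₜ w' + (b⁻¹ • u₂) ⊗ₜ ((0 : F) • w' + b • w'') := by
      rw [zero_smul, zero_add, TensorProduct.smul_tmul_smul, inv_mul_cancel₀ hb, one_smul]
    rw [e'] at h2
    have := rk_eq_two_iff.1 h2
    exact ⟨b⁻¹ • u₂, U.smul_mem _ hu₂, w', hw', this.1, LinearIndependent.pair_symm_iff.1 this.2, e'⟩
  · left
    have e' : e ⊗ₜ[F] w' + u₂ ⊗ₜ[F] w'' =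
        a⁻¹ • (e ⊗ₜ (a • w' + b • w'') + (a • u₂ - b • e) ⊗ₜ w'') := by
      rw [TensorProduct.tmul_add, TensorProduct.sub_tmul, TensorProduct.tmul_smul,
        TensorProduct.tmul_smul, ← TensorProduct.smul_tmul', ← TensorProduct.smul_tmul']
      rw [show a • e ⊗ₜ[F] w' + b • e ⊗ₜ[F] w'' + (a • u₂ ⊗ₜ[F] w'' - b • e ⊗ₜ[F] w'') =
        a • (e ⊗ₜ[F] w' + u₂ ⊗ₜ[F] w'') by module, smul_smul, inv_mul_cancel₀ ha, one_smul]
    rw [e', rk_smul (inv_ne_zero ha)] at h2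
    have := rk_eq_two_iff.1 h2
    exact ⟨a⁻¹, inv_ne_zero ha, a • u₂ - b • e, U.sub_mem (U.smul_mem _ hu₂) (U.smul_mem _ he), w'',
      hw'', this.1, this.2, e'⟩

/-! ### Pencils with points of rank one -/

theorem o4_subset_orbit : o4 F ⊆ MulAction.orbit (H F) (tens (E 0 0) (E 0 1)) := by
  rintro A ⟨⟨hA, -⟩, U, W, hU, hW, hL⟩
  obtain ⟨u, hu, hu0⟩ := exists_ne_zero_of_finrank_pos (U := U) (by omega)
  obtain ⟨w₁, hw₁, hw₁0⟩ := exists_ne_zero_of_finrank_pos (U := W) (by omega)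
  obtain ⟨w₂, hw₂, hw⟩ := exists_pair_of_finrank_eq_two hW hw₁0
  obtain ⟨u', hu'⟩ := exists_pair_of_ne_zero hu0
  obtain ⟨u'', hu''⟩ := exists_triple_of_pair hu'
  obtain ⟨w₃, hw'⟩ := exists_triple_of_pair hw
  have key : ∀ w ∈ W, w ≠ 0 → u ⊗ₜ[F] w ∈ contractionSpace A := fun w hw hw0 =>
    (mk_mem_line (tmul_ne_zero hu0 hw0)).1 (hL ▸ mk_mem_segre hu0 hw0 hu hw)
  refine mem_orbit_tens hA hu'' hw' (linearIndependent_of_minor 0 0 0 1 (by simp))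
    fun g k hg hk => ?_
  simp only [E, TensorProduct.congr_tmul, hg, hk]
  exact ⟨key _ hw₁ hw₁0, key _ hw₂ (hw.ne_zero 1)⟩

theorem o4T_subset_orbit : o4T F ⊆ MulAction.orbit (H F) (tens (E 0 0) (E 1 0)) := by
  rintro A ⟨⟨hA, -⟩, U, W, hU, hW, hL⟩
  obtain ⟨w, hw, hw0⟩ := exists_ne_zero_of_finrank_pos (U := W) (by omega)
  obtain ⟨u₁, hu₁, hu₁0⟩ := exists_ne_zero_of_finrank_pos (U := U) (by omega)
  obtain ⟨u₂, hu₂, hu⟩ := exists_pair_of_finrank_eq_two hU hu₁0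
  obtain ⟨w', hw'⟩ := exists_pair_of_ne_zero hw0
  obtain ⟨w'', hw''⟩ := exists_triple_of_pair hw'
  obtain ⟨u₃, hu'⟩ := exists_triple_of_pair hu
  have key : ∀ u ∈ U, u ≠ 0 → u ⊗ₜ[F] w ∈ contractionSpace A := fun u hu hu0 =>
    (mk_mem_line (tmul_ne_zero hu0 hw0)).1 (hL ▸ mk_mem_segre hu0 hw0 hu hw)
  refine mem_orbit_tens hA hu' hw'' (linearIndependent_of_minor 0 0 1 0 (by simp))
    fun g k hg hk => ?_
  simp only [E, TensorProduct.congr_tmul, hg, hk]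
  exact ⟨key _ hu₁ hu₁0, key _ hu₂ (hu.ne_zero 1)⟩

theorem linearIndependent_rep {x y : ℙ F (M F)} (h : x ≠ y) :
    LinearIndependent F ![x.rep, y.rep] := by
  rw [LinearIndependent.pair_iff' x.rep_nonzero]
  intro a e
  apply h
  rw [← x.mk_rep, ← y.mk_rep, eq_comm, Projectivization.mk_eq_mk_iff']
  exact ⟨a, e⟩

theorem o5_subset_orbit : o5 F ⊆ MulAction.orbit (H F) (tens (E 0 0) (E 1 1)) := by
  rintro A ⟨⟨hA, -⟩, h⟩
  obtain ⟨x, y, hxy, hset⟩ := Set.encard_eq_two.1 h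
  have hx : x ∈ {x ∈ line A | pointRk x = 1} := by rw [hset]; simp
  have hy : y ∈ {x ∈ line A | pointRk x = 1} := by rw [hset]; simp
  obtain ⟨u, w, hu, hw, ex⟩ := exists_rep_eq_tmul hx.2
  obtain ⟨u', w', hu', hw', ey⟩ := exists_rep_eq_tmul hy.2
  have mx := rep_mem_of_mem_line hx.1
  have my := rep_mem_of_mem_line hy.1
  have hli := linearIndependent_rep hxy
  -- if the two points had a common factor, their sum would be a third point of rank one on the line
  have third : rk (x.rep + y.rep) ≠ 1 := by
    intro h1
    have h0 : x.rep + y.rep ≠ 0 := by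
      intro h0
      have := LinearIndependent.pair_iff.1 hli 1 1 (by simpa using h0)
      simp at this
    have hm : Projectivization.mk F _ h0 ∈ {x ∈ line A | pointRk x = 1} :=
      ⟨(mk_mem_line h0).2 (Submodule.add_mem _ mx my), by rw [pointRk_mk, h1]⟩
    rw [hset] at hm
    rcases hm with hm | hm
    · obtain ⟨a, ha⟩ := (Projectivization.mk_eq_mk_iff' F _ _ _ _).1 (hm.trans x.mk_rep.symm)
      have := LinearIndependent.pair_iff.1 hli (a - 1) (-1) (by rw [sub_smul, ha]; module)
      simp at this
    · obtain ⟨a, ha⟩ := (Projectivization.mk_eq_mk_iff' F _ _ _ _).1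
        ((Set.mem_singleton_iff.1 hm).trans y.mk_rep.symm)
      have := LinearIndependent.pair_iff.1 hli (-1) (a - 1) (by rw [sub_smul, ha]; module)
      simp at this
  rw [ex, ey] at third hli
  rw [ex] at mx
  rw [ey] at my
  have hli0 : u ⊗ₜ[F] w + u' ⊗ₜ[F] w' ≠ 0 := by
    intro h0
    have := LinearIndependent.pair_iff.1 hli 1 1 (by simpa using h0)
    simp at this
  have h2 : rk (u ⊗ₜ[F] w + u' ⊗ₜ[F] w') = 2 := by
    have h1 := rk_add_le u u' w w'
    have h0 : rk (u ⊗ₜ[F] w + u' ⊗ₜ[F] w') ≠ 0 := fun h0 => hli0 (rk_eq_zero.1 h0)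
    omega
  obtain ⟨huu, hww⟩ := rk_eq_two_iff.1 h2
  obtain ⟨u'', hu''⟩ := exists_triple_of_pair huu
  obtain ⟨w'', hw''⟩ := exists_triple_of_pair hww
  refine mem_orbit_tens hA hu'' hw'' (linearIndependent_of_minor 0 0 1 1 (by simp))
    fun g k hg hk => ?_
  simp only [E, TensorProduct.congr_tmul, hg, hk]
  exact ⟨mx, my⟩

/-- If the rank distribution has a single point of rank one, any rank one tensor of the contraction
space spans it. -/
theorem eq_smul_of_rankDist_eq_one {A : V F} {j : ℕ} (h : rankDist A j = 1) {s t : M F}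
    (hs : s ∈ contractionSpace A) (ht : t ∈ contractionSpace A) (hs0 : s ≠ 0) (ht0 : t ≠ 0)
    (hsj : rk s = j) (htj : rk t = j) : ∃ c : F, s = c • t := by
  obtain ⟨r, hr, hr0, hrj, hu⟩ := rankDist_eq_one_iff.1 h
  obtain ⟨a, ha, rfl⟩ := hu s hs hs0 hsj
  obtain ⟨b, hb, rfl⟩ := hu t ht ht0 htj
  exact ⟨a * b⁻¹, by rw [smul_smul, mul_assoc, inv_mul_cancel₀ hb, mul_one]⟩

/-- The point of rank two lies on a tangent through the point `e ⊗ f` of rank one: a secant through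
`e ⊗ f` would be the whole line and contain a second point of rank one. -/
theorem o6_subset_orbit : o6 F ⊆ MulAction.orbit (H F) (tens (E 0 0) (E 0 1 + E 1 0)) := by
  rintro A ⟨⟨hA, -⟩, h1, x₁, hx₁, x₂, hx₂, hr₁, hr₂, U, W, hQ, hs⟩
  obtain ⟨e, f, he, hf, ex⟩ := exists_rep_eq_tmul hr₁
  have m₁ := rep_mem_of_mem_line hx₁
  have m₂ := rep_mem_of_mem_line hx₂
  obtain ⟨heU, hfW⟩ := (mem_segre_iff ex).1 hs
  rw [ex] at m₁
  rcases secant_or_tangent hQ.1 heU hfW he hf (rep_mem_segreSpan hQ) hr₂ hQ.2.1 with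
    ⟨α, hα, u, -, w, -, hu, hw, e₂⟩ | ⟨u, -, w, -, hu, hw, e₂⟩
  · exfalso
    rw [e₂] at m₂
    have hm : u ⊗ₜ[F] w ∈ contractionSpace A := by
      have := Submodule.sub_mem _ (Submodule.smul_mem _ α⁻¹ m₂) m₁
      rwa [smul_smul, inv_mul_cancel₀ hα, one_smul, add_sub_cancel_left] at this
    have hu0 : u ≠ 0 := hu.ne_zero 1
    have hw0 : w ≠ 0 := hw.ne_zero 1
    obtain ⟨c, hc⟩ := eq_smul_of_rankDist_eq_one h1 hm m₁ (tmul_ne_zero hu0 hw0)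
      (tmul_ne_zero he hf) (rk_tmul hu0 hw0) (rk_tmul he hf)
    rw [TensorProduct.smul_tmul'] at hc
    obtain ⟨d, -, hd⟩ := exists_smul_of_tmul_eq_right hu0 hw0 hc
    have := LinearIndependent.pair_iff.1 hu (d * c) (-1) (by rw [hd]; module)
    simp at this
  · rw [e₂] at m₂
    obtain ⟨u', hu'⟩ := exists_triple_of_pair hu
    obtain ⟨w', hw'⟩ := exists_triple_of_pair hw
    refine mem_orbit_tens hA hu' hw' (linearIndependent_of_minor 0 0 0 1 (by simp))
      fun g k hg hk => ?_
    simp only [E, TensorProduct.congr_tmul, hg, hk, map_add]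
    exact ⟨m₁, m₂⟩

theorem le_of_segre_subset_left {U U' W W' : Submodule F (Fin 3 → F)} (hW : Module.finrank F W = 2)
    (h : segre U W ⊆ segre U' W') : U ≤ U' := by
  obtain ⟨w, hw, hw0⟩ := exists_ne_zero_of_finrank_pos (U := W) (by omega)
  intro u hu
  by_cases hu0 : u = 0
  · rw [hu0]; exact U'.zero_mem
  obtain ⟨u', hu', w', hw', -, -, e⟩ := exists_of_mem_segre _ (h (mk_mem_segre hu0 hw0 hu hw))
  obtain ⟨c, -, rfl⟩ := exists_smul_of_tmul_eq_right hu0 hw0 e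
  exact U'.smul_mem _ hu'

theorem le_of_segre_subset_right {U U' W W' : Submodule F (Fin 3 → F)}
    (hU : Module.finrank F U = 2) (h : segre U W ⊆ segre U' W') : W ≤ W' := by
  obtain ⟨u, hu, hu0⟩ := exists_ne_zero_of_finrank_pos (U := U) (by omega)
  intro w hw
  by_cases hw0 : w = 0
  · rw [hw0]; exact W'.zero_mem
  obtain ⟨u', hu', w', hw', -, -, e⟩ := exists_of_mem_segre _ (h (mk_mem_segre hu0 hw0 hu hw))
  obtain ⟨c, -, rfl⟩ := exists_smul_of_tmul_eq_left hu0 hw0 e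
  exact W'.smul_mem _ hw'

theorem segre_mono {U U' W W' : Submodule F (Fin 3 → F)} (hU : U ≤ U') (hW : W ≤ W') :
    segre U W ⊆ segre U' W' := by
  rintro x ⟨u, hu, w, hw, h⟩
  exact ⟨u, hU hu, w, hW hw, h⟩

/-- A point `e ⊗ f` and `σ(U × W)` lie in a common `S₂,₃` if and only if `e ∈ U`. -/
theorem commonS23_iff {x : ℙ F (M F)} {U W : Submodule F (Fin 3 → F)} {e f : Fin 3 → F}
    (hx : x.rep = e ⊗ₜ f) (hU : Module.finrank F U = 2) (hW : Module.finrank F W = 2) :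
    CommonS23 x U W ↔ e ∈ U := by
  constructor
  · rintro ⟨U', hU', h1, h2⟩
    have := Submodule.eq_of_le_of_finrank_eq (le_of_segre_subset_left hW h1) (by rw [hU, hU'])
    rw [this]
    exact ((mem_segre_iff hx).1 h2).1
  · intro he
    exact ⟨U, hU, segre_mono le_rfl le_top, (mem_segre_iff hx).2 ⟨he, Submodule.mem_top⟩⟩

/-- A point `e ⊗ f` and `σ(U × W)` lie in a common `S₃,₂` if and only if `f ∈ W`. -/
theorem commonS32_iff {x : ℙ F (M F)} {U W : Submodule F (Fin 3 → F)} {e f : Fin 3 → F}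
    (hx : x.rep = e ⊗ₜ f) (hU : Module.finrank F U = 2) (hW : Module.finrank F W = 2) :
    CommonS32 x U W ↔ f ∈ W := by
  constructor
  · rintro ⟨W', hW', h1, h2⟩
    have := Submodule.eq_of_le_of_finrank_eq (le_of_segre_subset_right hU h1) (by rw [hW, hW'])
    rw [this]
    exact ((mem_segre_iff hx).1 h2).2
  · intro hf
    exact ⟨W, hW, segre_mono le_top le_rfl, (mem_segre_iff hx).2 ⟨Submodule.mem_top, hf⟩⟩

/-- Here `e ∈ U` and `f ∉ W`, so `f` extends a basis of `W` to one of `F³`. -/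
theorem o7_subset_orbit : o7 F ⊆ MulAction.orbit (H F) (tens (E 0 2) (E 0 0 + E 1 1)) := by
  rintro A ⟨⟨hA, -⟩, h1, x₁, hx₁, x₂, hx₂, hr₁, hr₂, U, W, hQ, hs, hc⟩
  obtain ⟨e, f, he, hf, ex⟩ := exists_rep_eq_tmul hr₁
  have m₁ := rep_mem_of_mem_line hx₁
  have m₂ := rep_mem_of_mem_line hx₂
  rw [commonS23_iff ex hQ.1 hQ.2.1] at hc
  rw [mem_segre_iff ex] at hs
  have hfW : f ∉ W := fun h => hs ⟨hc, h⟩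
  obtain ⟨u, hu, heu⟩ := exists_pair_of_finrank_eq_two hQ.1 he
  obtain ⟨w₁, hw₁, w₂, hw₂, e₂⟩ := exists_of_mem_segreSpan_left hQ.1 hc hu heu
    (rep_mem_segreSpan hQ)
  have hww := (rk_eq_two_iff.1 (e₂ ▸ hr₂ : rk (e ⊗ₜ[F] w₁ + u ⊗ₜ[F] w₂) = 2)).2
  rw [ex] at m₁
  rw [e₂] at m₂
  obtain ⟨u', hu'⟩ := exists_triple_of_pair heu
  refine mem_orbit_tens hA hu' (linearIndependent_triple_of_notMem hww hw₁ hw₂ hfW)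
    (linearIndependent_of_minor 0 2 0 0 (by simp)) fun g k hg hk => ?_
  simp only [E, TensorProduct.congr_tmul, hg, hk, map_add]
  exact ⟨m₁, m₂⟩

/-- Here `f ∈ W` and `e ∉ U`, so `e` extends a basis of `U` to one of `F³`. -/
theorem o7T_subset_orbit : o7T F ⊆ MulAction.orbit (H F) (tens (E 2 0) (E 0 0 + E 1 1)) := by
  rintro A ⟨⟨hA, -⟩, h1, x₁, hx₁, x₂, hx₂, hr₁, hr₂, U, W, hQ, hs, hc⟩
  obtain ⟨e, f, he, hf, ex⟩ := exists_rep_eq_tmul hr₁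
  have m₁ := rep_mem_of_mem_line hx₁
  have m₂ := rep_mem_of_mem_line hx₂
  rw [commonS32_iff ex hQ.1 hQ.2.1] at hc
  rw [mem_segre_iff ex] at hs
  have heU : e ∉ U := fun h => hs ⟨h, hc⟩
  obtain ⟨w, hw, hfw⟩ := exists_pair_of_finrank_eq_two hQ.2.1 hf
  obtain ⟨u₁, hu₁, u₂, hu₂, e₂⟩ := exists_of_mem_segreSpan_right hQ.2.1 hc hw hfw
    (rep_mem_segreSpan hQ)
  have huu := (rk_eq_two_iff.1 (e₂ ▸ hr₂ : rk (u₁ ⊗ₜ[F] f + u₂ ⊗ₜ[F] w) = 2)).1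
  rw [ex] at m₁
  rw [e₂] at m₂
  obtain ⟨w', hw'⟩ := exists_triple_of_pair hfw
  refine mem_orbit_tens hA (linearIndependent_triple_of_notMem huu hu₁ hu₂ heU) hw'
    (linearIndependent_of_minor 2 0 0 0 (by simp)) fun g k hg hk => ?_
  simp only [E, TensorProduct.congr_tmul, hg, hk, map_add]
  exact ⟨m₁, m₂⟩

theorem linearIndependent_triple_rotate {E : Type*} [AddCommGroup E] [Module F E] {x y z : E}
    (h : LinearIndependent F ![x, y, z]) : LinearIndependent F ![z, x, y] := by
  rw [linearIndependent_triple_iff] at h ⊢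
  intro r s t e
  obtain ⟨h1, h2, h3⟩ := h s t r (by rw [← e]; abel)
  exact ⟨h3, h1, h2⟩

/-- Here `e ∉ U` and `f ∉ W`, so `e` and `f` extend bases of `U` and `W`. -/
theorem o8_subset_orbit : o8 F ⊆ MulAction.orbit (H F) (tens (E 0 0) (E 1 1 + E 2 2)) := by
  rintro A ⟨⟨hA, -⟩, h1, x₁, hx₁, x₂, hx₂, hr₁, hr₂, U, W, hQ, hc, hc'⟩
  obtain ⟨e, f, he, hf, ex⟩ := exists_rep_eq_tmul hr₁
  have m₁ := rep_mem_of_mem_line hx₁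
  have m₂ := rep_mem_of_mem_line hx₂
  rw [commonS23_iff ex hQ.1 hQ.2.1] at hc
  rw [commonS32_iff ex hQ.1 hQ.2.1] at hc'
  obtain ⟨u₁, hu₁, hu0⟩ := exists_ne_zero_of_finrank_pos (U := U) (by have := hQ.1; omega)
  obtain ⟨u₂, hu₂, huu⟩ := exists_pair_of_finrank_eq_two hQ.1 hu0
  obtain ⟨w₁, hw₁, w₂, hw₂, e₂⟩ := exists_of_mem_segreSpan_left hQ.1 hu₁ hu₂ huu
    (rep_mem_segreSpan hQ)
  have hww := (rk_eq_two_iff.1 (e₂ ▸ hr₂ : rk (u₁ ⊗ₜ[F] w₁ + u₂ ⊗ₜ[F] w₂) = 2)).2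
  rw [ex] at m₁
  rw [e₂] at m₂
  refine mem_orbit_tens hA
    (linearIndependent_triple_rotate (linearIndependent_triple_of_notMem huu hu₁ hu₂ hc))
    (linearIndependent_triple_rotate (linearIndependent_triple_of_notMem hww hw₁ hw₂ hc'))
    (linearIndependent_of_minor 0 0 1 1 (by simp)) fun g k hg hk => ?_
  simp only [E, TensorProduct.congr_tmul, hg, hk, map_add]
  exact ⟨m₁, m₂⟩

theorem exists_coeff_of_triple {x y z : Fin 3 → F} (h : LinearIndependent F ![x, y, z])
    (v : Fin 3 → F) : ∃ a b c : F, v = a • x + b • y + c • z := by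
  have hv : v ∈ Submodule.span F (Set.range ![x, y, z]) := by
    rw [h.span_eq_top_of_card_eq_finrank' (by simp)]
    trivial
  obtain ⟨c, hc⟩ := (Submodule.mem_span_range_iff_exists_fun F).1 hv
  exact ⟨c 0, c 1, c 2, by rw [← hc, Fin.sum_univ_three]; simp⟩

theorem exists_eq_sum_of_triple {x y z : Fin 3 → F} (h : LinearIndependent F ![x, y, z])
    (t : M F) : ∃ a b c : Fin 3 → F, t = x ⊗ₜ a + y ⊗ₜ b + z ⊗ₜ c := by
  induction t using TensorProduct.induction_on with
  | zero => exact ⟨0, 0, 0, by simp⟩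
  | tmul u w =>
    obtain ⟨a, b, c, rfl⟩ := exists_coeff_of_triple h u
    exact ⟨a • w, b • w, c • w, by simp [TensorProduct.add_tmul, TensorProduct.smul_tmul]⟩
  | add s t hs ht =>
    obtain ⟨a, b, c, rfl⟩ := hs
    obtain ⟨a', b', c', rfl⟩ := ht
    exact ⟨a + a', b + b', c + c', by simp only [TensorProduct.tmul_add]; abel⟩

theorem ne_smul_of_linearIndependent {E : Type*} [AddCommGroup E] [Module F E] {x y : E}
    (h : LinearIndependent F ![x, y]) (a c : F) {b : F} (hb : b ≠ 0) : a • x + b • y ≠ c • x := by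
  intro e
  have := LinearIndependent.pair_iff.1 h (a - c) b (by
    rw [show (a - c) • x + b • y = (a • x + b • y) - c • x by module, e, sub_self])
  exact hb this.2

/-- Every point but `u ⊗ w` has rank three. Writing another one as `∑ uᵢ ⊗ wᵢ` with `u₁ = u`, the
vector `w` has no component along `w₁`, so the last two summands can be rewritten with `w` as a second
factor. -/
theorem o9_subset_orbit :
    o9 F ⊆ MulAction.orbit (H F) (tens (E 0 0) (E 0 1 + E 1 0 + E 2 2)) := by
  rintro A ⟨⟨hA, -⟩, h1, h2⟩
  obtain ⟨t, ht, ht0, hr, hu⟩ := rankDist_eq_one_iff.1 h1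
  rw [rankDist_eq_zero_iff] at h2
  obtain ⟨u, w, hu0, hw0, rfl⟩ := rk_eq_one hr
  obtain ⟨y, hy, hty⟩ := exists_pair_of_finrank_eq_two hA ht0
  have hrk : ∀ a b : F, b ≠ 0 → rk (a • u ⊗ₜ[F] w + b • y) = 3 := by
    intro a b hb
    have hm : a • u ⊗ₜ[F] w + b • y ∈ contractionSpace A :=
      Submodule.add_mem _ (Submodule.smul_mem _ _ ht) (Submodule.smul_mem _ _ hy)
    have hn : a • u ⊗ₜ[F] w + b • y ≠ 0 := by
      have := ne_smul_of_linearIndependent hty a 0 hb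
      rwa [zero_smul] at this
    have r0 : rk (a • u ⊗ₜ[F] w + b • y) ≠ 0 := fun h => hn (rk_eq_zero.1 h)
    have r1 : rk (a • u ⊗ₜ[F] w + b • y) ≠ 1 := by
      intro h
      obtain ⟨c, -, hc⟩ := hu _ hm hn h
      exact ne_smul_of_linearIndependent hty a c hb hc
    have r2 := h2 _ hm hn
    have r3 := rk_le_three (a • u ⊗ₜ[F] w + b • y)
    omega
  obtain ⟨u₂, hu₂⟩ := exists_pair_of_ne_zero hu0
  obtain ⟨u₃, hu₃⟩ := exists_triple_of_pair hu₂
  obtain ⟨w₁, w₂, w₃, rfl⟩ := exists_eq_sum_of_triple hu₃ y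
  have r3 := hrk 0 1 one_ne_zero
  rw [zero_smul, zero_add, one_smul] at r3
  have hww := (rk_eq_three_iff.1 r3).2
  obtain ⟨a, b, c, rfl⟩ := exists_coeff_of_triple hww w
  -- otherwise a combination with `u ⊗ w` would cancel the summand `u ⊗ w₁` and have rank at most two
  have ha : a = 0 := by
    by_contra ha
    have := hrk (-1) a ha
    rw [show (-1 : F) • u ⊗ₜ[F] (a • w₁ + b • w₂ + c • w₃) +
        a • (u ⊗ₜ[F] w₁ + u₂ ⊗ₜ[F] w₂ + u₃ ⊗ₜ[F] w₃) =
        (a • u₂ - b • u) ⊗ₜ w₂ + (a • u₃ - c • u) ⊗ₜ w₃ by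
      simp only [TensorProduct.tmul_add, TensorProduct.sub_tmul, TensorProduct.tmul_smul,
        ← TensorProduct.smul_tmul']
      module] at this
    have h2 := rk_add_le (a • u₂ - b • u) (a • u₃ - c • u) w₂ w₃
    omega
  subst ha
  rw [zero_smul, zero_add] at *
  have hw23 : LinearIndependent F ![w₂, w₃] := by
    rw [LinearIndependent.pair_iff]
    intro s t e
    exact (linearIndependent_triple_iff.1 hww 0 s t (by rw [← e]; module)).2
  have hwm : b • w₂ + c • w₃ ∈ Submodule.span F {w₂, w₃} := Submodule.mem_span_pair.2 ⟨b, c, rfl⟩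
  have hdim := finrank_span_pair hw23
  obtain ⟨w', hw', hww'⟩ := exists_pair_of_finrank_eq_two hdim hw0
  have hm : u₂ ⊗ₜ[F] w₂ + u₃ ⊗ₜ[F] w₃ ∈ segreSpan ⊤ (Submodule.span F {w₂, w₃}) :=
    Submodule.add_mem _ (tmul_mem_segreSpan trivial (Submodule.subset_span (by simp)))
      (tmul_mem_segreSpan trivial (Submodule.subset_span (by simp)))
  obtain ⟨v₂, -, v₃, -, e⟩ := exists_of_mem_segreSpan_right hdim hwm hw' hww' hm
  rw [add_assoc, e, ← add_assoc] at r3 hy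
  have l1 := (rk_eq_three_iff.1 r3).1
  rw [add_comm (u ⊗ₜ[F] w₁)] at r3
  have l2 := (rk_eq_three_iff.1 r3).2
  refine mem_orbit_tens hA l1 l2 (linearIndependent_of_minor 0 0 0 1 (by simp)) fun g k hg hk => ?_
  simp only [E, TensorProduct.congr_tmul, hg, hk, map_add]
  exact ⟨ht, hy⟩

/-! ### Pencils in the span of a plane times a plane -/

theorem rk_le_two_of_mem_left {U W : Submodule F (Fin 3 → F)} (hU : Module.finrank F U = 2)
    {t : M F} (ht : t ∈ segreSpan U W) : rk t ≤ 2 := by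
  obtain ⟨u, hu, hu0⟩ := exists_ne_zero_of_finrank_pos (U := U) (by omega)
  obtain ⟨u', hu', h⟩ := exists_pair_of_finrank_eq_two hU hu0
  obtain ⟨w, -, w', -, rfl⟩ := exists_of_mem_segreSpan_left hU hu hu' h ht
  exact rk_add_le _ _ _ _

theorem rk_le_two_of_mem_right {U W : Submodule F (Fin 3 → F)} (hW : Module.finrank F W = 2)
    {t : M F} (ht : t ∈ segreSpan U W) : rk t ≤ 2 := by
  obtain ⟨w, hw, hw0⟩ := exists_ne_zero_of_finrank_pos (U := W) (by omega)
  obtain ⟨w', hw', h⟩ := exists_pair_of_finrank_eq_two hW hw0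
  obtain ⟨u, -, u', -, rfl⟩ := exists_of_mem_segreSpan_right hW hw hw' h ht
  exact rk_add_le _ _ _ _

theorem segreSpan_mono {U U' W W' : Submodule F (Fin 3 → F)} (hU : U ≤ U') (hW : W ≤ W') :
    segreSpan U W ≤ segreSpan U' W' :=
  Submodule.span_mono fun _ ⟨u, hu, w, hw, h⟩ => ⟨u, hU hu, w, hW hw, h⟩

theorem mem_of_tmul_mem_segreSpan_left {U W : Submodule F (Fin 3 → F)} {u w : Fin 3 → F}
    (hw : w ≠ 0) (h : u ⊗ₜ w ∈ segreSpan U W) : u ∈ U := by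
  by_contra hu
  obtain ⟨f, hf, hfU⟩ := Submodule.exists_le_ker_of_notMem hu
  have key : segreSpan U W ≤ LinearMap.ker
      ((TensorProduct.lid F (Fin 3 → F)).toLinearMap ∘ₗ LinearMap.rTensor (Fin 3 → F) f) := by
    rw [segreSpan, Submodule.span_le]
    rintro _ ⟨u', hu', w', -, rfl⟩
    have : f u' = 0 := hfU hu'
    simp [this]
  have := key h
  simp only [LinearMap.mem_ker, LinearMap.comp_apply, LinearMap.rTensor_tmul,
    LinearEquiv.coe_coe, TensorProduct.lid_tmul, smul_eq_zero] at this
  exact this.elim hf hw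

theorem mem_of_tmul_mem_segreSpan_right {U W : Submodule F (Fin 3 → F)} {u w : Fin 3 → F}
    (hu : u ≠ 0) (h : u ⊗ₜ w ∈ segreSpan U W) : w ∈ W := by
  by_contra hw
  obtain ⟨f, hf, hfW⟩ := Submodule.exists_le_ker_of_notMem hw
  have key : segreSpan U W ≤ LinearMap.ker
      ((TensorProduct.rid F (Fin 3 → F)).toLinearMap ∘ₗ LinearMap.lTensor (Fin 3 → F) f) := by
    rw [segreSpan, Submodule.span_le]
    rintro _ ⟨u', -, w', hw', rfl⟩
    have : f w' = 0 := hfW hw'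
    simp [this]
  have := key h
  simp only [LinearMap.mem_ker, LinearMap.comp_apply, LinearMap.lTensor_tmul,
    LinearEquiv.coe_coe, TensorProduct.rid_tmul, smul_eq_zero] at this
  exact this.elim hf hu

/-- The quadratic form `s² + δ s t - γ t²` has no nontrivial zero. -/
def Anisotropic (γ δ : F) : Prop := ∀ s t : F, s ^ 2 + δ * s * t - γ * t ^ 2 = 0 → s = 0 ∧ t = 0

/-- The form with coefficients `γ₀`, `δ₀` is anisotropic, and for every other anisotropic form a
substitution `ν ↦ a ν + b` carries a root of `ν² = δ ν + γ` to a root of `ν² = δ₀ ν + γ₀`. Such a form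
exists if and only if `F` has, up to isomorphism, exactly one quadratic extension. -/
def IsUniversal (γ₀ δ₀ : F) : Prop := Anisotropic γ₀ δ₀ ∧ ∀ γ δ : F, Anisotropic γ δ →
  ∃ a b : F, a ≠ 0 ∧ δ₀ = a * δ + 2 * b ∧ γ₀ = a ^ 2 * γ - a * b * δ - b ^ 2

/-- The rational canonical form of a pencil of `2 × 2` matrices all of whose nonzero members are
invertible. -/
theorem exists_companion {U W : Submodule F (Fin 3 → F)} (hU : Module.finrank F U = 2)
    (hW : Module.finrank F W = 2) {x y : M F} (hx : x ∈ segreSpan U W) (hy : y ∈ segreSpan U W)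
    (h : ∀ s t : F, rk (s • x + t • y) ≤ 1 → s = 0 ∧ t = 0) :
    ∃ γ δ : F, Anisotropic γ δ ∧ ∃ u₁ ∈ U, ∃ u₂ ∈ U, ∃ w₁ ∈ W, ∃ w₂ ∈ W,
      x = u₁ ⊗ₜ w₁ + u₂ ⊗ₜ w₂ ∧ y = u₁ ⊗ₜ w₂ + u₂ ⊗ₜ (γ • w₁ + δ • w₂) := by
  obtain ⟨u₁, hu₁, hu0⟩ := exists_ne_zero_of_finrank_pos (U := U) (by omega)
  obtain ⟨u₂, hu₂, hu⟩ := exists_pair_of_finrank_eq_two hU hu0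
  obtain ⟨w₁, hw₁, z, hz, rfl⟩ := exists_of_mem_segreSpan_left hU hu₁ hu₂ hu hx
  obtain ⟨w₂, hw₂, z', hz', rfl⟩ := exists_of_mem_segreSpan_left hU hu₁ hu₂ hu hy
  have hw : LinearIndependent F ![w₁, w₂] := by
    rw [LinearIndependent.pair_iff]
    intro s t e
    apply h
    rw [show s • (u₁ ⊗ₜ[F] w₁ + u₂ ⊗ₜ[F] z) + t • (u₁ ⊗ₜ[F] w₂ + u₂ ⊗ₜ[F] z') =
      u₁ ⊗ₜ (s • w₁ + t • w₂) + u₂ ⊗ₜ (s • z + t • z') by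
        simp only [TensorProduct.tmul_add, TensorProduct.tmul_smul]; module, e,
      TensorProduct.tmul_zero, zero_add]
    exact rk_tmul_le _ _
  have hspan := eq_span_pair_of_finrank_eq_two hW hw₁ hw₂ hw
  obtain ⟨α, β, rfl⟩ := Submodule.mem_span_pair.1 (hspan ▸ hz : z ∈ Submodule.span F {w₁, w₂})
  obtain ⟨γ, δ, rfl⟩ := Submodule.mem_span_pair.1 (hspan ▸ hz' : z' ∈ Submodule.span F {w₁, w₂})
  -- for `β = 0` the first generator would be pure
  have hβ : β ≠ 0 := by
    rintro rfl
    have := h 1 0 (by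
      rw [show (1 : F) • (u₁ ⊗ₜ[F] w₁ + u₂ ⊗ₜ[F] (α • w₁ + (0 : F) • w₂)) +
        (0 : F) • (u₁ ⊗ₜ[F] w₂ + u₂ ⊗ₜ[F] (γ • w₁ + δ • w₂)) = (u₁ + α • u₂) ⊗ₜ w₁ by
          simp only [TensorProduct.tmul_add, TensorProduct.tmul_smul, TensorProduct.add_tmul,
            ← TensorProduct.smul_tmul']; module]
      exact rk_tmul_le _ _)
    exact one_ne_zero this.1
  have ex : u₁ ⊗ₜ[F] w₁ + u₂ ⊗ₜ[F] (α • w₁ + β • w₂) = (u₁ + α • u₂) ⊗ₜ w₁ + (β • u₂) ⊗ₜ w₂ := by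
    simp only [TensorProduct.tmul_add, TensorProduct.tmul_smul, TensorProduct.add_tmul,
      ← TensorProduct.smul_tmul']
    module
  have ey : u₁ ⊗ₜ[F] w₂ + u₂ ⊗ₜ[F] (γ • w₁ + δ • w₂) =
      (u₁ + α • u₂) ⊗ₜ w₂ + (β • u₂) ⊗ₜ ((γ / β) • w₁ + ((δ - α) / β) • w₂) := by
    simp only [TensorProduct.tmul_add, TensorProduct.tmul_smul, TensorProduct.add_tmul,
      ← TensorProduct.smul_tmul']
    match_scalars <;> field_simp
    ring
  rw [ex, ey] at h ⊢
  refine ⟨γ / β, (δ - α) / β, ?_, _, U.add_mem hu₁ (U.smul_mem _ hu₂), _, U.smul_mem β hu₂, _, hw₁,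
    _, hw₂, rfl, rfl⟩
  generalize u₁ + α • u₂ = v₁ at *
  generalize β • u₂ = v₂ at *
  generalize γ / β = γ at *
  generalize (δ - α) / β = δ at *
  intro s t e
  by_cases ht : t = 0
  · subst ht
    exact ⟨by simpa using e, rfl⟩
  apply h
  -- at a zero of the form the member of the pencil with coordinates `s`, `t` has determinant zero,
  -- hence is pure
  have key : t • (s • (v₁ ⊗ₜ[F] w₁ + v₂ ⊗ₜ[F] w₂) +
      t • (v₁ ⊗ₜ[F] w₂ + v₂ ⊗ₜ[F] (γ • w₁ + δ • w₂))) =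
      (t • v₁ + (s + δ * t) • v₂) ⊗ₜ (s • w₁ + t • w₂) := by
    simp only [TensorProduct.tmul_add, TensorProduct.tmul_smul, TensorProduct.add_tmul,
      ← TensorProduct.smul_tmul']
    match_scalars <;> first | ring1 | linear_combination -e
  rw [← rk_smul ht, key]
  exact rk_tmul_le _ _

/-- If the quadratic extension is unique, the coefficients in the normal form of such a pencil can be
prescribed, after replacing the second generator. -/
theorem exists_normal_form {γ₀ δ₀ : F} (h₀ : IsUniversal γ₀ δ₀) {U W : Submodule F (Fin 3 → F)}
    (hU : Module.finrank F U = 2) (hW : Module.finrank F W = 2) {x y : M F}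
    (hx : x ∈ segreSpan U W) (hy : y ∈ segreSpan U W)
    (h : ∀ s t : F, rk (s • x + t • y) ≤ 1 → s = 0 ∧ t = 0) :
    ∃ a b : F, a ≠ 0 ∧ ∃ u₁ ∈ U, ∃ u₂ ∈ U, ∃ w₁ ∈ W, ∃ w₂ ∈ W,
      x = u₁ ⊗ₜ w₁ + γ₀ • u₂ ⊗ₜ w₂ ∧
      a • y + b • x = u₁ ⊗ₜ w₂ + u₂ ⊗ₜ w₁ + δ₀ • u₂ ⊗ₜ w₂ := by
  obtain ⟨γ, δ, han, u₁, hu₁, u₂, hu₂, w₁, hw₁, w₂, hw₂, rfl, rfl⟩ := exists_companion hU hW hx hy h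
  obtain ⟨a, b, ha, rfl, hγ₀⟩ := h₀.2 γ δ han
  have hγ0 : γ₀ ≠ 0 := by
    rintro h
    have := (h₀.1 0 1 (by rw [h]; ring)).2
    exact one_ne_zero this
  -- a change of the root `ν` to `a ν + b` in the companion form, followed by rescaling by `γ₀`
  refine ⟨γ₀⁻¹ * a, γ₀⁻¹ * b, mul_ne_zero (inv_ne_zero hγ0) ha, u₁ - (b / a) • u₂,
    U.sub_mem hu₁ (U.smul_mem _ hu₂), a⁻¹ • u₂, U.smul_mem _ hu₂, w₁, hw₁,
    γ₀⁻¹ • (b • w₁ + a • w₂), W.smul_mem _ (W.add_mem (W.smul_mem _ hw₁) (W.smul_mem _ hw₂)), ?_, ?_⟩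
  · simp only [TensorProduct.tmul_add, TensorProduct.tmul_smul, TensorProduct.sub_tmul,
      ← TensorProduct.smul_tmul']
    match_scalars <;> field_simp
    ring
  · simp only [TensorProduct.tmul_add, TensorProduct.tmul_smul, TensorProduct.sub_tmul,
      ← TensorProduct.smul_tmul']
    match_scalars <;> field_simp <;> first | ring1 | (rw [hγ₀]; ring1)

theorem Anisotropic.ne_zero {γ δ : F} (h : Anisotropic γ δ) : γ ≠ 0 := by
  rintro rfl
  exact one_ne_zero (h 0 1 (by ring)).2

theorem linearIndependent_of_mem_disjoint {A : V F} (hA : Module.finrank F (contractionSpace A) = 2)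
    {U W : Submodule F (Fin 3 → F)} (hle : contractionSpace A ≤ segreSpan U W)
    (hd : Disjoint (line A) (segre U W)) : ∃ x ∈ contractionSpace A, ∃ y ∈ contractionSpace A,
      LinearIndependent F ![x, y] ∧ ∀ s t : F, rk (s • x + t • y) ≤ 1 → s = 0 ∧ t = 0 := by
  obtain ⟨x, hx, hx0⟩ := exists_ne_zero_of_finrank_pos (U := contractionSpace A) (by omega)
  obtain ⟨y, hy, hxy⟩ := exists_pair_of_finrank_eq_two hA hx0
  refine ⟨x, hx, y, hy, hxy, fun s t hst => ?_⟩
  have hm : s • x + t • y ∈ contractionSpace A :=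
    Submodule.add_mem _ (Submodule.smul_mem _ _ hx) (Submodule.smul_mem _ _ hy)
  have h0 : s • x + t • y = 0 := by
    by_contra h0
    have h1 : rk (s • x + t • y) = 1 := by
      have : rk (s • x + t • y) ≠ 0 := fun h => h0 (rk_eq_zero.1 h)
      omega
    obtain ⟨u, w, hu, hw, e⟩ := rk_eq_one h1
    have hs := hle hm
    rw [e] at hs
    refine Set.disjoint_left.1 hd ((mk_mem_line (tmul_ne_zero hu hw)).2 (e ▸ hm))
      (mk_mem_segre hu hw (mem_of_tmul_mem_segreSpan_left hw hs)
        (mem_of_tmul_mem_segreSpan_right hu hs))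
  exact LinearIndependent.pair_iff.1 hxy s t h0

theorem o10_eq_empty (h : ∀ γ δ : F, ¬ Anisotropic γ δ) : o10 F = ∅ := by
  rw [Set.eq_empty_iff_forall_notMem]
  rintro A ⟨⟨hA, -⟩, U, W, hU, hW, hle, hd⟩
  obtain ⟨x, hx, y, hy, -, hxy⟩ := linearIndependent_of_mem_disjoint hA hle hd
  obtain ⟨γ, δ, han, -⟩ := exists_companion hU hW (hle hx) (hle hy) hxy
  exact h γ δ han

theorem o10_subset_orbit {γ₀ δ₀ : F} (h₀ : IsUniversal γ₀ δ₀) : o10 F ⊆ MulAction.orbit (H F)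
    (tens (E 0 0 + γ₀ • E 1 1) (E 0 1 + E 1 0 + δ₀ • E 1 1)) := by
  rintro A ⟨⟨hA, -⟩, U, W, hU, hW, hle, hd⟩
  obtain ⟨x, hx, y, hy, hli, hxy⟩ := linearIndependent_of_mem_disjoint hA hle hd
  obtain ⟨a, b, ha, u₁, hu₁, u₂, hu₂, w₁, hw₁, w₂, hw₂, ex, ey⟩ :=
    exists_normal_form h₀ hU hW (hle hx) (hle hy) hxy
  have hr : rk x = 2 := by
    have h1 := rk_le_two_of_mem_left hU (hle hx)
    have h2 : ¬ rk x ≤ 1 := fun h => one_ne_zero (hxy 1 0 (by simpa using h)).1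
    omega
  have hr' := hr
  rw [ex, ← TensorProduct.tmul_smul] at hr
  have huu := (rk_eq_two_iff.1 hr).1
  rw [ex, TensorProduct.smul_tmul'] at hr'
  have hww := (rk_eq_two_iff.1 hr').2
  have hy' := Submodule.add_mem _ (Submodule.smul_mem _ a hy) (Submodule.smul_mem _ b hx)
  rw [ey] at hy'
  rw [ex] at hx
  obtain ⟨u', hu'⟩ := exists_triple_of_pair huu
  obtain ⟨w', hw'⟩ := exists_triple_of_pair hww
  refine mem_orbit_tens hA hu' hw' (linearIndependent_of_minor 0 0 0 1 (by simp))
    fun g k hg hk => ?_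
  simp only [E, TensorProduct.congr_tmul, hg, hk, map_add, map_smul]
  exact ⟨hx, hy'⟩

/-! ### Pencils without points of rank one -/

theorem rk_ne_one_of_disjoint {A : V F} (hd : Disjoint (line A) (segre ⊤ ⊤)) {t : M F}
    (ht : t ∈ contractionSpace A) : rk t ≠ 1 := by
  intro h
  obtain ⟨u, w, hu, hw, rfl⟩ := rk_eq_one h
  exact Set.disjoint_left.1 hd ((mk_mem_line (tmul_ne_zero hu hw)).2 ht)
    (mk_mem_segre hu hw trivial trivial)

theorem exists_eq_add_smul_of_notMem {W : Submodule F (Fin 3 → F)} (hW : Module.finrank F W = 2)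
    {w : Fin 3 → F} (hw : w ∉ W) (v : Fin 3 → F) : ∃ p ∈ W, ∃ c : F, v = p + c • w := by
  obtain ⟨w₁, hw₁, hw0⟩ := exists_ne_zero_of_finrank_pos (U := W) (by omega)
  obtain ⟨w₂, hw₂, hww⟩ := exists_pair_of_finrank_eq_two hW hw0
  have hli := linearIndependent_triple_of_notMem hww hw₁ hw₂ hw
  obtain ⟨a, b, c, h⟩ := exists_coeff_of_triple hli v
  exact ⟨a • w₁ + b • w₂, W.add_mem (W.smul_mem _ hw₁) (W.smul_mem _ hw₂), c, h⟩

/-- All points have rank two. Modulo `U ⊗ W`, where `x ∈ U ⊗ W`, the second generator is `v ⊗ w₃`;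
with `v` as the second basis vector of `U`, both generators take the canonical form. -/
theorem o11_subset_orbit :
    o11 F ⊆ MulAction.orbit (H F) (tens (E 0 0 + E 1 1) (E 0 1 + E 1 2)) := by
  rintro A ⟨⟨hA, -⟩, hd, ⟨U, hU, hle⟩, hn⟩
  obtain ⟨x, hx, hx0⟩ := exists_ne_zero_of_finrank_pos (U := contractionSpace A) (by omega)
  obtain ⟨y, hy, hxy⟩ := exists_pair_of_finrank_eq_two hA hx0
  have hspan := eq_span_pair_of_finrank_eq_two hA hx hy hxy
  have hr2 : ∀ t ∈ contractionSpace A, t ≠ 0 → rk t = 2 := by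
    intro t ht h0
    have h1 := rk_ne_one_of_disjoint hd ht
    have h2 := rk_le_two_of_mem_left hU (hle ht)
    have h3 : rk t ≠ 0 := fun h => h0 (rk_eq_zero.1 h)
    omega
  obtain ⟨u₁, hu₁, hu0⟩ := exists_ne_zero_of_finrank_pos (U := U) (by omega)
  obtain ⟨u₂, hu₂, hu⟩ := exists_pair_of_finrank_eq_two hU hu0
  obtain ⟨w₁, -, w₂, -, ex⟩ := exists_of_mem_segreSpan_left hU hu₁ hu₂ hu (hle hx)
  obtain ⟨z₁, -, z₂, -, ey⟩ := exists_of_mem_segreSpan_left hU hu₁ hu₂ hu (hle hy)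
  have hrx := hr2 x hx hx0
  have hw : LinearIndependent F ![w₁, w₂] := by rw [ex] at hrx; exact (rk_eq_two_iff.1 hrx).2
  have hW := finrank_span_pair hw
  have hxW : x ∈ segreSpan U (Submodule.span F {w₁, w₂}) := by
    rw [ex]
    exact Submodule.add_mem _ (tmul_mem_segreSpan hu₁ (Submodule.subset_span (by simp)))
      (tmul_mem_segreSpan hu₂ (Submodule.subset_span (by simp)))
  generalize Submodule.span F {w₁, w₂} = W at hW hxW
  obtain ⟨w₃, hw₃⟩ := exists_notMem_of_finrank_eq_two hW
  obtain ⟨p₁, hp₁, c₁, rfl⟩ := exists_eq_add_smul_of_notMem hW hw₃ z₁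
  obtain ⟨p₂, hp₂, c₂, rfl⟩ := exists_eq_add_smul_of_notMem hW hw₃ z₂
  have hq : u₁ ⊗ₜ p₁ + u₂ ⊗ₜ p₂ ∈ segreSpan U W :=
    Submodule.add_mem _ (tmul_mem_segreSpan hu₁ hp₁) (tmul_mem_segreSpan hu₂ hp₂)
  have ey' : y = u₁ ⊗ₜ p₁ + u₂ ⊗ₜ p₂ + (c₁ • u₁ + c₂ • u₂) ⊗ₜ w₃ := by
    rw [ey]
    simp only [TensorProduct.tmul_add, TensorProduct.tmul_smul, TensorProduct.add_tmul,
      ← TensorProduct.smul_tmul']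
    module
  have hv : c₁ • u₁ + c₂ • u₂ ∈ U := U.add_mem (U.smul_mem _ hu₁) (U.smul_mem _ hu₂)
  generalize c₁ • u₁ + c₂ • u₂ = v at ey' hv
  have hv0 : v ≠ 0 := by
    rintro rfl
    refine hn ⟨U, W, hU, hW, ?_⟩
    rw [hspan, Submodule.span_le]
    rintro _ (rfl | rfl)
    · exact hxW
    · rw [ey', TensorProduct.zero_tmul, add_zero]
      exact hq
  obtain ⟨v', hv', hvv⟩ := exists_pair_of_finrank_eq_two hU hv0
  have hvv' := LinearIndependent.pair_symm_iff.1 hvv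
  obtain ⟨q₁, hq₁, q₂, hq₂, eq⟩ := exists_of_mem_segreSpan_left hU hv' hv hvv' hq
  obtain ⟨b₁, hb₁, b₂, hb₂, ex'⟩ := exists_of_mem_segreSpan_left hU hv' hv hvv' hxW
  have hb : LinearIndependent F ![b₁, b₂] := by rw [ex'] at hrx; exact (rk_eq_two_iff.1 hrx).2
  rw [eq_span_pair_of_finrank_eq_two hW hb₁ hb₂ hb] at hq₁
  obtain ⟨α, β, rfl⟩ := Submodule.mem_span_pair.1 hq₁
  have ey'' : y - α • x = v' ⊗ₜ (β • b₂) + v ⊗ₜ (q₂ + w₃ - α • b₂) := by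
    rw [ey', ex', eq]
    simp only [TensorProduct.tmul_add, TensorProduct.tmul_smul, TensorProduct.tmul_sub]
    module
  have hym : y - α • x ∈ contractionSpace A := Submodule.sub_mem _ hy (Submodule.smul_mem _ _ hx)
  -- for `β = 0` the member `y - α • x` would be pure
  have hβ : β ≠ 0 := by
    rintro rfl
    have h1 := hr2 _ hym (by
      have := ne_smul_of_linearIndependent hxy (-α) 0 one_ne_zero
      rw [zero_smul] at this
      rwa [show y - α • x = (-α) • x + (1 : F) • y by module])
    rw [ey'', zero_smul, TensorProduct.tmul_zero, zero_add] at h1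
    have := rk_tmul_le v (q₂ + w₃ - α • b₂)
    omega
  have hym' := Submodule.smul_mem _ β⁻¹ hym
  rw [ey'', TensorProduct.tmul_smul, smul_add, smul_smul, inv_mul_cancel₀ hβ, one_smul,
    ← TensorProduct.tmul_smul] at hym'
  rw [ex'] at hx
  have hb₃ : β⁻¹ • (q₂ + w₃ - α • b₂) ∉ W := by
    intro h
    apply hw₃
    have h1 := W.smul_mem β h
    rw [smul_smul, mul_inv_cancel₀ hβ, one_smul] at h1
    have h2 := W.sub_mem (W.add_mem h1 (W.smul_mem α hb₂)) hq₂
    rwa [show q₂ + w₃ - α • b₂ + α • b₂ - q₂ = w₃ by module] at h2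
  obtain ⟨v'', hv''⟩ := exists_triple_of_pair hvv'
  refine mem_orbit_tens hA hv'' (linearIndependent_triple_of_notMem hb hb₁ hb₂ hb₃)
    (linearIndependent_of_minor 0 0 0 1 (by simp)) fun g k hg hk => ?_
  simp only [E, TensorProduct.congr_tmul, hg, hk, map_add]
  exact ⟨hx, hym'⟩

/-- The transpose of the argument for `o11`. -/
theorem o11T_subset_orbit :
    o11T F ⊆ MulAction.orbit (H F) (tens (E 0 0 + E 1 1) (E 1 0 + E 2 1)) := by
  rintro A ⟨⟨hA, -⟩, hd, ⟨W, hW, hle⟩, hn⟩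
  obtain ⟨x, hx, hx0⟩ := exists_ne_zero_of_finrank_pos (U := contractionSpace A) (by omega)
  obtain ⟨y, hy, hxy⟩ := exists_pair_of_finrank_eq_two hA hx0
  have hspan := eq_span_pair_of_finrank_eq_two hA hx hy hxy
  have hr2 : ∀ t ∈ contractionSpace A, t ≠ 0 → rk t = 2 := by
    intro t ht h0
    have h1 := rk_ne_one_of_disjoint hd ht
    have h2 := rk_le_two_of_mem_right hW (hle ht)
    have h3 : rk t ≠ 0 := fun h => h0 (rk_eq_zero.1 h)
    omega
  obtain ⟨w₁, hw₁, hw0⟩ := exists_ne_zero_of_finrank_pos (U := W) (by omega)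
  obtain ⟨w₂, hw₂, hw⟩ := exists_pair_of_finrank_eq_two hW hw0
  obtain ⟨u₁, -, u₂, -, ex⟩ := exists_of_mem_segreSpan_right hW hw₁ hw₂ hw (hle hx)
  obtain ⟨z₁, -, z₂, -, ey⟩ := exists_of_mem_segreSpan_right hW hw₁ hw₂ hw (hle hy)
  have hrx := hr2 x hx hx0
  have hu : LinearIndependent F ![u₁, u₂] := by rw [ex] at hrx; exact (rk_eq_two_iff.1 hrx).1
  have hU := finrank_span_pair hu
  have hxU : x ∈ segreSpan (Submodule.span F {u₁, u₂}) W := by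
    rw [ex]
    exact Submodule.add_mem _ (tmul_mem_segreSpan (Submodule.subset_span (by simp)) hw₁)
      (tmul_mem_segreSpan (Submodule.subset_span (by simp)) hw₂)
  generalize Submodule.span F {u₁, u₂} = U at hU hxU
  obtain ⟨u₃, hu₃⟩ := exists_notMem_of_finrank_eq_two hU
  obtain ⟨p₁, hp₁, c₁, rfl⟩ := exists_eq_add_smul_of_notMem hU hu₃ z₁
  obtain ⟨p₂, hp₂, c₂, rfl⟩ := exists_eq_add_smul_of_notMem hU hu₃ z₂
  have hq : p₁ ⊗ₜ w₁ + p₂ ⊗ₜ w₂ ∈ segreSpan U W :=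
    Submodule.add_mem _ (tmul_mem_segreSpan hp₁ hw₁) (tmul_mem_segreSpan hp₂ hw₂)
  have ey' : y = p₁ ⊗ₜ w₁ + p₂ ⊗ₜ w₂ + u₃ ⊗ₜ (c₁ • w₁ + c₂ • w₂) := by
    rw [ey]
    simp only [TensorProduct.tmul_add, TensorProduct.tmul_smul, TensorProduct.add_tmul,
      ← TensorProduct.smul_tmul']
    module
  have hv : c₁ • w₁ + c₂ • w₂ ∈ W := W.add_mem (W.smul_mem _ hw₁) (W.smul_mem _ hw₂)
  generalize c₁ • w₁ + c₂ • w₂ = v at ey' hv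
  have hv0 : v ≠ 0 := by
    rintro rfl
    refine hn ⟨U, W, hU, hW, ?_⟩
    rw [hspan, Submodule.span_le]
    rintro _ (rfl | rfl)
    · exact hxU
    · rw [ey', TensorProduct.tmul_zero, add_zero]
      exact hq
  obtain ⟨v', hv', hvv⟩ := exists_pair_of_finrank_eq_two hW hv0
  have hvv' := LinearIndependent.pair_symm_iff.1 hvv
  obtain ⟨q₁, hq₁, q₂, hq₂, eq⟩ := exists_of_mem_segreSpan_right hW hv' hv hvv' hq
  obtain ⟨b₁, hb₁, b₂, hb₂, ex'⟩ := exists_of_mem_segreSpan_right hW hv' hv hvv' hxU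
  have hb : LinearIndependent F ![b₁, b₂] := by rw [ex'] at hrx; exact (rk_eq_two_iff.1 hrx).1
  rw [eq_span_pair_of_finrank_eq_two hU hb₁ hb₂ hb] at hq₁
  obtain ⟨α, β, rfl⟩ := Submodule.mem_span_pair.1 hq₁
  have ey'' : y - α • x = (β • b₂) ⊗ₜ v' + (q₂ + u₃ - α • b₂) ⊗ₜ v := by
    rw [ey', ex', eq]
    simp only [TensorProduct.add_tmul, ← TensorProduct.smul_tmul', TensorProduct.sub_tmul]
    module
  have hym : y - α • x ∈ contractionSpace A := Submodule.sub_mem _ hy (Submodule.smul_mem _ _ hx)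
  -- for `β = 0` the member `y - α • x` would be pure
  have hβ : β ≠ 0 := by
    rintro rfl
    have h1 := hr2 _ hym (by
      have := ne_smul_of_linearIndependent hxy (-α) 0 one_ne_zero
      rw [zero_smul] at this
      rwa [show y - α • x = (-α) • x + (1 : F) • y by module])
    rw [ey'', zero_smul, TensorProduct.zero_tmul, zero_add] at h1
    have := rk_tmul_le (q₂ + u₃ - α • b₂) v
    omega
  have hym' := Submodule.smul_mem _ β⁻¹ hym
  rw [ey'', ← TensorProduct.smul_tmul', smul_add, smul_smul, inv_mul_cancel₀ hβ, one_smul,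
    TensorProduct.smul_tmul'] at hym'
  rw [ex'] at hx
  have hb₃ : β⁻¹ • (q₂ + u₃ - α • b₂) ∉ U := by
    intro h
    apply hu₃
    have h1 := U.smul_mem β h
    rw [smul_smul, mul_inv_cancel₀ hβ, one_smul] at h1
    have h2 := U.sub_mem (U.add_mem h1 (U.smul_mem α hb₂)) hq₂
    rwa [show q₂ + u₃ - α • b₂ + α • b₂ - q₂ = u₃ by module] at h2
  obtain ⟨v'', hv''⟩ := exists_triple_of_pair hvv'
  refine mem_orbit_tens hA (linearIndependent_triple_of_notMem hb hb₁ hb₂ hb₃) hv''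
    (linearIndependent_of_minor 0 0 1 0 (by simp)) fun g k hg hk => ?_
  simp only [E, TensorProduct.congr_tmul, hg, hk, map_add]
  exact ⟨hx, hym'⟩

/-! ### Two points of rank two -/

theorem exists_of_onJoin {x y z : ℙ F (M F)} (h : OnJoin x y z) :
    ∃ a b : F, x.rep = a • y.rep + b • z.rep := by
  rw [OnJoin, Projectivization.submodule_eq x, Projectivization.submodule_eq y,
    Projectivization.submodule_eq z, Submodule.span_singleton_le_iff_mem, Submodule.mem_sup] at h
  obtain ⟨p, hp, q, hq, e⟩ := h
  obtain ⟨a, rfl⟩ := Submodule.mem_span_singleton.1 hp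
  obtain ⟨b, rfl⟩ := Submodule.mem_span_singleton.1 hq
  exact ⟨a, b, e.symm⟩

theorem onJoin_mk {x : ℙ F (M F)} {s t : M F} (hs : s ≠ 0) (ht : t ≠ 0) {a b : F}
    (h : x.rep = a • s + b • t) :
    OnJoin x (Projectivization.mk F s hs) (Projectivization.mk F t ht) := by
  rw [OnJoin, Projectivization.submodule_eq x, Projectivization.submodule_mk,
    Projectivization.submodule_mk, Submodule.span_singleton_le_iff_mem, Submodule.mem_sup]
  exact ⟨a • s, Submodule.mem_span_singleton.2 ⟨a, rfl⟩, b • t,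
    Submodule.mem_span_singleton.2 ⟨b, rfl⟩, h.symm⟩

/-- If `x` lies on a secant through the point `e ⊗ f` of `Q(x)`, it does not lie on a tangent there:
subtracting a multiple of `e ⊗ f` from a tensor `e ⊗ w + u ⊗ f` never gives a pure tensor. -/
theorem exists_of_onSecantThrough {x z : ℙ F (M F)} {U W : Submodule F (Fin 3 → F)}
    {e f : Fin 3 → F} (hQ : IsQ x U W) (hr : pointRk x = 2) (he : e ∈ U) (hf : f ∈ W)
    (he0 : e ≠ 0) (hf0 : f ≠ 0) (hz : z.rep = e ⊗ₜ f) (hsec : OnSecantThrough z x) :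
    ∃ α : F, α ≠ 0 ∧ ∃ u ∈ U, ∃ w ∈ W, LinearIndependent F ![e, u] ∧ LinearIndependent F ![f, w] ∧
      x.rep = α • (e ⊗ₜ f + u ⊗ₜ w) := by
  rcases secant_or_tangent hQ.1 he hf he0 hf0 (rep_mem_segreSpan hQ) hr hQ.2.1 with
    h | ⟨u, hu, w, hw, heu, hfw, ex⟩
  · exact h
  exfalso
  obtain ⟨y, hy, -, hj⟩ := hsec
  obtain ⟨a, b, ej⟩ := exists_of_onJoin hj
  rw [← y.mk_rep] at hy
  obtain ⟨p, -, q, -, -, -, ey⟩ := exists_of_mem_segre y.rep_nonzero hy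
  have h1 : rk (e ⊗ₜ[F] (w - a • f) + u ⊗ₜ[F] f) ≤ 1 := by
    have : e ⊗ₜ[F] (w - a • f) + u ⊗ₜ[F] f = (b • p) ⊗ₜ q := by
      rw [TensorProduct.tmul_sub, TensorProduct.tmul_smul, ← TensorProduct.smul_tmul']
      rw [ex, ey, hz] at ej
      rw [sub_add_eq_add_sub, ej]
      abel
    rw [this]
    exact rk_tmul_le _ _
  have h2 : rk (e ⊗ₜ[F] (w - a • f) + u ⊗ₜ[F] f) = 2 := by
    refine rk_eq_two_iff.2 ⟨heu, ?_⟩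
    rw [LinearIndependent.pair_iff] at hfw ⊢
    intro s t est
    obtain ⟨h1, h2⟩ := hfw (t - s * a) s (by rw [← est]; module)
    subst h2
    exact ⟨rfl, by simpa using h1⟩
  omega

theorem exists_of_not_onSecantThrough {x z : ℙ F (M F)} {U W : Submodule F (Fin 3 → F)}
    {e f : Fin 3 → F} (hQ : IsQ x U W) (hr : pointRk x = 2) (he : e ∈ U) (hf : f ∈ W)
    (he0 : e ≠ 0) (hf0 : f ≠ 0) (hz : z.rep = e ⊗ₜ f) (hsec : ¬ OnSecantThrough z x) :
    ∃ u ∈ U, ∃ w ∈ W, LinearIndependent F ![e, u] ∧ LinearIndependent F ![f, w] ∧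
      x.rep = e ⊗ₜ w + u ⊗ₜ f := by
  rcases secant_or_tangent hQ.1 he hf he0 hf0 (rep_mem_segreSpan hQ) hr hQ.2.1 with
    ⟨α, hα, u, hu, w, hw, heu, hfw, ex⟩ | h
  · exfalso
    have hu0 : u ≠ 0 := heu.ne_zero 1
    have hw0 : w ≠ 0 := hfw.ne_zero 1
    have hz' : z = Projectivization.mk F _ (tmul_ne_zero he0 hf0) := by
      rw [← z.mk_rep]
      simp only [hz]
    refine hsec ⟨_, mk_mem_segre hu0 hw0 trivial trivial, ?_, ?_⟩
    · intro e'
      obtain ⟨c, hc⟩ := (Projectivization.mk_eq_mk_iff' F _ _ _ _).1 (e'.trans hz')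
      rw [TensorProduct.smul_tmul'] at hc
      obtain ⟨d, -, hd⟩ := exists_smul_of_tmul_eq_right hu0 hw0 hc.symm
      have := LinearIndependent.pair_iff.1 heu (d * c) (-1) (by rw [hd]; module)
      simp at this
    · rw [hz']
      exact onJoin_mk _ _ (by rw [ex, smul_add])
  · exact h

/-- Two points of rank two on a line that lies in no span of an `S₂,₃` or `S₃,₂`: their planes meet
in a line each, which gives the point `e ⊗ f` common to the two quadrics. -/
theorem exists_of_twoSingularPoints {C : ℙ F (M F) → ℙ F (M F) → ℙ F (M F) → Prop} {A : V F}
    (h : A ∈ twoSingularPoints C) : Module.finrank F (contractionSpace A) = 2 ∧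
    ∃ (x₁ x₂ z : ℙ F (M F)) (U₁ W₁ U₂ W₂ : Submodule F (Fin 3 → F)) (e f : Fin 3 → F),
      x₁.rep ∈ contractionSpace A ∧ x₂.rep ∈ contractionSpace A ∧ pointRk x₁ = 2 ∧ pointRk x₂ = 2 ∧
      IsQ x₁ U₁ W₁ ∧ IsQ x₂ U₂ W₂ ∧ C z x₁ x₂ ∧ z.rep = e ⊗ₜ f ∧ e ≠ 0 ∧ f ≠ 0 ∧
      e ∈ U₁ ∧ e ∈ U₂ ∧ f ∈ W₁ ∧ f ∈ W₂ ∧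
      (∀ u₁ ∈ U₁, ∀ u₂ ∈ U₂, LinearIndependent F ![e, u₁] → LinearIndependent F ![e, u₂] →
        LinearIndependent F ![e, u₁, u₂]) ∧
      (∀ w₁ ∈ W₁, ∀ w₂ ∈ W₂, LinearIndependent F ![f, w₁] → LinearIndependent F ![f, w₂] →
        LinearIndependent F ![f, w₁, w₂]) := by
  obtain ⟨⟨hA, -⟩, -, h23, h32, x₁, hx₁, x₂, hx₂, hne, hr₁, hr₂, U₁, W₁, U₂, W₂, z, hQ₁, hQ₂, hz,
    hC⟩ := h
  have hz' : z ∈ segre U₁ W₁ ∩ segre U₂ W₂ := by rw [hz]; rfl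
  have hz1 := hz'.1
  rw [← z.mk_rep] at hz1
  obtain ⟨e, he₁, f, hf₁, he0, hf0, ez⟩ := exists_of_mem_segre z.rep_nonzero hz1
  obtain ⟨he₂, hf₂⟩ := (mem_segre_iff ez).1 hz'.2
  have m₁ := rep_mem_of_mem_line hx₁
  have m₂ := rep_mem_of_mem_line hx₂
  have hspan := eq_span_pair_of_finrank_eq_two hA m₁ m₂ (linearIndependent_rep hne)
  have hUU : U₁ ≠ U₂ := by
    rintro rfl
    refine h23 ⟨U₁, hQ₁.1, ?_⟩
    rw [hspan, Submodule.span_le]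
    rintro _ (rfl | rfl)
    · exact segreSpan_mono le_rfl le_top (rep_mem_segreSpan hQ₁)
    · exact segreSpan_mono le_rfl le_top (rep_mem_segreSpan hQ₂)
  have hWW : W₁ ≠ W₂ := by
    rintro rfl
    refine h32 ⟨W₁, hQ₁.2.1, ?_⟩
    rw [hspan, Submodule.span_le]
    rintro _ (rfl | rfl)
    · exact segreSpan_mono le_top le_rfl (rep_mem_segreSpan hQ₁)
    · exact segreSpan_mono le_top le_rfl (rep_mem_segreSpan hQ₂)
  have key : ∀ {P₁ P₂ : Submodule F (Fin 3 → F)} {v : Fin 3 → F}, Module.finrank F P₁ = 2 →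
      Module.finrank F P₂ = 2 → P₁ ≠ P₂ → v ∈ P₁ → v ∈ P₂ → ∀ u₁ ∈ P₁, ∀ u₂ ∈ P₂,
      LinearIndependent F ![v, u₁] → LinearIndependent F ![v, u₂] →
      LinearIndependent F ![v, u₁, u₂] := by
    intro P₁ P₂ v hP₁ hP₂ hPP hv₁ hv₂ u₁ hu₁ u₂ hu₂ l₁ l₂
    refine linearIndependent_triple_of_notMem l₁ hv₁ hu₁ fun hu₂' => hPP ?_
    rw [eq_span_pair_of_finrank_eq_two hP₂ hv₂ hu₂ l₂]
    exact eq_span_pair_of_finrank_eq_two hP₁ hv₁ hu₂' l₂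
  exact ⟨hA, x₁, x₂, z, U₁, W₁, U₂, W₂, e, f, m₁, m₂, hr₁, hr₂, hQ₁, hQ₂, hC, ez, he0, hf0, he₁,
    he₂, hf₁, hf₂, key hQ₁.1 hQ₂.1 hUU he₁ he₂, key hQ₁.2.1 hQ₂.2.1 hWW hf₁ hf₂⟩

theorem o12_subset_orbit :
    o12 F ⊆ MulAction.orbit (H F) (tens (E 0 1 + E 1 0) (E 0 2 + E 2 0)) := by
  intro A h
  obtain ⟨hA, x₁, x₂, z, U₁, W₁, U₂, W₂, e, f, m₁, m₂, hr₁, hr₂, hQ₁, hQ₂, ⟨hs₁, hs₂⟩, ez, he0, hf0,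
    he₁, he₂, hf₁, hf₂, hU, hW⟩ := exists_of_twoSingularPoints h
  obtain ⟨u₁, hu₁, w₁, hw₁, lu₁, lw₁, e₁⟩ :=
    exists_of_not_onSecantThrough hQ₁ hr₁ he₁ hf₁ he0 hf0 ez hs₁
  obtain ⟨u₂, hu₂, w₂, hw₂, lu₂, lw₂, e₂⟩ :=
    exists_of_not_onSecantThrough hQ₂ hr₂ he₂ hf₂ he0 hf0 ez hs₂
  rw [e₁] at m₁
  rw [e₂] at m₂
  refine mem_orbit_tens hA (hU u₁ hu₁ u₂ hu₂ lu₁ lu₂) (hW w₁ hw₁ w₂ hw₂ lw₁ lw₂)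
    (linearIndependent_of_minor 0 1 0 2 (by simp)) fun g k hg hk => ?_
  simp only [E, TensorProduct.congr_tmul, hg, hk, map_add]
  exact ⟨m₁, m₂⟩

/-- The canonical form lists the secant point first; when `x₂` is the secant point, the last two basis
vectors are interchanged. -/
theorem o13_subset_orbit :
    o13 F ⊆ MulAction.orbit (H F) (tens (E 0 0 + E 1 1) (E 0 2 + E 2 0)) := by
  intro A h
  obtain ⟨hA, x₁, x₂, z, U₁, W₁, U₂, W₂, e, f, m₁, m₂, hr₁, hr₂, hQ₁, hQ₂, hs, ez, he0, hf0,
    he₁, he₂, hf₁, hf₂, hU, hW⟩ := exists_of_twoSingularPoints h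
  rcases hs with ⟨hs₁, hs₂⟩ | ⟨hs₂, hs₁⟩
  · obtain ⟨α, hα, u₁, hu₁, w₁, hw₁, lu₁, lw₁, e₁⟩ :=
      exists_of_onSecantThrough hQ₁ hr₁ he₁ hf₁ he0 hf0 ez hs₁
    obtain ⟨u₂, hu₂, w₂, hw₂, lu₂, lw₂, e₂⟩ :=
      exists_of_not_onSecantThrough hQ₂ hr₂ he₂ hf₂ he0 hf0 ez hs₂
    rw [e₁, Submodule.smul_mem_iff _ hα] at m₁
    rw [e₂] at m₂
    refine mem_orbit_tens hA (hU u₁ hu₁ u₂ hu₂ lu₁ lu₂) (hW w₁ hw₁ w₂ hw₂ lw₁ lw₂)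
      (linearIndependent_of_minor 0 0 0 2 (by simp)) fun g k hg hk => ?_
    simp only [E, TensorProduct.congr_tmul, hg, hk, map_add]
    exact ⟨m₁, m₂⟩
  · obtain ⟨u₁, hu₁, w₁, hw₁, lu₁, lw₁, e₁⟩ :=
      exists_of_not_onSecantThrough hQ₁ hr₁ he₁ hf₁ he0 hf0 ez hs₁
    obtain ⟨α, hα, u₂, hu₂, w₂, hw₂, lu₂, lw₂, e₂⟩ :=
      exists_of_onSecantThrough hQ₂ hr₂ he₂ hf₂ he0 hf0 ez hs₂
    rw [e₁] at m₁
    rw [e₂, Submodule.smul_mem_iff _ hα] at m₂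
    have swap : ∀ {a b c : Fin 3 → F}, LinearIndependent F ![a, b, c] →
        LinearIndependent F ![a, c, b] := by
      intro a b c h
      rw [linearIndependent_triple_iff] at h ⊢
      intro r s t e
      obtain ⟨h1, h2, h3⟩ := h r t s (by rw [← e]; abel)
      exact ⟨h1, h3, h2⟩
    refine mem_orbit_tens hA (swap (hU u₁ hu₁ u₂ hu₂ lu₁ lu₂)) (swap (hW w₁ hw₁ w₂ hw₂ lw₁ lw₂))
      (linearIndependent_of_minor 0 0 0 2 (by simp)) fun g k hg hk => ?_
    simp only [E, TensorProduct.congr_tmul, hg, hk, map_add]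
    exact ⟨m₂, m₁⟩

theorem o14_subset_orbit :
    o14 F ⊆ MulAction.orbit (H F) (tens (E 0 0 + E 1 1) (E 0 0 + E 2 2)) := by
  intro A h
  obtain ⟨hA, x₁, x₂, z, U₁, W₁, U₂, W₂, e, f, m₁, m₂, hr₁, hr₂, hQ₁, hQ₂, ⟨hs₁, hs₂⟩, ez, he0, hf0,
    he₁, he₂, hf₁, hf₂, hU, hW⟩ := exists_of_twoSingularPoints h
  obtain ⟨α, hα, u₁, hu₁, w₁, hw₁, lu₁, lw₁, e₁⟩ :=
    exists_of_onSecantThrough hQ₁ hr₁ he₁ hf₁ he0 hf0 ez hs₁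
  obtain ⟨β, hβ, u₂, hu₂, w₂, hw₂, lu₂, lw₂, e₂⟩ :=
    exists_of_onSecantThrough hQ₂ hr₂ he₂ hf₂ he0 hf0 ez hs₂
  rw [e₁, Submodule.smul_mem_iff _ hα] at m₁
  rw [e₂, Submodule.smul_mem_iff _ hβ] at m₂
  refine mem_orbit_tens hA (hU u₁ hu₁ u₂ hu₂ lu₁ lu₂) (hW w₁ hw₁ w₂ hw₂ lw₁ lw₂)
    (linearIndependent_of_minor 0 0 2 2 (by simp)) fun g k hg hk => ?_
  simp only [E, TensorProduct.congr_tmul, hg, hk, map_add]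
  exact ⟨m₁, m₂⟩

/-! ### A single point of rank two -/

theorem linearIndependent_of_rk_ne {x y : M F} (hx : x ≠ 0) (hy : y ≠ 0) (h : rk x ≠ rk y) :
    LinearIndependent F ![x, y] := by
  rw [LinearIndependent.pair_iff' hx]
  rintro a rfl
  have ha : a ≠ 0 := by rintro rfl; simp at hy
  exact h (rk_smul ha x).symm

/-- On a line with no point of rank one and the single point `x` of rank two, every other point has
rank three. -/
theorem rk_eq_three_of_unique {A : V F} (h₁ : rankDist A 1 = 0) (h₂ : rankDist A 2 = 1)
    {x y : M F} (hx : x ∈ contractionSpace A) (hy : y ∈ contractionSpace A) (hx2 : rk x = 2)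
    (hxy : LinearIndependent F ![x, y]) (a : F) {b : F} (hb : b ≠ 0) : rk (a • x + b • y) = 3 := by
  have hm : a • x + b • y ∈ contractionSpace A :=
    Submodule.add_mem _ (Submodule.smul_mem _ _ hx) (Submodule.smul_mem _ _ hy)
  have hn : a • x + b • y ≠ 0 := by
    have := ne_smul_of_linearIndependent hxy a 0 hb
    rwa [zero_smul] at this
  have r0 : rk (a • x + b • y) ≠ 0 := fun h => hn (rk_eq_zero.1 h)
  have r1 := rankDist_eq_zero_iff.1 h₁ _ hm hn
  have r2 : rk (a • x + b • y) ≠ 2 := by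
    intro h
    obtain ⟨c, hc⟩ := eq_smul_of_rankDist_eq_one h₂ hm hx hn (hxy.ne_zero 0) h hx2
    exact ne_smul_of_linearIndependent hxy a c hb hc
  have r3 := rk_le_three (a • x + b • y)
  omega

/-- For a split point of rank three, the points `y₂` and `x₂` of rank two span a line in the span of
`σ(U × W)` that is disjoint from it: adding the pure summand to a pure tensor would give a further
point of rank at most two on the line of `A`. -/
theorem exists_of_o15 {A : V F} (h : A ∈ o15 F) :
    Module.finrank F (contractionSpace A) = 2 ∧
    ∃ U W : Submodule F (Fin 3 → F), Module.finrank F U = 2 ∧ Module.finrank F W = 2 ∧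
      ∃ x ∈ segreSpan U W, ∃ y ∈ segreSpan U W, ∃ u w : Fin 3 → F, u ∉ U ∧ w ∉ W ∧
        x ∈ contractionSpace A ∧ u ⊗ₜ w + y ∈ contractionSpace A ∧ rk x = 2 ∧
        ∀ s t : F, rk (s • x + t • y) ≤ 1 → s = 0 ∧ t = 0 := by
  obtain ⟨⟨hA, -⟩, h₁, h₂, x₁, hx₁, x₂, hx₂, hr₁, hr₂, y₁, y₂, hy₁, hy₂, hj, U, W, hQ, hQ'⟩ := h
  obtain ⟨a, b, ej⟩ := exists_of_onJoin hj
  obtain ⟨u, w, hu, hw, ey⟩ := exists_rep_eq_tmul hy₁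
  have m₁ := rep_mem_of_mem_line hx₁
  have m₂ := rep_mem_of_mem_line hx₂
  have hy : b • y₂.rep ∈ segreSpan U W := Submodule.smul_mem _ _ (rep_mem_segreSpan hQ')
  have hx := rep_mem_segreSpan hQ
  have r₁ : rk x₁.rep = 3 := hr₁
  have r₂ : rk x₂.rep = 2 := hr₂
  have hli : LinearIndependent F ![x₂.rep, x₁.rep] :=
    linearIndependent_of_rk_ne x₂.rep_nonzero x₁.rep_nonzero (by omega)
  have h3 := fun s t ht => rk_eq_three_of_unique h₁ h₂ m₂ m₁ hr₂ hli s (b := t) ht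
  rw [ey, TensorProduct.smul_tmul'] at ej
  rw [ej] at m₁ h3 r₁
  have key : ∀ {t : M F}, rk t ≤ 1 → ∀ p q : Fin 3 → F, rk (p ⊗ₜ q + t) ≤ 2 := by
    intro t ht p q
    rcases Nat.lt_or_ge (rk t) 1 with h | h
    · rw [rk_eq_zero.1 (by omega : rk t = 0), add_zero]
      exact (rk_tmul_le _ _).trans (by norm_num)
    · obtain ⟨u', w', -, -, rfl⟩ := rk_eq_one (by omega : rk t = 1)
      exact rk_add_le _ _ _ _
  refine ⟨hA, U, W, hQ.1, hQ.2.1, x₂.rep, hx, b • y₂.rep, hy, a • u, w, ?_, ?_, m₂, m₁, hr₂, ?_⟩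
  · intro hu'
    have := rk_le_two_of_mem_left (W := ⊤) hQ.1 (Submodule.add_mem _
      (tmul_mem_segreSpan hu' (Submodule.mem_top (x := w))) (segreSpan_mono le_rfl le_top hy))
    omega
  · intro hw'
    have := rk_le_two_of_mem_right (U := ⊤) hQ.2.1 (Submodule.add_mem _
      (tmul_mem_segreSpan (Submodule.mem_top (x := a • u)) hw') (segreSpan_mono le_top le_rfl hy))
    omega
  · intro s t hst
    by_cases ht : t = 0
    · subst ht
      refine ⟨?_, rfl⟩
      by_contra hs
      rw [zero_smul, add_zero, rk_smul hs] at hst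
      omega
    · exfalso
      have h3' := h3 s t ht
      have h2 := key hst (t • a • u) w
      rw [← TensorProduct.smul_tmul' t (a • u) w] at h2
      rw [show s • x₂.rep + t • ((a • u) ⊗ₜ[F] w + b • y₂.rep) =
        t • (a • u) ⊗ₜ[F] w + (s • x₂.rep + t • b • y₂.rep) by module] at h3'
      omega

theorem o15_eq_empty (h : ∀ γ δ : F, ¬ Anisotropic γ δ) : o15 F = ∅ := by
  rw [Set.eq_empty_iff_forall_notMem]
  intro A hA
  obtain ⟨-, U, W, hU, hW, x, hx, y, hy, u, w, -, -, -, -, -, hst⟩ := exists_of_o15 hA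
  obtain ⟨γ, δ, han, -⟩ := exists_companion hU hW hx hy hst
  exact h γ δ han

/-- The line in the span of `σ(U × W)` takes the form of `o10`, and the pure summand supplies the third
basis vectors. -/
theorem o15_subset_orbit {γ₀ δ₀ : F} (h₀ : IsUniversal γ₀ δ₀) : o15 F ⊆ MulAction.orbit (H F)
    (tens (E 0 0 + γ₀ • E 1 1) (E 2 2 + (E 0 1 + E 1 0 + δ₀ • E 1 1))) := by
  intro A h
  obtain ⟨hA, U, W, hU, hW, x, hx, y, hy, u, w, hu, hw, mx, my, hr, hst⟩ := exists_of_o15 h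
  obtain ⟨a, b, ha, u₁, hu₁, u₂, hu₂, w₁, hw₁, w₂, hw₂, ex, ey⟩ :=
    exists_normal_form h₀ hU hW hx hy hst
  have hr' := hr
  rw [ex, ← TensorProduct.tmul_smul] at hr
  have huu := (rk_eq_two_iff.1 hr).1
  rw [ex, TensorProduct.smul_tmul'] at hr'
  have hww := (rk_eq_two_iff.1 hr').2
  have my' := Submodule.add_mem _ (Submodule.smul_mem _ a my) (Submodule.smul_mem _ b mx)
  rw [smul_add, add_assoc, ey, TensorProduct.smul_tmul'] at my'
  rw [ex] at mx
  have hau : a • u ∉ U := fun h => hu ((Submodule.smul_mem_iff _ ha).1 h)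
  have l₁ := linearIndependent_triple_of_notMem huu hu₁ hu₂ hau
  have l₂ := linearIndependent_triple_of_notMem hww hw₁ hw₂ hw
  refine mem_orbit_tens hA l₁ l₂ (linearIndependent_of_minor 0 0 2 2 (by simp)) fun g k hg hk => ?_
  simp only [E, TensorProduct.congr_tmul, hg, hk, map_add, map_smul, Matrix.cons_val]
  exact ⟨mx, my'⟩

theorem exists_isQ {x : ℙ F (M F)} (hr₂ : pointRk x = 2) : ∃ U W, IsQ x U W := by
  obtain ⟨u, u', w, w', e⟩ := exists_of_rk_le_two (le_of_eq hr₂ : rk x.rep ≤ 2)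
  have hr : rk x.rep = 2 := hr₂
  rw [e] at hr
  obtain ⟨hu, hw⟩ := rk_eq_two_iff.1 hr
  refine ⟨_, _, finrank_span_pair hu, finrank_span_pair hw, ?_⟩
  rw [Projectivization.submodule_eq, Submodule.span_singleton_le_iff_mem, e]
  exact Submodule.add_mem _
    (tmul_mem_segreSpan (Submodule.subset_span (by simp)) (Submodule.subset_span (by simp)))
    (tmul_mem_segreSpan (Submodule.subset_span (by simp)) (Submodule.subset_span (by simp)))

/-- A point of rank three that does not split contracts, modulo the plane `U` of `Q(x₂)`, into the
other plane `W`. -/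
theorem mem_of_not_splits {x₁ x₂ : ℙ F (M F)} {U W : Submodule F (Fin 3 → F)} (hQ : IsQ x₂ U W)
    (r₁ : rk x₁.rep = 3) (hns : ¬ Splits x₁ x₂) {u₁ u₂ u₃ z₁ z₂ z₃ : Fin 3 → F} (hu₁ : u₁ ∈ U)
    (hu₂ : u₂ ∈ U) (hu : LinearIndependent F ![u₁, u₂])
    (ex : x₁.rep = u₁ ⊗ₜ z₁ + u₂ ⊗ₜ z₂ + u₃ ⊗ₜ z₃) (hz0 : z₃ ≠ 0) : z₃ ∈ W := by
  obtain ⟨hU, hW, -⟩ := id hQ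
  by_contra hzW
  apply hns
  obtain ⟨p₁, hp₁, c₁, rfl⟩ := exists_eq_add_smul_of_notMem hW hzW z₁
  obtain ⟨p₂, hp₂, c₂, rfl⟩ := exists_eq_add_smul_of_notMem hW hzW z₂
  have ex' : x₁.rep = (u₃ + c₁ • u₁ + c₂ • u₂) ⊗ₜ z₃ + (u₁ ⊗ₜ p₁ + u₂ ⊗ₜ p₂) := by
    rw [ex]
    simp only [TensorProduct.tmul_add, TensorProduct.tmul_smul, TensorProduct.add_tmul,
      ← TensorProduct.smul_tmul']
    module
  have hr3 := r₁
  rw [ex', add_comm, rk_eq_three_iff] at hr3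
  have hv0 : u₃ + c₁ • u₁ + c₂ • u₂ ≠ 0 := hr3.1.ne_zero 2
  have hp : LinearIndependent F ![p₁, p₂] := by
    rw [LinearIndependent.pair_iff]
    intro s t e
    have := linearIndependent_triple_iff.1 hr3.2 s t 0 (by rw [e]; simp)
    exact ⟨this.1, this.2.1⟩
  have hrk : rk (u₁ ⊗ₜ[F] p₁ + u₂ ⊗ₜ[F] p₂) = 2 := rk_eq_two_iff.2 ⟨hu, hp⟩
  have hn0 : u₁ ⊗ₜ[F] p₁ + u₂ ⊗ₜ[F] p₂ ≠ 0 := by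
    intro h; rw [h, rk_zero] at hrk; omega
  refine ⟨Projectivization.mk F _ (tmul_ne_zero hv0 hz0), Projectivization.mk F _ hn0,
    by rw [pointRk_mk, rk_tmul hv0 hz0], by rw [pointRk_mk, hrk],
    onJoin_mk (a := 1) (b := 1) _ _ (by rw [ex', one_smul, one_smul]), U, W, hQ, hU, hW, ?_⟩
  rw [Projectivization.submodule_mk, Submodule.span_singleton_le_iff_mem]
  exact Submodule.add_mem _ (tmul_mem_segreSpan hu₁ hp₁) (tmul_mem_segreSpan hu₂ hp₂)

/-- Since `x₁` does not split, its component `z₃` along a vector outside `U` lies in `W`. A basis of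
`W` containing `z₃` expresses `x₂` through `z₃` and `w'`, and the absence of a second point of rank
two forces `w'` into the span of `y₂` and `z₃`; rescaling gives the canonical form. -/
theorem o16_subset_orbit :
    o16 F ⊆ MulAction.orbit (H F) (tens (E 0 1 + E 1 0) (E 0 2 + E 1 1 + E 2 0)) := by
  rintro A ⟨⟨hA, -⟩, h₁, h₂, x₁, hx₁, x₂, hx₂, hr₁, hr₂, hns⟩
  obtain ⟨U, W, hQ⟩ := exists_isQ hr₂
  obtain ⟨hU, hW, -⟩ := id hQ
  have m₁ := rep_mem_of_mem_line hx₁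
  have m₂ := rep_mem_of_mem_line hx₂
  have hx := rep_mem_segreSpan hQ
  have r₁ : rk x₁.rep = 3 := hr₁
  have r₂ : rk x₂.rep = 2 := hr₂
  have hli : LinearIndependent F ![x₂.rep, x₁.rep] :=
    linearIndependent_of_rk_ne x₂.rep_nonzero x₁.rep_nonzero (by omega)
  have h3 := fun s t ht => rk_eq_three_of_unique h₁ h₂ m₂ m₁ hr₂ hli s (b := t) ht
  obtain ⟨u₁, hu₁, hu0⟩ := exists_ne_zero_of_finrank_pos (U := U) (by omega)
  obtain ⟨u₂, hu₂, hu⟩ := exists_pair_of_finrank_eq_two hU hu0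
  obtain ⟨u₃, hu₃⟩ := exists_notMem_of_finrank_eq_two hU
  have hu' := linearIndependent_triple_of_notMem hu hu₁ hu₂ hu₃
  obtain ⟨z₁, z₂, z₃, ex⟩ := exists_eq_sum_of_triple hu' x₁.rep
  have hz : LinearIndependent F ![z₁, z₂, z₃] := (rk_eq_three_iff.1 (ex ▸ r₁)).2
  have hz0 : z₃ ≠ 0 := hz.ne_zero 2
  have hzW : z₃ ∈ W := mem_of_not_splits hQ r₁ hns hu₁ hu₂ hu ex hz0
  obtain ⟨w', hw', hzw⟩ := exists_pair_of_finrank_eq_two hW hz0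
  obtain ⟨v₂, hv₂, v₁, hv₁, ex₂⟩ := exists_of_mem_segreSpan_right hW hzW hw' hzw hx
  have hv : LinearIndependent F ![v₂, v₁] := by rw [ex₂] at r₂; exact (rk_eq_two_iff.1 r₂).1
  have hq : u₁ ⊗ₜ z₁ + u₂ ⊗ₜ z₂ ∈ segreSpan U ⊤ :=
    Submodule.add_mem _ (tmul_mem_segreSpan hu₁ trivial) (tmul_mem_segreSpan hu₂ trivial)
  obtain ⟨y₂, -, y₁, -, eq⟩ := exists_of_mem_segreSpan_left hU hv₂ hv₁ hv hq
  rw [eq] at ex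
  rw [ex] at r₁ m₁ h3
  rw [ex₂] at m₂ h3
  have hy := (rk_eq_three_iff.1 r₁).2
  obtain ⟨β, α, κ, ew⟩ := exists_coeff_of_triple hy w'
  -- otherwise a combination with `x₂` would cancel the factor `y₁` and have rank at most two
  have hα : α = 0 := by
    by_contra hα
    have h := h3 (-1) α hα
    rw [ew, show (-1 : F) • (v₂ ⊗ₜ[F] z₃ + v₁ ⊗ₜ[F] (β • y₂ + α • y₁ + κ • z₃)) +
        α • (v₂ ⊗ₜ[F] y₂ + v₁ ⊗ₜ[F] y₁ + u₃ ⊗ₜ[F] z₃) =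
        (α • v₂ - β • v₁) ⊗ₜ y₂ + (α • u₃ - v₂ - κ • v₁) ⊗ₜ z₃ by
      simp only [TensorProduct.tmul_add, TensorProduct.sub_tmul, TensorProduct.tmul_smul,
        ← TensorProduct.smul_tmul']
      module] at h
    have h2 := rk_add_le (α • v₂ - β • v₁) (α • u₃ - v₂ - κ • v₁) y₂ z₃
    omega
  have hβ : β ≠ 0 := by
    rintro rfl
    have := LinearIndependent.pair_iff.1 hzw κ (-1) (by rw [ew, hα]; module)
    simp at this
  subst hα
  have f₂ : v₂ ⊗ₜ[F] z₃ + v₁ ⊗ₜ[F] w' = v₁ ⊗ₜ w' + (β⁻¹ • v₂) ⊗ₜ (β • z₃) := by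
    rw [TensorProduct.smul_tmul_smul, inv_mul_cancel₀ hβ, one_smul, add_comm]
  have f₁ : v₂ ⊗ₜ[F] y₂ + v₁ ⊗ₜ[F] y₁ + u₃ ⊗ₜ[F] z₃ =
      v₁ ⊗ₜ y₁ + (β⁻¹ • v₂) ⊗ₜ w' + (β⁻¹ • (u₃ - (κ / β) • v₂)) ⊗ₜ (β • z₃) := by
    rw [ew]
    simp only [TensorProduct.tmul_add, TensorProduct.sub_tmul, TensorProduct.tmul_smul,
      ← TensorProduct.smul_tmul', smul_sub]
    match_scalars <;> field_simp <;> ring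
  rw [f₂] at m₂
  rw [f₁] at m₁ r₁
  have l₁ := (rk_eq_three_iff.1 r₁).1
  rw [add_assoc, add_comm, add_comm ((β⁻¹ • v₂) ⊗ₜ[F] w')] at r₁
  have l₂ := (rk_eq_three_iff.1 r₁).2
  refine mem_orbit_tens hA l₁ l₂ (linearIndependent_of_minor 0 1 0 2 (by simp))
    fun g k hg hk => ?_
  simp only [E, TensorProduct.congr_tmul, hg, hk, map_add]
  exact ⟨m₂, m₁⟩

/-! ### The sixteen types exhaust `Ω` -/

theorem span_pair_le {E : Type*} [AddCommGroup E] [Module F E] {U : Submodule F E} {x y : E}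
    (hx : x ∈ U) (hy : y ∈ U) : Submodule.span F {x, y} ≤ U := by
  rw [Submodule.span_le]
  rintro _ (rfl | rfl) <;> assumption

theorem mem_o4 {A : V F} (hA : A ∈ Omega F) {u w w' : Fin 3 → F} (hu : u ≠ 0)
    (hw : LinearIndependent F ![w, w']) (h : u ⊗ₜ w ∈ contractionSpace A)
    (h' : u ⊗ₜ w' ∈ contractionSpace A) (hli : LinearIndependent F ![u ⊗ₜ[F] w, u ⊗ₜ[F] w']) :
    A ∈ o4 F := by
  refine ⟨hA, Submodule.span F {u}, Submodule.span F {w, w'}, finrank_span_singleton hu,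
    finrank_span_pair hw, ?_⟩
  have hspan := eq_span_pair_of_finrank_eq_two hA.1 h h' hli
  ext x
  constructor
  · intro hx
    have := rep_mem_of_mem_line hx
    rw [hspan] at this
    obtain ⟨a, b, e⟩ := Submodule.mem_span_pair.1 this
    have e' : x.rep = u ⊗ₜ (a • w + b • w') := by
      rw [← e, TensorProduct.tmul_add, TensorProduct.tmul_smul, TensorProduct.tmul_smul]
    exact (mem_segre_iff e').2 ⟨Submodule.mem_span_singleton_self u,
      Submodule.mem_span_pair.2 ⟨a, b, rfl⟩⟩
  · intro hx
    rw [← x.mk_rep] at hx ⊢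
    obtain ⟨p, hp, q, hq, -, -, e⟩ := exists_of_mem_segre x.rep_nonzero hx
    rw [mk_mem_line, e]
    obtain ⟨c, rfl⟩ := Submodule.mem_span_singleton.1 hp
    obtain ⟨a, b, rfl⟩ := Submodule.mem_span_pair.1 hq
    rw [← TensorProduct.smul_tmul', TensorProduct.tmul_add, TensorProduct.tmul_smul,
      TensorProduct.tmul_smul]
    exact Submodule.smul_mem _ _ (Submodule.add_mem _ (Submodule.smul_mem _ _ h)
      (Submodule.smul_mem _ _ h'))

theorem mem_o4T {A : V F} (hA : A ∈ Omega F) {u u' w : Fin 3 → F} (hw : w ≠ 0)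
    (hu : LinearIndependent F ![u, u']) (h : u ⊗ₜ w ∈ contractionSpace A)
    (h' : u' ⊗ₜ w ∈ contractionSpace A) (hli : LinearIndependent F ![u ⊗ₜ[F] w, u' ⊗ₜ[F] w]) :
    A ∈ o4T F := by
  refine ⟨hA, Submodule.span F {u, u'}, Submodule.span F {w}, finrank_span_pair hu,
    finrank_span_singleton hw, ?_⟩
  have hspan := eq_span_pair_of_finrank_eq_two hA.1 h h' hli
  ext x
  constructor
  · intro hx
    have := rep_mem_of_mem_line hx
    rw [hspan] at this
    obtain ⟨a, b, e⟩ := Submodule.mem_span_pair.1 this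
    have e' : x.rep = (a • u + b • u') ⊗ₜ w := by
      rw [← e, TensorProduct.add_tmul, TensorProduct.smul_tmul', TensorProduct.smul_tmul']
    exact (mem_segre_iff e').2 ⟨Submodule.mem_span_pair.2 ⟨a, b, rfl⟩,
      Submodule.mem_span_singleton_self w⟩
  · intro hx
    rw [← x.mk_rep] at hx ⊢
    obtain ⟨p, hp, q, hq, -, -, e⟩ := exists_of_mem_segre x.rep_nonzero hx
    rw [mk_mem_line, e]
    obtain ⟨c, rfl⟩ := Submodule.mem_span_singleton.1 hq
    obtain ⟨a, b, rfl⟩ := Submodule.mem_span_pair.1 hp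
    rw [TensorProduct.tmul_smul, TensorProduct.add_tmul, ← TensorProduct.smul_tmul',
      ← TensorProduct.smul_tmul']
    exact Submodule.smul_mem _ _ (Submodule.add_mem _ (Submodule.smul_mem _ _ h)
      (Submodule.smul_mem _ _ h'))

theorem linearIndependent_smul_pair {E : Type*} [AddCommGroup E] [Module F E] {x y : E} {a b : F}
    (ha : a ≠ 0) (hb : b ≠ 0) (h : LinearIndependent F ![x, y]) :
    LinearIndependent F ![a • x, b • y] := by
  rw [LinearIndependent.pair_iff] at h ⊢
  intro s t e
  rw [smul_smul, smul_smul] at e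
  obtain ⟨h1, h2⟩ := h _ _ e
  exact ⟨(mul_eq_zero.1 h1).resolve_right ha, (mul_eq_zero.1 h2).resolve_right hb⟩

theorem mem_o5 {A : V F} (hA : A ∈ Omega F) {u u' w w' : Fin 3 → F}
    (hu : LinearIndependent F ![u, u']) (hw : LinearIndependent F ![w, w'])
    (h : u ⊗ₜ w ∈ contractionSpace A) (h' : u' ⊗ₜ w' ∈ contractionSpace A)
    (hli : LinearIndependent F ![u ⊗ₜ[F] w, u' ⊗ₜ[F] w']) : A ∈ o5 F := by
  have hspan := eq_span_pair_of_finrank_eq_two hA.1 h h' hli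
  have hu0 : u ≠ 0 := hu.ne_zero 0
  have hu0' : u' ≠ 0 := hu.ne_zero 1
  have hw0 : w ≠ 0 := hw.ne_zero 0
  have hw0' : w' ≠ 0 := hw.ne_zero 1
  refine ⟨hA, Set.encard_eq_two.2 ⟨Projectivization.mk F _ (tmul_ne_zero hu0 hw0),
    Projectivization.mk F _ (tmul_ne_zero hu0' hw0'), ?_, ?_⟩⟩
  · intro e
    obtain ⟨c, hc⟩ := (Projectivization.mk_eq_mk_iff' F _ _ _ _).1 e
    have := LinearIndependent.pair_iff.1 hli 1 (-c) (by rw [← hc]; module)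
    simp at this
  · ext x
    constructor
    · rintro ⟨hx, hr⟩
      have := rep_mem_of_mem_line hx
      rw [hspan] at this
      obtain ⟨a, b, e⟩ := Submodule.mem_span_pair.1 this
      have hr' : rk x.rep = 1 := hr
      rw [← x.mk_rep]
      by_cases ha : a = 0
      · right
        rw [Set.mem_singleton_iff, Projectivization.mk_eq_mk_iff']
        exact ⟨b, by rw [← e, ha]; module⟩
      by_cases hb : b = 0
      · left
        rw [Projectivization.mk_eq_mk_iff']
        exact ⟨a, by rw [← e, hb]; module⟩
      exfalso
      rw [← e, TensorProduct.smul_tmul', TensorProduct.smul_tmul'] at hr'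
      have hab := linearIndependent_smul_pair ha hb hu
      have := rk_eq_two_iff.2 ⟨hab, hw⟩
      omega
    · rintro (rfl | rfl)
      · exact ⟨(mk_mem_line _).2 h, by rw [pointRk_mk, rk_tmul hu0 hw0]⟩
      · exact ⟨(mk_mem_line _).2 h', by rw [pointRk_mk, rk_tmul hu0' hw0']⟩

theorem exists_type_of_two_rank_one {A : V F} (hA : A ∈ Omega F) {s t : M F}
    (hs : s ∈ contractionSpace A) (ht : t ∈ contractionSpace A) (hrs : rk s = 1) (hrt : rk t = 1)
    (hst : LinearIndependent F ![s, t]) : A ∈ o4 F ∨ A ∈ o4T F ∨ A ∈ o5 F := by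
  obtain ⟨u, w, hu, hw, rfl⟩ := rk_eq_one hrs
  obtain ⟨u', w', hu', hw', rfl⟩ := rk_eq_one hrt
  by_cases huu : LinearIndependent F ![u, u']
  · by_cases hww : LinearIndependent F ![w, w']
    · exact Or.inr (Or.inr (mem_o5 hA huu hww hs ht hst))
    · rw [LinearIndependent.pair_iff' hw] at hww
      push Not at hww
      obtain ⟨c, rfl⟩ := hww
      have hc : c ≠ 0 := by rintro rfl; simp at hw'
      rw [TensorProduct.tmul_smul] at ht hst
      rw [Submodule.smul_mem_iff _ hc] at ht
      refine Or.inr (Or.inl (mem_o4T hA hw huu hs ht ?_))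
      have := linearIndependent_smul_pair one_ne_zero (inv_ne_zero hc) hst
      rwa [one_smul, smul_smul, inv_mul_cancel₀ hc, one_smul] at this
  · rw [LinearIndependent.pair_iff' hu] at huu
    push Not at huu
    obtain ⟨c, rfl⟩ := huu
    have hc : c ≠ 0 := by rintro rfl; simp at hu'
    rw [← TensorProduct.smul_tmul'] at ht hst
    rw [Submodule.smul_mem_iff _ hc] at ht
    have hli : LinearIndependent F ![u ⊗ₜ[F] w, u ⊗ₜ[F] w'] := by
      have := linearIndependent_smul_pair one_ne_zero (inv_ne_zero hc) hst
      rwa [one_smul, smul_smul, inv_mul_cancel₀ hc, one_smul] at this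
    refine Or.inl (mem_o4 hA hu ?_ hs ht hli)
    rw [LinearIndependent.pair_iff]
    intro a b e
    refine LinearIndependent.pair_iff.1 hli a b ?_
    rw [← TensorProduct.tmul_smul, ← TensorProduct.tmul_smul, ← TensorProduct.tmul_add, e,
      TensorProduct.tmul_zero]

/-- The types `o6`, `o7`, `o7T`, `o8` distinguish the positions of the point of rank one relative to
`Q(x₂)`; without a point of rank two the type is `o9`. -/
theorem exists_type_of_one_rank_one {A : V F} (hA : A ∈ Omega F) (h : rankDist A 1 = 1) :
    A ∈ o6 F ∨ A ∈ o7 F ∨ A ∈ o7T F ∨ A ∈ o8 F ∨ A ∈ o9 F := by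
  obtain ⟨t, ht, ht0, hr, -⟩ := rankDist_eq_one_iff.1 h
  have hx₁ := (mk_mem_line ht0).2 ht
  have hr₁ : pointRk (Projectivization.mk F t ht0) = 1 := by rw [pointRk_mk, hr]
  generalize Projectivization.mk F t ht0 = x₁ at hx₁ hr₁
  by_cases h2 : rankDist A 2 = 0
  · exact Or.inr (Or.inr (Or.inr (Or.inr ⟨hA, h, h2⟩)))
  rw [rankDist_eq_zero_iff] at h2
  push Not at h2
  obtain ⟨s, hs, hs0, hrs⟩ := h2
  have hx₂ := (mk_mem_line hs0).2 hs
  have hr₂ : pointRk (Projectivization.mk F s hs0) = 2 := by rw [pointRk_mk, hrs]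
  generalize Projectivization.mk F s hs0 = x₂ at hx₂ hr₂
  obtain ⟨U, W, hQ⟩ := exists_isQ hr₂
  by_cases h1 : x₁ ∈ segre U W
  · exact Or.inl ⟨hA, h, x₁, hx₁, x₂, hx₂, hr₁, hr₂, U, W, hQ, h1⟩
  by_cases h3 : CommonS23 x₁ U W
  · exact Or.inr (Or.inl ⟨hA, h, x₁, hx₁, x₂, hx₂, hr₁, hr₂, U, W, hQ, h1, h3⟩)
  by_cases h4 : CommonS32 x₁ U W
  · exact Or.inr (Or.inr (Or.inl ⟨hA, h, x₁, hx₁, x₂, hx₂, hr₁, hr₂, U, W, hQ, h1, h4⟩))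
  · exact Or.inr (Or.inr (Or.inr (Or.inl ⟨hA, h, x₁, hx₁, x₂, hx₂, hr₁, hr₂, U, W, hQ, h3, h4⟩)))

/-- Distinct planes of `F³` meet in a line. -/
theorem exists_inter {P₁ P₂ : Submodule F (Fin 3 → F)} (h₁ : Module.finrank F P₁ = 2)
    (h₂ : Module.finrank F P₂ = 2) (hne : P₁ ≠ P₂) :
    ∃ e ≠ 0, e ∈ P₁ ∧ e ∈ P₂ ∧ ∀ p ∈ P₁, p ∈ P₂ → ∃ c : F, p = c • e := by
  have h := Submodule.finrank_sup_add_finrank_inf_eq P₁ P₂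
  have h3 := Submodule.finrank_le (P₁ ⊔ P₂)
  rw [Module.finrank_fin_fun] at h3
  obtain ⟨e, he, he0⟩ := exists_ne_zero_of_finrank_pos (U := P₁ ⊓ P₂) (by omega)
  refine ⟨e, he0, he.1, he.2, fun p hp₁ hp₂ => ?_⟩
  by_contra! hc
  have hli : LinearIndependent F ![e, p] :=
    (LinearIndependent.pair_iff' he0).2 fun a ha => hc a ha.symm
  exact hne ((eq_span_pair_of_finrank_eq_two h₁ he.1 hp₁ hli).trans
    (eq_span_pair_of_finrank_eq_two h₂ he.2 hp₂ hli).symm)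

theorem exists_segre_inter_eq_singleton {U₁ U₂ W₁ W₂ : Submodule F (Fin 3 → F)}
    (hU₁ : Module.finrank F U₁ = 2) (hU₂ : Module.finrank F U₂ = 2) (hU : U₁ ≠ U₂)
    (hW₁ : Module.finrank F W₁ = 2) (hW₂ : Module.finrank F W₂ = 2) (hW : W₁ ≠ W₂) :
    ∃ z, segre U₁ W₁ ∩ segre U₂ W₂ = {z} := by
  obtain ⟨e, he0, he₁, he₂, he⟩ := exists_inter hU₁ hU₂ hU
  obtain ⟨f, hf0, hf₁, hf₂, hf⟩ := exists_inter hW₁ hW₂ hW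
  refine ⟨Projectivization.mk F _ (tmul_ne_zero he0 hf0), Set.eq_singleton_iff_unique_mem.2
    ⟨⟨mk_mem_segre he0 hf0 he₁ hf₁, mk_mem_segre he0 hf0 he₂ hf₂⟩, ?_⟩⟩
  rintro x ⟨hx₁, hx₂⟩
  rw [← x.mk_rep] at hx₁
  obtain ⟨p, hp, q, hq, -, -, ex⟩ := exists_of_mem_segre x.rep_nonzero hx₁
  obtain ⟨hp', hq'⟩ := (mem_segre_iff ex).1 hx₂
  obtain ⟨c, rfl⟩ := he p hp hp'
  obtain ⟨d, rfl⟩ := hf q hq hq'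
  rw [← x.mk_rep, Projectivization.mk_eq_mk_iff']
  exact ⟨c * d, by rw [ex, TensorProduct.smul_tmul_smul]⟩

/-- Outside the spans of all `S₂,₃` and `S₃,₂`, the planes belonging to two points of rank two are
distinct on either side, so that the two quadrics meet in a single point. -/
theorem exists_type_of_two_rank_two {A : V F} (hA : A ∈ Omega F) (h0 : rankDist A 1 = 0)
    (h23 : ¬ InS23 A) (h32 : ¬ InS32 A) {s t : M F} (hs : s ∈ contractionSpace A)
    (ht : t ∈ contractionSpace A) (hrs : rk s = 2) (hrt : rk t = 2)
    (hst : LinearIndependent F ![s, t]) : A ∈ o12 F ∨ A ∈ o13 F ∨ A ∈ o14 F := by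
  have hs0 : s ≠ 0 := hst.ne_zero 0
  have ht0 : t ≠ 0 := hst.ne_zero 1
  have hne : Projectivization.mk F s hs0 ≠ Projectivization.mk F t ht0 := by
    intro e
    obtain ⟨c, hc⟩ := (Projectivization.mk_eq_mk_iff' F _ _ _ _).1 e
    have := LinearIndependent.pair_iff.1 hst 1 (-c) (by rw [← hc]; module)
    simp at this
  have hr₁ : pointRk (Projectivization.mk F s hs0) = 2 := by rw [pointRk_mk, hrs]
  have hr₂ : pointRk (Projectivization.mk F t ht0) = 2 := by rw [pointRk_mk, hrt]
  have hx₁ := (mk_mem_line hs0).2 hs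
  have hx₂ := (mk_mem_line ht0).2 ht
  generalize Projectivization.mk F s hs0 = x₁ at hx₁ hr₁ hne
  generalize Projectivization.mk F t ht0 = x₂ at hx₂ hr₂ hne
  obtain ⟨U₁, W₁, hQ₁⟩ := exists_isQ hr₁
  obtain ⟨U₂, W₂, hQ₂⟩ := exists_isQ hr₂
  have hspan := eq_span_pair_of_finrank_eq_two hA.1 (rep_mem_of_mem_line hx₁)
    (rep_mem_of_mem_line hx₂) (linearIndependent_rep hne)
  have hU : U₁ ≠ U₂ := by
    rintro rfl
    refine h23 ⟨U₁, hQ₁.1, ?_⟩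
    rw [hspan]
    exact span_pair_le (segreSpan_mono le_rfl le_top (rep_mem_segreSpan hQ₁))
      (segreSpan_mono le_rfl le_top (rep_mem_segreSpan hQ₂))
  have hW : W₁ ≠ W₂ := by
    rintro rfl
    refine h32 ⟨W₁, hQ₁.2.1, ?_⟩
    rw [hspan]
    exact span_pair_le (segreSpan_mono le_top le_rfl (rep_mem_segreSpan hQ₁))
      (segreSpan_mono le_top le_rfl (rep_mem_segreSpan hQ₂))
  obtain ⟨z, hz⟩ := exists_segre_inter_eq_singleton hQ₁.1 hQ₂.1 hU hQ₁.2.1 hQ₂.2.1 hW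
  have key : ∀ C : ℙ F (M F) → ℙ F (M F) → ℙ F (M F) → Prop, C z x₁ x₂ → A ∈ twoSingularPoints C :=
    fun C hC => ⟨hA, h0, h23, h32, x₁, hx₁, x₂, hx₂, hne, hr₁, hr₂, U₁, W₁, U₂, W₂, z, hQ₁, hQ₂, hz,
      hC⟩
  by_cases h1 : OnSecantThrough z x₁ <;> by_cases h2 : OnSecantThrough z x₂
  · exact Or.inr (Or.inr (key _ ⟨h1, h2⟩))
  · exact Or.inr (Or.inl (key _ (Or.inl ⟨h1, h2⟩)))
  · exact Or.inr (Or.inl (key _ (Or.inr ⟨h2, h1⟩)))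
  · exact Or.inl (key _ ⟨h1, h2⟩)

theorem disjoint_segre_of_rankDist {A : V F} (h0 : rankDist A 1 = 0)
    (U W : Submodule F (Fin 3 → F)) : Disjoint (line A) (segre U W) := by
  rw [Set.disjoint_left]
  rintro x hx hxs
  rw [← x.mk_rep] at hxs
  obtain ⟨p, -, q, -, hp, hq, ex⟩ := exists_of_mem_segre x.rep_nonzero hxs
  exact rankDist_eq_zero_iff.1 h0 _ (rep_mem_of_mem_line hx) x.rep_nonzero
    (by rw [ex, rk_tmul hp hq])

theorem exists_type_of_no_rank_one {A : V F} (hA : A ∈ Omega F) (h0 : rankDist A 1 = 0) :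
    A ∈ o10 F ∨ A ∈ o11 F ∨ A ∈ o11T F ∨ A ∈ o12 F ∨ A ∈ o13 F ∨ A ∈ o14 F ∨ A ∈ o15 F ∨
      A ∈ o16 F := by
  by_cases h22 : InS22 A
  · obtain ⟨U, W, hU, hW, hle⟩ := h22
    exact Or.inl ⟨hA, U, W, hU, hW, hle, disjoint_segre_of_rankDist h0 U W⟩
  by_cases h23 : InS23 A
  · exact Or.inr (Or.inl ⟨hA, disjoint_segre_of_rankDist h0 _ _, h23, h22⟩)
  by_cases h32 : InS32 A
  · exact Or.inr (Or.inr (Or.inl ⟨hA, disjoint_segre_of_rankDist h0 _ _, h32, h22⟩))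
  obtain ⟨s, hs, hs0, hrs⟩ := id hA.2
  have hrs2 : rk s = 2 := by
    have h1 := rankDist_eq_zero_iff.1 h0 s hs hs0
    have h2 : rk s ≠ 0 := fun h => hs0 (rk_eq_zero.1 h)
    omega
  by_cases h : ∃ t ∈ contractionSpace A, rk t = 2 ∧ LinearIndependent F ![s, t]
  · obtain ⟨t, ht, hrt, hst⟩ := h
    rcases exists_type_of_two_rank_two hA h0 h23 h32 hs ht hrs2 hrt hst with h | h | h <;> tauto
  push Not at h
  have h2 : rankDist A 2 = 1 := by
    refine rankDist_eq_one_iff.2 ⟨s, hs, hs0, hrs2, fun t ht ht0 hrt => ?_⟩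
    have := h t ht hrt
    rw [LinearIndependent.pair_iff' hs0] at this
    push Not at this
    obtain ⟨c, rfl⟩ := this
    exact ⟨c, by rintro rfl; simp at ht0, rfl⟩
  obtain ⟨y, hy, hsy⟩ := exists_pair_of_finrank_eq_two hA.1 hs0
  have hry := rk_eq_three_of_unique h0 h2 hs hy hrs2 hsy 0 one_ne_zero
  rw [zero_smul, zero_add, one_smul] at hry
  have hy0 : y ≠ 0 := hsy.ne_zero 1
  have hx₁ := (mk_mem_line hy0).2 hy
  have hr₁ : pointRk (Projectivization.mk F y hy0) = 3 := by rw [pointRk_mk, hry]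
  have hx₂ := (mk_mem_line hs0).2 hs
  have hr₂ : pointRk (Projectivization.mk F s hs0) = 2 := by rw [pointRk_mk, hrs2]
  by_cases hsp : Splits (Projectivization.mk F y hy0) (Projectivization.mk F s hs0)
  · have : A ∈ o15 F := ⟨hA, h0, h2, _, hx₁, _, hx₂, hr₁, hr₂, hsp⟩
    tauto
  · have : A ∈ o16 F := ⟨hA, h0, h2, _, hx₁, _, hx₂, hr₁, hr₂, hsp⟩
    tauto

theorem exists_type {A : V F} (hA : A ∈ Omega F) :
    (A ∈ o4 F ∨ A ∈ o4T F ∨ A ∈ o5 F) ∨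
    (A ∈ o6 F ∨ A ∈ o7 F ∨ A ∈ o7T F ∨ A ∈ o8 F ∨ A ∈ o9 F) ∨
    (A ∈ o10 F ∨ A ∈ o11 F ∨ A ∈ o11T F ∨ A ∈ o12 F ∨ A ∈ o13 F ∨ A ∈ o14 F ∨ A ∈ o15 F ∨
      A ∈ o16 F) := by
  by_cases h0 : rankDist A 1 = 0
  · exact Or.inr (Or.inr (exists_type_of_no_rank_one hA h0))
  by_cases h1 : rankDist A 1 = 1
  · exact Or.inr (Or.inl (exists_type_of_one_rank_one hA h1))
  left
  rw [rankDist_eq_zero_iff] at h0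
  push Not at h0
  obtain ⟨s, hs, hs0, hrs⟩ := h0
  have : ∃ t ∈ contractionSpace A, rk t = 1 ∧ LinearIndependent F ![s, t] := by
    by_contra! hn
    refine h1 (rankDist_eq_one_iff.2 ⟨s, hs, hs0, hrs, fun t ht ht0 hrt => ?_⟩)
    have := hn t ht hrt
    rw [LinearIndependent.pair_iff' hs0] at this
    push Not at this
    obtain ⟨c, rfl⟩ := this
    exact ⟨c, by rintro rfl; simp at ht0, rfl⟩
  obtain ⟨t, ht, hrt, hst⟩ := this
  exact exists_type_of_two_rank_one hA hs ht hrs hrt hst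

/-! ### Invariants of pencils -/

/-- Some nonzero functional on the first factor annihilates the whole pencil. -/
def LeftDegenerate (S : Submodule F (M F)) : Prop :=
  ∃ f : Module.Dual F (Fin 3 → F), f ≠ 0 ∧ ∀ t ∈ S, ∀ f', pair f f' t = 0

/-- Some nonzero functional on the second factor annihilates the whole pencil. -/
def RightDegenerate (S : Submodule F (M F)) : Prop :=
  ∃ f' : Module.Dual F (Fin 3 → F), f' ≠ 0 ∧ ∀ t ∈ S, ∀ f, pair f f' t = 0

/-- The pencil contains a pure tensor. -/
def HasPure (S : Submodule F (M F)) : Prop :=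
  ∃ u w : Fin 3 → F, u ≠ 0 ∧ w ≠ 0 ∧ u ⊗ₜ w ∈ S

/-- The pencil contains pure tensors with independent first factors. -/
def LeftIndependentPure (S : Submodule F (M F)) : Prop :=
  ∃ u u' w w' : Fin 3 → F, LinearIndependent F ![u, u'] ∧ w ≠ 0 ∧ w' ≠ 0 ∧ u ⊗ₜ w ∈ S ∧ u' ⊗ₜ w' ∈ S

/-- The pencil contains pure tensors with independent second factors. -/
def RightIndependentPure (S : Submodule F (M F)) : Prop :=
  ∃ u u' w w' : Fin 3 → F, LinearIndependent F ![w, w'] ∧ u ≠ 0 ∧ u' ≠ 0 ∧ u ⊗ₜ w ∈ S ∧ u' ⊗ₜ w' ∈ S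

/-- The tensor, seen as a matrix, has a nonzero left kernel. -/
def HasKernel (t : M F) : Prop :=
  ∃ f : Module.Dual F (Fin 3 → F), f ≠ 0 ∧ ∀ f', pair f f' t = 0

/-- The pencil has at least two singular points. -/
def TwoSingular (S : Submodule F (M F)) : Prop :=
  ∃ x ∈ S, ∃ y ∈ S, LinearIndependent F ![x, y] ∧ HasKernel x ∧ HasKernel y

/-- The determinant of the pencil has a simple zero: the pencil is nonzero on the product of the left
and right kernels of one of its members. -/
def HasSimpleZero (S : Submodule F (M F)) : Prop :=
  ∃ x ∈ S, x ≠ 0 ∧ ∃ f f' : Module.Dual F (Fin 3 → F), (∀ h, pair f h x = 0) ∧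
    (∀ h, pair h f' x = 0) ∧ ∃ y ∈ S, pair f f' y ≠ 0

/-- The determinant of the pencil has a multiple zero: the pencil vanishes on some left and right
kernel vectors of one of its members. -/
def HasMultipleZero (S : Submodule F (M F)) : Prop :=
  ∃ x ∈ S, x ≠ 0 ∧ ∃ f f' : Module.Dual F (Fin 3 → F), f ≠ 0 ∧ f' ≠ 0 ∧ (∀ h, pair f h x = 0) ∧
    (∀ h, pair h f' x = 0) ∧ ∀ y ∈ S, pair f f' y = 0

open Classical in
/-- The number of the orbit of a pencil, read off from invariants. -/
noncomputable def code (S : Submodule F (M F)) : Fin 16 :=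
  if LeftDegenerate S then
    if RightDegenerate S then
      if HasPure S then
        if LeftIndependentPure S then
          if RightIndependentPure S then 2 else 1
        else if RightIndependentPure S then 0 else 3
      else 8
    else if HasPure S then 4 else 9
  else if RightDegenerate S then
    if HasPure S then 5 else 10
  else if HasPure S then
    if TwoSingular S then 6 else 7
  else if TwoSingular S then
    if HasSimpleZero S then
      if HasMultipleZero S then 12 else 13
    else 11
  else if HasSimpleZero S then 14 else 15

theorem pair_congr (g k : (Fin 3 → F) ≃ₗ[F] (Fin 3 → F)) (f f' : Module.Dual F (Fin 3 → F))
    (t : M F) : pair f f' (TensorProduct.congr g k t) =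
      pair (f ∘ₗ g.toLinearMap) (f' ∘ₗ k.toLinearMap) t := by
  have : pair f f' ∘ₗ (TensorProduct.congr g k).toLinearMap =
      pair (f ∘ₗ g.toLinearMap) (f' ∘ₗ k.toLinearMap) := by
    ext
    simp
  exact LinearMap.congr_fun this t

theorem pair_congr_symm (g k : (Fin 3 → F) ≃ₗ[F] (Fin 3 → F)) (f f' : Module.Dual F (Fin 3 → F))
    (t : M F) : pair (f ∘ₗ g.symm.toLinearMap) (f' ∘ₗ k.symm.toLinearMap)
      (TensorProduct.congr g k t) = pair f f' t := by
  rw [pair_congr]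
  congr 2 <;> ext <;> simp

theorem pair_congr_symm_left (g k : (Fin 3 → F) ≃ₗ[F] (Fin 3 → F))
    (f f' : Module.Dual F (Fin 3 → F)) (t : M F) :
    pair (f ∘ₗ g.symm.toLinearMap) f' (TensorProduct.congr g k t) =
      pair f (f' ∘ₗ k.toLinearMap) t := by
  rw [pair_congr]
  congr 2; ext; simp

theorem pair_congr_symm_right (g k : (Fin 3 → F) ≃ₗ[F] (Fin 3 → F))
    (f f' : Module.Dual F (Fin 3 → F)) (t : M F) :
    pair f (f' ∘ₗ k.symm.toLinearMap) (TensorProduct.congr g k t) =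
      pair (f ∘ₗ g.toLinearMap) f' t := by
  rw [pair_congr]
  congr 2; ext; simp

theorem comp_symm_ne_zero {f : Module.Dual F (Fin 3 → F)} (hf : f ≠ 0)
    (g : (Fin 3 → F) ≃ₗ[F] (Fin 3 → F)) : f ∘ₗ g.symm.toLinearMap ≠ 0 := by
  intro h
  apply hf
  ext i
  have := LinearMap.congr_fun h (g (Pi.single i 1))
  simpa using this

section Transfer

variable {S : Submodule F (M F)} (g k : (Fin 3 → F) ≃ₗ[F] (Fin 3 → F))

theorem LeftDegenerate.map (h : LeftDegenerate S) :
    LeftDegenerate (S.map (TensorProduct.congr g k).toLinearMap) := by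
  obtain ⟨f, hf, h⟩ := h
  refine ⟨_, comp_symm_ne_zero hf g, ?_⟩
  rintro _ ⟨t, ht, rfl⟩ f'
  exact (pair_congr_symm_left g k f f' t).trans (h t ht _)

theorem RightDegenerate.map (h : RightDegenerate S) :
    RightDegenerate (S.map (TensorProduct.congr g k).toLinearMap) := by
  obtain ⟨f, hf, h⟩ := h
  refine ⟨_, comp_symm_ne_zero hf k, ?_⟩
  rintro _ ⟨t, ht, rfl⟩ f'
  exact (pair_congr_symm_right g k f' f t).trans (h t ht _)

theorem tmul_mem_map {u w : Fin 3 → F} (h : u ⊗ₜ w ∈ S) :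
    g u ⊗ₜ k w ∈ S.map (TensorProduct.congr g k).toLinearMap := ⟨_, h, rfl⟩

theorem HasPure.map (h : HasPure S) : HasPure (S.map (TensorProduct.congr g k).toLinearMap) := by
  obtain ⟨u, w, hu, hw, h⟩ := h
  exact ⟨g u, k w, g.map_ne_zero_iff.2 hu, k.map_ne_zero_iff.2 hw, tmul_mem_map g k h⟩

theorem LeftIndependentPure.map (h : LeftIndependentPure S) :
    LeftIndependentPure (S.map (TensorProduct.congr g k).toLinearMap) := by
  obtain ⟨u, u', w, w', hu, hw, hw', h, h'⟩ := h
  exact ⟨g u, g u', k w, k w', linearIndependent_pair_map hu g, k.map_ne_zero_iff.2 hw,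
    k.map_ne_zero_iff.2 hw', tmul_mem_map g k h, tmul_mem_map g k h'⟩

theorem RightIndependentPure.map (h : RightIndependentPure S) :
    RightIndependentPure (S.map (TensorProduct.congr g k).toLinearMap) := by
  obtain ⟨u, u', w, w', hw, hu, hu', h, h'⟩ := h
  exact ⟨g u, g u', k w, k w', linearIndependent_pair_map hw k, g.map_ne_zero_iff.2 hu,
    g.map_ne_zero_iff.2 hu', tmul_mem_map g k h, tmul_mem_map g k h'⟩

theorem HasKernel.map {t : M F} (h : HasKernel t) : HasKernel (TensorProduct.congr g k t) := by
  obtain ⟨f, hf, h⟩ := h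
  exact ⟨_, comp_symm_ne_zero hf g, fun f' => (pair_congr_symm_left g k f f' t).trans (h _)⟩

theorem TwoSingular.map (h : TwoSingular S) :
    TwoSingular (S.map (TensorProduct.congr g k).toLinearMap) := by
  obtain ⟨x, hx, y, hy, hxy, hkx, hky⟩ := h
  exact ⟨_, ⟨x, hx, rfl⟩, _, ⟨y, hy, rfl⟩, linearIndependent_pair_map hxy _, hkx.map g k, hky.map g k⟩

theorem HasSimpleZero.map (h : HasSimpleZero S) :
    HasSimpleZero (S.map (TensorProduct.congr g k).toLinearMap) := by
  obtain ⟨x, hx, hx0, f, f', h1, h2, y, hy, h3⟩ := h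
  refine ⟨_, ⟨x, hx, rfl⟩, (TensorProduct.congr g k).map_ne_zero_iff.2 hx0, f ∘ₗ g.symm.toLinearMap,
    f' ∘ₗ k.symm.toLinearMap, fun h => (pair_congr_symm_left g k f h x).trans (h1 _),
    fun h => (pair_congr_symm_right g k h f' x).trans (h2 _), _, ⟨y, hy, rfl⟩, ?_⟩
  exact fun h => h3 ((pair_congr_symm g k f f' y).symm.trans h)

theorem HasMultipleZero.map (h : HasMultipleZero S) :
    HasMultipleZero (S.map (TensorProduct.congr g k).toLinearMap) := by
  obtain ⟨x, hx, hx0, f, f', hf, hf', h1, h2, h3⟩ := h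
  refine ⟨_, ⟨x, hx, rfl⟩, (TensorProduct.congr g k).map_ne_zero_iff.2 hx0, f ∘ₗ g.symm.toLinearMap,
    f' ∘ₗ k.symm.toLinearMap, comp_symm_ne_zero hf g, comp_symm_ne_zero hf' k,
    fun h => (pair_congr_symm_left g k f h x).trans (h1 _),
    fun h => (pair_congr_symm_right g k h f' x).trans (h2 _), ?_⟩
  rintro _ ⟨y, hy, rfl⟩
  exact (pair_congr_symm g k f f' y).trans (h3 y hy)

/-- A property of pencils that is preserved by every change of bases is invariant. -/
theorem iff_of_forall_map {P : Submodule F (M F) → Prop}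
    (h : ∀ (S : Submodule F (M F)) (g k : (Fin 3 → F) ≃ₗ[F] (Fin 3 → F)), P S →
      P (S.map (TensorProduct.congr g k).toLinearMap)) :
    P (S.map (TensorProduct.congr g k).toLinearMap) ↔ P S := by
  refine ⟨fun hS => ?_, h S g k⟩
  have := h _ g.symm k.symm hS
  rw [← Submodule.map_comp] at this
  convert this
  have e : (TensorProduct.congr g.symm k.symm).toLinearMap ∘ₗ
      (TensorProduct.congr g k).toLinearMap = LinearMap.id := by
    ext
    simp
  rw [e, Submodule.map_id]

theorem code_map : code (S.map (TensorProduct.congr g k).toLinearMap) = code S := by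
  have h1 := iff_of_forall_map (S := S) g k (P := LeftDegenerate) fun _ g k h => h.map g k
  have h2 := iff_of_forall_map (S := S) g k (P := RightDegenerate) fun _ g k h => h.map g k
  have h3 := iff_of_forall_map (S := S) g k (P := HasPure) fun _ g k h => h.map g k
  have h4 := iff_of_forall_map (S := S) g k (P := LeftIndependentPure) fun _ g k h => h.map g k
  have h5 := iff_of_forall_map (S := S) g k (P := RightIndependentPure) fun _ g k h => h.map g k
  have h6 := iff_of_forall_map (S := S) g k (P := TwoSingular) fun _ g k h => h.map g k
  have h7 := iff_of_forall_map (S := S) g k (P := HasSimpleZero) fun _ g k h => h.map g k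
  have h8 := iff_of_forall_map (S := S) g k (P := HasMultipleZero) fun _ g k h => h.map g k
  classical
  unfold code
  exact if_congr h1 (if_congr h2 (if_congr h3 (if_congr h4 (if_congr h5 rfl rfl)
    (if_congr h5 rfl rfl)) rfl) (if_congr h3 rfl rfl)) (if_congr h2 (if_congr h3 rfl rfl)
    (if_congr h3 (if_congr h6 rfl rfl) (if_congr h6 (if_congr h7 (if_congr h8 rfl rfl) rfl)
    (if_congr h7 rfl rfl))))

end Transfer

theorem code_eq_of_mem_orbit {A B : V F} (h : A ∈ MulAction.orbit (H F) B) :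
    code (contractionSpace A) = code (contractionSpace B) := by
  obtain ⟨⟨_, ⟨g, g₂, g₃⟩, rfl⟩, rfl⟩ := h
  exact (congrArg code (contractionSpace_smul g g₂ g₃ B)).trans (code_map g₂ g₃)

/-! ### Canonical pencils -/

theorem dual_eq_zero {f : Module.Dual F (Fin 3 → F)} (h0 : f (Pi.single 0 1) = 0)
    (h1 : f (Pi.single 1 1) = 0) (h2 : f (Pi.single 2 1) = 0) : f = 0 := by
  ext i
  fin_cases i <;> simpa

/-- The first generator of the canonical pencil of each type. -/
noncomputable def canonLeft (γ : F) : Fin 16 → M F :=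
  ![E 0 0, E 0 0, E 0 0, E 0 0, E 0 2, E 2 0, E 0 0, E 0 0, E 0 0 + γ • E 1 1, E 0 0 + E 1 1,
    E 0 0 + E 1 1, E 0 1 + E 1 0, E 0 0 + E 1 1, E 0 0 + E 1 1, E 0 0 + γ • E 1 1, E 0 1 + E 1 0]

/-- The second generator of the canonical pencil of each type. -/
noncomputable def canonRight (δ : F) : Fin 16 → M F :=
  ![E 0 1, E 1 0, E 1 1, E 0 1 + E 1 0, E 0 0 + E 1 1, E 0 0 + E 1 1, E 1 1 + E 2 2,
    E 0 1 + E 1 0 + E 2 2, E 0 1 + E 1 0 + δ • E 1 1, E 0 1 + E 1 2, E 1 0 + E 2 1, E 0 2 + E 2 0,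
    E 0 2 + E 2 0, E 0 0 + E 2 2, E 2 2 + (E 0 1 + E 1 0 + δ • E 1 1), E 0 2 + E 1 1 + E 2 0]

section Criteria

variable {X Y : M F}

theorem leftDegenerate_span {f : Module.Dual F (Fin 3 → F)} (hf : f ≠ 0)
    (hX : ∀ f', pair f f' X = 0) (hY : ∀ f', pair f f' Y = 0) :
    LeftDegenerate (Submodule.span F {X, Y}) := by
  refine ⟨f, hf, fun t ht f' => ?_⟩
  obtain ⟨a, b, rfl⟩ := Submodule.mem_span_pair.1 ht
  simp [hX, hY]

theorem rightDegenerate_span {f' : Module.Dual F (Fin 3 → F)} (hf : f' ≠ 0)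
    (hX : ∀ f, pair f f' X = 0) (hY : ∀ f, pair f f' Y = 0) :
    RightDegenerate (Submodule.span F {X, Y}) := by
  refine ⟨f', hf, fun t ht f => ?_⟩
  obtain ⟨a, b, rfl⟩ := Submodule.mem_span_pair.1 ht
  simp [hX, hY]

/-- A functional annihilating the pencil vanishes on the basis vectors, hence is zero; only its values
against the coordinate functionals have to be tested. -/
theorem not_leftDegenerate_span (h : ∀ f : Module.Dual F (Fin 3 → F),
    (∀ j, pair f (LinearMap.proj j) X = 0) → (∀ j, pair f (LinearMap.proj j) Y = 0) →
      f (Pi.single 0 1) = 0 ∧ f (Pi.single 1 1) = 0 ∧ f (Pi.single 2 1) = 0) :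
    ¬ LeftDegenerate (Submodule.span F {X, Y}) := by
  rintro ⟨f, hf, h'⟩
  obtain ⟨h0, h1, h2⟩ := h f (fun j => h' X (Submodule.subset_span (by simp)) _)
    fun j => h' Y (Submodule.subset_span (by simp)) _
  exact hf (dual_eq_zero h0 h1 h2)

theorem not_rightDegenerate_span (h : ∀ f : Module.Dual F (Fin 3 → F),
    (∀ j, pair (LinearMap.proj j) f X = 0) → (∀ j, pair (LinearMap.proj j) f Y = 0) →
      f (Pi.single 0 1) = 0 ∧ f (Pi.single 1 1) = 0 ∧ f (Pi.single 2 1) = 0) :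
    ¬ RightDegenerate (Submodule.span F {X, Y}) := by
  rintro ⟨f, hf, h'⟩
  obtain ⟨h0, h1, h2⟩ := h f (fun j => h' X (Submodule.subset_span (by simp)) _)
    fun j => h' Y (Submodule.subset_span (by simp)) _
  exact hf (dual_eq_zero h0 h1 h2)

/-- The entry of a tensor in row `i` and column `j`. -/
noncomputable abbrev ent (i j : Fin 3) (t : M F) : F := pair (LinearMap.proj i) (LinearMap.proj j) t

/-- The `2 × 2` minors of a pure tensor vanish, so a pencil whose members have no common zero of all
minors contains no pure tensor. -/
theorem not_hasPure_span (h : ∀ a b : F, (∀ i j k l, ent i j (a • X + b • Y) *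
    ent k l (a • X + b • Y) = ent i l (a • X + b • Y) * ent k j (a • X + b • Y)) → a = 0 ∧ b = 0) :
    ¬ HasPure (Submodule.span F {X, Y}) := by
  rintro ⟨u, w, hu, hw, hm⟩
  obtain ⟨a, b, e⟩ := Submodule.mem_span_pair.1 hm
  obtain ⟨rfl, rfl⟩ := h a b fun i j k l => by
    rw [e]
    simp only [ent, pair_tmul, LinearMap.proj_apply]
    ring
  exact tmul_ne_zero hu hw (by rw [← e]; simp)

/-- The first generator is the only singular point if every singular member has no `Y`-component. -/
theorem not_twoSingular_span (h : ∀ (a b : F) (f : Module.Dual F (Fin 3 → F)),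
    (∀ j, pair f (LinearMap.proj j) (a • X + b • Y) = 0) → b ≠ 0 →
      f (Pi.single 0 1) = 0 ∧ f (Pi.single 1 1) = 0 ∧ f (Pi.single 2 1) = 0) :
    ¬ TwoSingular (Submodule.span F {X, Y}) := by
  have key : ∀ t ∈ Submodule.span F {X, Y}, HasKernel t → ∃ a : F, t = a • X := by
    rintro t ht ⟨f, hf, hk⟩
    obtain ⟨a, b, rfl⟩ := Submodule.mem_span_pair.1 ht
    refine ⟨a, ?_⟩
    by_cases hb : b = 0
    · rw [hb]; module
    · obtain ⟨h0, h1, h2⟩ := h a b f (fun j => hk _) hb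
      exact absurd (dual_eq_zero h0 h1 h2) hf
  rintro ⟨x, hx, y, hy, hxy, hkx, hky⟩
  obtain ⟨a, rfl⟩ := key x hx hkx
  obtain ⟨b, rfl⟩ := key y hy hky
  have := LinearIndependent.pair_iff.1 hxy b (-a) (by module)
  have hb0 : b • X ≠ 0 := hxy.ne_zero 1
  exact hb0 (by rw [this.1, zero_smul])

theorem linearIndependent_single {i j : Fin 3} (h : i ≠ j) :
    LinearIndependent F ![(Pi.single i 1 : Fin 3 → F), Pi.single j 1] := by
  rw [LinearIndependent.pair_iff]
  intro s t e
  have hi := congrFun e i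
  have hj := congrFun e j
  simp [h] at hi
  simp [h.symm] at hj
  exact ⟨hi, hj⟩

theorem proj_ne_zero (i : Fin 3) : (LinearMap.proj i : Module.Dual F (Fin 3 → F)) ≠ 0 := by
  intro h
  have := LinearMap.congr_fun h (Pi.single i 1)
  simp at this

theorem hasPure_span_left {i j : Fin 3} : HasPure (Submodule.span F {E i j, Y}) :=
  ⟨Pi.single i 1, Pi.single j 1, by simp, by simp, Submodule.subset_span (Set.mem_insert _ _)⟩

end Criteria

theorem eq_smul_single {u : Fin 3 → F} (h1 : u 1 = 0) (h2 : u 2 = 0) :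
    u = u 0 • (Pi.single 0 1 : Fin 3 → F) := by
  ext i
  fin_cases i <;> simp [h1, h2]

theorem not_linearIndependent_of_eq_smul {E : Type*} [AddCommGroup E] [Module F E] {x y e : E}
    {a b : F} (hx : x = a • e) (hy : y = b • e) : ¬ LinearIndependent F ![x, y] := by
  intro h
  have := LinearIndependent.pair_iff.1 h b (-a) (by rw [hx, hy]; module)
  have hy0 : y ≠ 0 := h.ne_zero 1
  exact hy0 (by rw [hy, this.1, zero_smul])

/-- Tested on entries: every pure member of the pencil has a multiple of `e₀` as its first factor. -/
theorem not_leftIndependentPure_span {X Y : M F} (h : ∀ (u w : Fin 3 → F) (a b : F), w ≠ 0 →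
    (∀ i j, ent i j (a • X + b • Y) = u i * w j) → u 1 = 0 ∧ u 2 = 0) :
    ¬ LeftIndependentPure (Submodule.span F {X, Y}) := by
  have key : ∀ u w : Fin 3 → F, w ≠ 0 → u ⊗ₜ w ∈ Submodule.span F {X, Y} →
      u = u 0 • (Pi.single 0 1 : Fin 3 → F) := by
    intro u w hw hm
    obtain ⟨a, b, e⟩ := Submodule.mem_span_pair.1 hm
    obtain ⟨h1, h2⟩ := h u w a b hw fun i j => by rw [e]; simp [ent]
    exact eq_smul_single h1 h2
  rintro ⟨u, u', w, w', hu, hw, hw', hm, hm'⟩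
  exact not_linearIndependent_of_eq_smul (key u w hw hm) (key u' w' hw' hm') hu

/-- Tested on entries: every pure member of the pencil has a multiple of `e₀` as its second factor. -/
theorem not_rightIndependentPure_span {X Y : M F} (h : ∀ (u w : Fin 3 → F) (a b : F), u ≠ 0 →
    (∀ i j, ent i j (a • X + b • Y) = u i * w j) → w 1 = 0 ∧ w 2 = 0) :
    ¬ RightIndependentPure (Submodule.span F {X, Y}) := by
  have key : ∀ u w : Fin 3 → F, u ≠ 0 → u ⊗ₜ w ∈ Submodule.span F {X, Y} →
      w = w 0 • (Pi.single 0 1 : Fin 3 → F) := by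
    intro u w hu hm
    obtain ⟨a, b, e⟩ := Submodule.mem_span_pair.1 hm
    obtain ⟨h1, h2⟩ := h u w a b hu fun i j => by rw [e]; simp [ent]
    exact eq_smul_single h1 h2
  rintro ⟨u, u', w, w', hw, hu, hu', hm, hm'⟩
  exact not_linearIndependent_of_eq_smul (key u w hu hm) (key u' w' hu' hm') hw

theorem twoSingular_span {X Y : M F} (h : LinearIndependent F ![X, Y]) (hX : HasKernel X)
    (hY : HasKernel Y) : TwoSingular (Submodule.span F {X, Y}) :=
  ⟨_, Submodule.subset_span (Set.mem_insert _ _), _,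
    Submodule.subset_span (Set.mem_insert_of_mem _ rfl), h, hX, hY⟩

theorem hasSimpleZero_span_left {X Y : M F} (i : Fin 3) (h : ∀ h, pair (LinearMap.proj i) h X = 0)
    (h' : ∀ h, pair h (LinearMap.proj i) X = 0) (hX : X ≠ 0) (hY : ent i i Y ≠ 0) :
    HasSimpleZero (Submodule.span F {X, Y}) :=
  ⟨X, Submodule.subset_span (Set.mem_insert _ _), hX, _, _, h, h', Y,
    Submodule.subset_span (Set.mem_insert_of_mem _ rfl), hY⟩

theorem not_hasSimpleZero_span {X Y : M F} (h : ∀ (a b : F) (f f' : Module.Dual F (Fin 3 → F)),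
    (a ≠ 0 ∨ b ≠ 0) → (∀ j, pair f (LinearMap.proj j) (a • X + b • Y) = 0) →
    (∀ j, pair (LinearMap.proj j) f' (a • X + b • Y) = 0) → pair f f' X = 0 ∧ pair f f' Y = 0) :
    ¬ HasSimpleZero (Submodule.span F {X, Y}) := by
  rintro ⟨x, hx, hx0, f, f', hf, hf', y, hy, hn⟩
  obtain ⟨a, b, rfl⟩ := Submodule.mem_span_pair.1 hx
  obtain ⟨c, d, rfl⟩ := Submodule.mem_span_pair.1 hy
  obtain ⟨h1, h2⟩ := h a b f f' (by
    by_contra! hab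
    exact hx0 (by simp [hab.1, hab.2])) (fun _ => hf _) fun _ => hf' _
  exact hn (by simp [h1, h2])

theorem tensor_ne_zero_of_ent {X : M F} (i j : Fin 3) (h : ent i j X ≠ 0) : X ≠ 0 := by
  rintro rfl
  simp [ent] at h

theorem code_o4 : code (Submodule.span F {(E 0 0 : M F), E 0 1}) = 0 := by
  have key : ∀ S : Submodule F (M F), LeftDegenerate S → RightDegenerate S → HasPure S →
      ¬ LeftIndependentPure S → RightIndependentPure S → code S = 0 := by
    intros; simp [code, *]
  refine key _ (leftDegenerate_span (proj_ne_zero 2) (by simp) (by simp))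
    (rightDegenerate_span (proj_ne_zero 2) (by simp) (by simp)) hasPure_span_left
    (not_leftIndependentPure_span fun u w a b hw h => ?_)
    ⟨Pi.single 0 1, Pi.single 0 1, Pi.single 0 1, Pi.single 1 1, linearIndependent_single (by decide),
      by simp, by simp, Submodule.subset_span (Set.mem_insert _ _),
      Submodule.subset_span (Set.mem_insert_of_mem _ rfl)⟩
  obtain ⟨j, hj⟩ := Function.ne_iff.1 hw
  have h1 := h 1 j
  have h2 := h 2 j
  simp [ent] at h1 h2 hj
  exact ⟨h1.resolve_right hj, h2.resolve_right hj⟩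

theorem code_o4T : code (Submodule.span F {(E 0 0 : M F), E 1 0}) = 1 := by
  have key : ∀ S : Submodule F (M F), LeftDegenerate S → RightDegenerate S → HasPure S →
      LeftIndependentPure S → ¬ RightIndependentPure S → code S = 1 := by
    intros; simp [code, *]
  refine key _ (leftDegenerate_span (proj_ne_zero 2) (by simp) (by simp))
    (rightDegenerate_span (proj_ne_zero 2) (by simp) (by simp)) hasPure_span_left
    ⟨Pi.single 0 1, Pi.single 1 1, Pi.single 0 1, Pi.single 0 1, linearIndependent_single (by decide),
      by simp, by simp, Submodule.subset_span (Set.mem_insert _ _),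
      Submodule.subset_span (Set.mem_insert_of_mem _ rfl)⟩
    (not_rightIndependentPure_span fun u w a b hu h => ?_)
  obtain ⟨j, hj⟩ := Function.ne_iff.1 hu
  have h1 := h j 1
  have h2 := h j 2
  simp [ent] at h1 h2 hj
  exact ⟨h1.resolve_left hj, h2.resolve_left hj⟩

theorem code_o5 : code (Submodule.span F {(E 0 0 : M F), E 1 1}) = 2 := by
  have key : ∀ S : Submodule F (M F), LeftDegenerate S → RightDegenerate S → HasPure S →
      LeftIndependentPure S → RightIndependentPure S → code S = 2 := by
    intros; simp [code, *]
  have hm : ∀ i : Fin 3, i = 0 ∨ i = 1 → (Pi.single i 1 : Fin 3 → F) ⊗ₜ (Pi.single i 1 : Fin 3 → F) ∈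
      Submodule.span F {(E 0 0 : M F), E 1 1} := by
    rintro i (rfl | rfl)
    · exact Submodule.subset_span (Set.mem_insert _ _)
    · exact Submodule.subset_span (Set.mem_insert_of_mem _ rfl)
  exact key _ (leftDegenerate_span (proj_ne_zero 2) (by simp) (by simp))
    (rightDegenerate_span (proj_ne_zero 2) (by simp) (by simp)) hasPure_span_left
    ⟨Pi.single 0 1, Pi.single 1 1, Pi.single 0 1, Pi.single 1 1, linearIndependent_single (by decide),
      by simp, by simp, hm 0 (by simp), hm 1 (by simp)⟩
    ⟨Pi.single 0 1, Pi.single 1 1, Pi.single 0 1, Pi.single 1 1, linearIndependent_single (by decide),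
      by simp, by simp, hm 0 (by simp), hm 1 (by simp)⟩

theorem code_o6 : code (Submodule.span F {(E 0 0 : M F), E 0 1 + E 1 0}) = 3 := by
  have key : ∀ S : Submodule F (M F), LeftDegenerate S → RightDegenerate S → HasPure S →
      ¬ LeftIndependentPure S → ¬ RightIndependentPure S → code S = 3 := by
    intros; simp [code, *]
  refine key _ (leftDegenerate_span (proj_ne_zero 2) (by simp) (by simp))
    (rightDegenerate_span (proj_ne_zero 2) (by simp) (by simp)) hasPure_span_left
    (not_leftIndependentPure_span fun u w a b hw h => ?_)
    (not_rightIndependentPure_span fun u w a b hu h => ?_)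
  · obtain ⟨j, hj⟩ := Function.ne_iff.1 hw
    have h01 := h 0 1
    have h10 := h 1 0
    have h11 := h 1 1
    have h2 := h 2 j
    have h12 := h 1 2
    simp [ent] at h01 h10 h11 h2 h12 hj
    refine ⟨?_, h2.resolve_right hj⟩
    by_contra hu
    have hb := h11.resolve_left hu
    rw [hb, mul_zero] at h01
    rw [h01] at h10
    have hw0 := (mul_eq_zero.1 h10.symm).resolve_left hu
    fin_cases j
    · exact hj hw0
    · exact hj hb
    · exact hj (h12.resolve_left hu)
  · obtain ⟨j, hj⟩ := Function.ne_iff.1 hu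
    have h01 := h 0 1
    have h10 := h 1 0
    have h11 := h 1 1
    have h2 := h j 2
    have h21 := h 2 1
    simp [ent] at h01 h10 h11 h2 h21 hj
    refine ⟨?_, h2.resolve_left hj⟩
    by_contra hw
    have hb := h11.resolve_right hw
    rw [hb, zero_mul] at h10
    rw [h10] at h01
    have hu0 := (mul_eq_zero.1 h01.symm).resolve_right hw
    fin_cases j
    · exact hj hu0
    · exact hj hb
    · exact hj (h21.resolve_right hw)

theorem code_o7 : code (Submodule.span F {(E 0 2 : M F), E 0 0 + E 1 1}) = 4 := by
  have key : ∀ S : Submodule F (M F), LeftDegenerate S → ¬ RightDegenerate S → HasPure S →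
      code S = 4 := by
    intros; simp [code, *]
  refine key _ (leftDegenerate_span (proj_ne_zero 2) (by simp) (by simp))
    (not_rightDegenerate_span fun f hX hY => ?_) hasPure_span_left
  have h0 := hX 0
  have h1 := hY 0
  have h2 := hY 1
  simp at h0 h1 h2
  exact ⟨h1, h2, h0⟩

theorem code_o7T : code (Submodule.span F {(E 2 0 : M F), E 0 0 + E 1 1}) = 5 := by
  have key : ∀ S : Submodule F (M F), ¬ LeftDegenerate S → RightDegenerate S → HasPure S →
      code S = 5 := by
    intros; simp [code, *]
  refine key _ (not_leftDegenerate_span fun f hX hY => ?_)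
    (rightDegenerate_span (proj_ne_zero 2) (by simp) (by simp)) hasPure_span_left
  have h0 := hX 0
  have h1 := hY 0
  have h2 := hY 1
  simp at h0 h1 h2
  exact ⟨h1, h2, h0⟩

theorem code_o8 : code (Submodule.span F {(E 0 0 : M F), E 1 1 + E 2 2}) = 6 := by
  have key : ∀ S : Submodule F (M F), ¬ LeftDegenerate S → ¬ RightDegenerate S → HasPure S →
      TwoSingular S → code S = 6 := by
    intros; simp [code, *]
  refine key _ (not_leftDegenerate_span fun f hX hY => ?_)
    (not_rightDegenerate_span fun f hX hY => ?_) hasPure_span_left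
    (twoSingular_span (linearIndependent_of_minor 0 0 1 1 (by simp))
      ⟨LinearMap.proj 1, proj_ne_zero 1, by simp⟩ ⟨LinearMap.proj 0, proj_ne_zero 0, by simp⟩)
  all_goals
    have h0 := hX 0
    have h1 := hY 1
    have h2 := hY 2
    simp at h0 h1 h2
    exact ⟨h0, h1, h2⟩

theorem code_o9 : code (Submodule.span F {(E 0 0 : M F), E 0 1 + E 1 0 + E 2 2}) = 7 := by
  have key : ∀ S : Submodule F (M F), ¬ LeftDegenerate S → ¬ RightDegenerate S → HasPure S →
      ¬ TwoSingular S → code S = 7 := by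
    intros; simp [code, *]
  refine key _ (not_leftDegenerate_span fun f hX hY => ?_)
    (not_rightDegenerate_span fun f hX hY => ?_) hasPure_span_left
    (not_twoSingular_span fun a b f h hb => ?_)
  · have h0 := hX 0
    have h1 := hY 0
    have h2 := hY 2
    simp at h0 h1 h2
    exact ⟨h0, h1, h2⟩
  · have h0 := hX 0
    have h1 := hY 0
    have h2 := hY 2
    simp at h0 h1 h2
    exact ⟨h0, h1, h2⟩
  · have h0 := h 0
    have h1 := h 1
    have h2 := h 2
    simp [hb] at h0 h1 h2
    simp [h1, hb] at h0
    exact ⟨h1, h0, h2⟩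

/-- The upper left `2 × 2` minor of a member of the canonical pencils with numbers `8` and `14` is, up
to sign, the anisotropic form. -/
theorem Anisotropic.eq_zero {γ δ : F} (h : Anisotropic γ δ) {a b : F}
    (e : b ^ 2 - δ * a * b - γ * a ^ 2 = 0) : a = 0 ∧ b = 0 := by
  obtain ⟨h1, h2⟩ := h b (-a) (by linear_combination e)
  exact ⟨neg_eq_zero.1 h2, h1⟩

theorem code_o10 {γ δ : F} (hγ : Anisotropic γ δ) :
    code (Submodule.span F {(E 0 0 + γ • E 1 1 : M F), E 0 1 + E 1 0 + δ • E 1 1}) = 8 := by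
  have key : ∀ S : Submodule F (M F), LeftDegenerate S → RightDegenerate S → ¬ HasPure S →
      code S = 8 := by
    intros; simp [code, *]
  refine key _ (leftDegenerate_span (proj_ne_zero 2) (by simp) (by simp))
    (rightDegenerate_span (proj_ne_zero 2) (by simp) (by simp)) (not_hasPure_span fun a b h => ?_)
  have h0 := h 0 0 1 1
  simp [ent] at h0
  exact hγ.eq_zero (by linear_combination -h0)

theorem code_o11 : code (Submodule.span F {(E 0 0 + E 1 1 : M F), E 0 1 + E 1 2}) = 9 := by
  have key : ∀ S : Submodule F (M F), LeftDegenerate S → ¬ RightDegenerate S → ¬ HasPure S →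
      code S = 9 := by
    intros; simp [code, *]
  refine key _ (leftDegenerate_span (proj_ne_zero 2) (by simp) (by simp))
    (not_rightDegenerate_span fun f hX hY => ?_) (not_hasPure_span fun a b h => ?_)
  · have h0 := hX 0
    have h1 := hX 1
    have h2 := hY 1
    simp at h0 h1 h2
    exact ⟨h0, h1, h2⟩
  · have h0 := h 0 0 1 1
    have h1 := h 0 1 1 2
    simp [ent] at h0 h1
    exact ⟨h0, h1⟩

theorem code_o11T : code (Submodule.span F {(E 0 0 + E 1 1 : M F), E 1 0 + E 2 1}) = 10 := by
  have key : ∀ S : Submodule F (M F), ¬ LeftDegenerate S → RightDegenerate S → ¬ HasPure S →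
      code S = 10 := by
    intros; simp [code, *]
  refine key _ (not_leftDegenerate_span fun f hX hY => ?_)
    (rightDegenerate_span (proj_ne_zero 2) (by simp) (by simp)) (not_hasPure_span fun a b h => ?_)
  · have h0 := hX 0
    have h1 := hX 1
    have h2 := hY 1
    simp at h0 h1 h2
    exact ⟨h0, h1, h2⟩
  · have h0 := h 0 0 1 1
    have h1 := h 1 0 2 1
    simp [ent] at h0 h1
    exact ⟨h0, h1⟩

theorem code_o12 : code (Submodule.span F {(E 0 1 + E 1 0 : M F), E 0 2 + E 2 0}) = 11 := by
  have key : ∀ S : Submodule F (M F), ¬ LeftDegenerate S → ¬ RightDegenerate S → ¬ HasPure S →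
      TwoSingular S → ¬ HasSimpleZero S → code S = 11 := by
    intros; simp [code, *]
  refine key _ (not_leftDegenerate_span fun f hX hY => ?_)
    (not_rightDegenerate_span fun f hX hY => ?_) (not_hasPure_span fun a b h => ?_)
    (twoSingular_span (linearIndependent_of_minor 0 1 0 2 (by simp))
      ⟨LinearMap.proj 2, proj_ne_zero 2, by simp⟩ ⟨LinearMap.proj 1, proj_ne_zero 1, by simp⟩)
    (not_hasSimpleZero_span fun a b f f' hab hf hf' => ?_)
  · have h0 := hX 0
    have h1 := hX 1
    have h2 := hY 0
    simp at h0 h1 h2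
    exact ⟨h1, h0, h2⟩
  · have h0 := hX 0
    have h1 := hX 1
    have h2 := hY 0
    simp at h0 h1 h2
    exact ⟨h1, h0, h2⟩
  · have h0 := h 0 1 1 0
    have h1 := h 0 2 2 0
    simp [ent] at h0 h1
    exact ⟨h0, h1⟩
  · have f1 := hf 1
    have f2 := hf 2
    have g1 := hf' 1
    have g2 := hf' 2
    simp at f1 f2 g1 g2
    rcases hab with ha | hb <;> simp_all

theorem code_o13 : code (Submodule.span F {(E 0 0 + E 1 1 : M F), E 0 2 + E 2 0}) = 12 := by
  have key : ∀ S : Submodule F (M F), ¬ LeftDegenerate S → ¬ RightDegenerate S → ¬ HasPure S →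
      TwoSingular S → HasSimpleZero S → HasMultipleZero S → code S = 12 := by
    intros; simp [code, *]
  refine key _ (not_leftDegenerate_span fun f hX hY => ?_)
    (not_rightDegenerate_span fun f hX hY => ?_) (not_hasPure_span fun a b h => ?_)
    (twoSingular_span (linearIndependent_of_minor 0 0 0 2 (by simp))
      ⟨LinearMap.proj 2, proj_ne_zero 2, by simp⟩ ⟨LinearMap.proj 1, proj_ne_zero 1, by simp⟩) ?_
    ⟨_, Submodule.subset_span (Set.mem_insert _ _), tensor_ne_zero_of_ent 0 0 (by simp [ent]),
      LinearMap.proj 2, LinearMap.proj 2, proj_ne_zero 2, proj_ne_zero 2, by simp, by simp, ?_⟩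
  · have h0 := hX 0
    have h1 := hX 1
    have h2 := hY 0
    simp at h0 h1 h2
    exact ⟨h0, h1, h2⟩
  · have h0 := hX 0
    have h1 := hX 1
    have h2 := hY 0
    simp at h0 h1 h2
    exact ⟨h0, h1, h2⟩
  · have h0 := h 0 2 2 0
    have h1 := h 0 0 1 1
    simp [ent] at h0 h1
    exact ⟨h1, h0⟩
  · rw [Set.pair_comm]
    exact hasSimpleZero_span_left 1 (by simp) (by simp) (tensor_ne_zero_of_ent 0 2 (by simp [ent]))
      (by simp [ent])
  · intro y hy
    obtain ⟨c, d, rfl⟩ := Submodule.mem_span_pair.1 hy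
    simp

theorem code_o14 : code (Submodule.span F {(E 0 0 + E 1 1 : M F), E 0 0 + E 2 2}) = 13 := by
  have key : ∀ S : Submodule F (M F), ¬ LeftDegenerate S → ¬ RightDegenerate S → ¬ HasPure S →
      TwoSingular S → HasSimpleZero S → ¬ HasMultipleZero S → code S = 13 := by
    intros; simp [code, *]
  refine key _ (not_leftDegenerate_span fun f hX hY => ?_)
    (not_rightDegenerate_span fun f hX hY => ?_) (not_hasPure_span fun a b h => ?_)
    (twoSingular_span (linearIndependent_of_minor 0 0 2 2 (by simp))
      ⟨LinearMap.proj 2, proj_ne_zero 2, by simp⟩ ⟨LinearMap.proj 1, proj_ne_zero 1, by simp⟩)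
    (hasSimpleZero_span_left 2 (by simp) (by simp) (tensor_ne_zero_of_ent 0 0 (by simp [ent]))
      (by simp [ent])) ?_
  · have h0 := hX 0
    have h1 := hX 1
    have h2 := hY 2
    simp at h0 h1 h2
    exact ⟨h0, h1, h2⟩
  · have h0 := hX 0
    have h1 := hX 1
    have h2 := hY 2
    simp at h0 h1 h2
    exact ⟨h0, h1, h2⟩
  · have h0 := h 1 1 2 2
    have h1 := h 0 0 1 1
    have h2 := h 0 0 2 2
    simp [ent] at h0 h1 h2
    rcases h0 with rfl | rfl <;> simp_all
  · rintro ⟨x, hx, hx0, f, f', hf0, hf0', hf, hf', h⟩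
    obtain ⟨a, b, rfl⟩ := Submodule.mem_span_pair.1 hx
    have hX := h _ (Submodule.subset_span (Set.mem_insert _ _))
    have hY := h _ (Submodule.subset_span (Set.mem_insert_of_mem _ rfl))
    have f0 := hf (LinearMap.proj 0)
    have f1 := hf (LinearMap.proj 1)
    have f2 := hf (LinearMap.proj 2)
    have g0 := hf' (LinearMap.proj 0)
    have g1 := hf' (LinearMap.proj 1)
    have g2 := hf' (LinearMap.proj 2)
    simp at f0 f1 f2 g0 g1 g2 hX hY
    -- exactly one of the diagonal entries `a + b`, `a`, `b` of a singular member is zero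
    by_cases ha : a = 0
    · have hb : b ≠ 0 := by rintro rfl; exact hx0 (by simp [ha])
      simp [ha, hb] at f0 f2 g0 g2
      simp [f0] at hX
      rcases hX with h1 | h1
      · exact hf0 (dual_eq_zero f0 h1 f2)
      · exact hf0' (dual_eq_zero g0 h1 g2)
    by_cases hb : b = 0
    · simp [ha, hb] at f0 f1 g0 g1
      simp [f0] at hY
      rcases hY with h1 | h1
      · exact hf0 (dual_eq_zero f0 f1 h1)
      · exact hf0' (dual_eq_zero g0 g1 h1)
    simp [ha, hb] at f1 f2 g1 g2
    simp [f1] at hX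
    rcases hX with h1 | h1
    · exact hf0 (dual_eq_zero h1 f1 f2)
    · exact hf0' (dual_eq_zero h1 g1 g2)

theorem code_o15 {γ δ : F} (hγ : Anisotropic γ δ) : code (Submodule.span F
    {(E 0 0 + γ • E 1 1 : M F), E 2 2 + (E 0 1 + E 1 0 + δ • E 1 1)}) = 14 := by
  have key : ∀ S : Submodule F (M F), ¬ LeftDegenerate S → ¬ RightDegenerate S → ¬ HasPure S →
      ¬ TwoSingular S → HasSimpleZero S → code S = 14 := by
    intros; simp [code, *]
  refine key _ (not_leftDegenerate_span fun f hX hY => ?_)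
    (not_rightDegenerate_span fun f hX hY => ?_) (not_hasPure_span fun a b h => ?_)
    (not_twoSingular_span fun a b f h hb => ?_)
    (hasSimpleZero_span_left 2 (by simp) (by simp) (tensor_ne_zero_of_ent 0 0 (by simp [ent]))
      (by simp [ent]))
  · have h0 := hX 0
    have h1 := hX 1
    have h2 := hY 2
    simp [hγ.ne_zero] at h0 h1 h2
    exact ⟨h0, h1, h2⟩
  · have h0 := hX 0
    have h1 := hX 1
    have h2 := hY 2
    simp [hγ.ne_zero] at h0 h1 h2
    exact ⟨h0, h1, h2⟩
  · have h0 := h 0 0 1 1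
    simp [ent] at h0
    exact hγ.eq_zero (by linear_combination -h0)
  · have h0 := h 0
    have h1 := h 1
    have h2 := h 2
    simp [hb] at h0 h1 h2
    have h3 : f (Pi.single 1 1) = 0 := by
      have : (b ^ 2 - δ * a * b - γ * a ^ 2) * f (Pi.single 1 1) = 0 := by
        linear_combination b * h0 - a * h1
      exact (mul_eq_zero.1 this).resolve_left fun e => hb (hγ.eq_zero e).2
    simp [h3, hb] at h1
    exact ⟨h1, h3, h2⟩

theorem code_o16 : code (Submodule.span F {(E 0 1 + E 1 0 : M F), E 0 2 + E 1 1 + E 2 0}) = 15 := by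
  have key : ∀ S : Submodule F (M F), ¬ LeftDegenerate S → ¬ RightDegenerate S → ¬ HasPure S →
      ¬ TwoSingular S → ¬ HasSimpleZero S → code S = 15 := by
    intros; simp [code, *]
  refine key _ (not_leftDegenerate_span fun f hX hY => ?_)
    (not_rightDegenerate_span fun f hX hY => ?_) (not_hasPure_span fun a b h => ?_)
    (not_twoSingular_span fun a b f h hb => ?_)
    (not_hasSimpleZero_span fun a b f f' hab hf hf' => ?_)
  · have h0 := hX 0
    have h1 := hX 1
    have h2 := hY 0
    simp at h0 h1 h2
    exact ⟨h1, h0, h2⟩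
  · have h0 := hX 0
    have h1 := hX 1
    have h2 := hY 0
    simp at h0 h1 h2
    exact ⟨h1, h0, h2⟩
  · have h0 := h 0 2 2 0
    have h1 := h 0 1 1 0
    simp [ent] at h0 h1
    exact ⟨h1, h0⟩
  · have h0 := h 0
    have h1 := h 1
    have h2 := h 2
    simp [hb] at h2
    simp [h2, hb] at h1
    simp [h1, hb] at h0
    exact ⟨h2, h1, h0⟩
  · have f0 := hf 0
    have f1 := hf 1
    have f2 := hf 2
    have g0 := hf' 0
    have g1 := hf' 1
    have g2 := hf' 2
    simp at f0 f1 f2 g0 g1 g2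
    by_cases hb : b = 0
    · have ha : a ≠ 0 := hab.resolve_right fun h => h hb
      simp [hb, ha] at f0 f1 g0 g1
      simp [f0, f1, g0, g1]
    · simp [hb] at f2 g2
      simp [f2, hb] at f1
      simp [g2, hb] at g1
      simp [f2, f1, g1, g2]

/-- The canonical pencils of numbers `8` and `14` exist only over fields with an anisotropic binary
quadratic form; all others are defined over every field. -/
theorem code_canon {γ δ : F} (i : Fin 16) (hγ : i = 8 ∨ i = 14 → Anisotropic γ δ) :
    code (Submodule.span F {canonLeft γ i, canonRight δ i}) = i := by
  fin_cases i
  exacts [code_o4, code_o4T, code_o5, code_o6, code_o7, code_o7T, code_o8, code_o9,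
    code_o10 (hγ (Or.inl rfl)), code_o11, code_o11T, code_o12, code_o13, code_o14,
    code_o15 (hγ (Or.inr rfl)), code_o16]

/-! ### Canonical tensors -/

theorem finrank_map_congr (g k : (Fin 3 → F) ≃ₗ[F] (Fin 3 → F)) (S : Submodule F (M F)) :
    Module.finrank F (S.map (TensorProduct.congr g k).toLinearMap) = Module.finrank F S :=
  LinearEquiv.finrank_map_eq (TensorProduct.congr g k) S

theorem smul_mem_Omega {A : V F} (hA : A ∈ Omega F) {h : V F ≃ₗ[F] V F} (hh : h ∈ H F) :
    h • A ∈ Omega F := by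
  obtain ⟨⟨g₁, g₂, g₃⟩, rfl⟩ := hh
  obtain ⟨hA, t, ht, ht0, hr⟩ := hA
  refine ⟨?_, TensorProduct.congr g₂ g₃ t, ?_, ?_, ?_⟩
  · rw [contractionSpace_smul, finrank_map_congr, hA]
  · rw [contractionSpace_smul]
    exact Submodule.mem_map_of_mem ht
  · exact (LinearEquiv.map_ne_zero_iff _).2 ht0
  · rwa [rk_congr]

/-- The canonical representative of each type. -/
noncomputable def canon (γ δ : F) (i : Fin 16) : V F := tens (canonLeft γ i) (canonRight δ i)

theorem rk_E_add_smul_E_le (i j k l : Fin 3) (c : F) :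
    rk ((E i j : M F) + c • E k l) ≤ 2 := by
  rw [E, E, TensorProduct.smul_tmul']
  exact rk_add_le _ _ _ _

theorem linearIndependent_canon (γ δ : F) (i : Fin 16) :
    LinearIndependent F ![canonLeft γ i, canonRight δ i] := by
  fin_cases i
  · exact linearIndependent_of_minor 0 0 0 1 (by simp [canonLeft, canonRight])
  · exact linearIndependent_of_minor 0 0 1 0 (by simp [canonLeft, canonRight])
  · exact linearIndependent_of_minor 0 0 1 1 (by simp [canonLeft, canonRight])
  · exact linearIndependent_of_minor 0 0 0 1 (by simp [canonLeft, canonRight])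
  · exact linearIndependent_of_minor 0 2 1 1 (by simp [canonLeft, canonRight])
  · exact linearIndependent_of_minor 2 0 1 1 (by simp [canonLeft, canonRight])
  · exact linearIndependent_of_minor 0 0 1 1 (by simp [canonLeft, canonRight])
  · exact linearIndependent_of_minor 0 0 0 1 (by simp [canonLeft, canonRight])
  · exact linearIndependent_of_minor 0 0 0 1 (by simp [canonLeft, canonRight])
  · exact linearIndependent_of_minor 0 0 0 1 (by simp [canonLeft, canonRight])
  · exact linearIndependent_of_minor 0 0 1 0 (by simp [canonLeft, canonRight])
  · exact linearIndependent_of_minor 0 1 0 2 (by simp [canonLeft, canonRight])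
  · exact linearIndependent_of_minor 0 0 0 2 (by simp [canonLeft, canonRight])
  · exact linearIndependent_of_minor 1 1 2 2 (by simp [canonLeft, canonRight])
  · exact linearIndependent_of_minor 0 0 2 2 (by simp [canonLeft, canonRight])
  · exact linearIndependent_of_minor 0 1 0 2 (by simp [canonLeft, canonRight])

/-- The first generator of every canonical pencil is singular, which puts the canonical tensors in
`Ω`. -/
theorem rk_canonLeft_le (γ : F) (i : Fin 16) : rk (canonLeft γ i) ≤ 2 := by
  have h : ∃ (i₁ j₁ i₂ j₂ : Fin 3) (c : F), canonLeft γ i = E i₁ j₁ + c • E i₂ j₂ := by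
    fin_cases i
    · exact ⟨0, 0, 0, 0, 0, by simp [canonLeft]⟩
    · exact ⟨0, 0, 0, 0, 0, by simp [canonLeft]⟩
    · exact ⟨0, 0, 0, 0, 0, by simp [canonLeft]⟩
    · exact ⟨0, 0, 0, 0, 0, by simp [canonLeft]⟩
    · exact ⟨0, 2, 0, 0, 0, by simp [canonLeft]⟩
    · exact ⟨2, 0, 0, 0, 0, by simp [canonLeft]⟩
    · exact ⟨0, 0, 0, 0, 0, by simp [canonLeft]⟩
    · exact ⟨0, 0, 0, 0, 0, by simp [canonLeft]⟩
    · exact ⟨0, 0, 1, 1, γ, by simp [canonLeft]⟩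
    · exact ⟨0, 0, 1, 1, 1, by simp [canonLeft]⟩
    · exact ⟨0, 0, 1, 1, 1, by simp [canonLeft]⟩
    · exact ⟨0, 1, 1, 0, 1, by simp [canonLeft]⟩
    · exact ⟨0, 0, 1, 1, 1, by simp [canonLeft]⟩
    · exact ⟨0, 0, 1, 1, 1, by simp [canonLeft]⟩
    · exact ⟨0, 0, 1, 1, γ, by simp [canonLeft]⟩
    · exact ⟨0, 1, 1, 0, 1, by simp [canonLeft]⟩
  obtain ⟨i₁, j₁, i₂, j₂, c, h⟩ := h
  rw [h]
  exact rk_E_add_smul_E_le _ _ _ _ _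

theorem canon_mem_Omega (γ δ : F) (i : Fin 16) : canon γ δ i ∈ Omega F := by
  have hli := linearIndependent_canon γ δ i
  have h2 := finrank_span_pair hli
  have hne : canonLeft γ i ≠ 0 := hli.ne_zero 0
  refine ⟨?_, canonLeft γ i, ?_, hne, rk_canonLeft_le γ i⟩
  · rwa [canon, contractionSpace_tens]
  · rw [canon, contractionSpace_tens]
    exact Submodule.subset_span (Set.mem_insert _ _)

/-- Representatives of different types lie in different orbits. -/
theorem eq_of_canon_mem_orbit {γ δ : F} {i j : Fin 16} (hi : i = 8 ∨ i = 14 → Anisotropic γ δ)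
    (hj : j = 8 ∨ j = 14 → Anisotropic γ δ) {A : V F} (hAi : A ∈ MulAction.orbit (H F) (canon γ δ i))
    (hAj : A ∈ MulAction.orbit (H F) (canon γ δ j)) : i = j := by
  have h1 := code_eq_of_mem_orbit hAi
  have h2 := code_eq_of_mem_orbit hAj
  rw [canon, contractionSpace_tens, code_canon _ hi] at h1
  rw [canon, contractionSpace_tens, code_canon _ hj] at h2
  rw [← h1, h2]

/-- The sixteen geometric types, in the order of the canonical tensors. -/
def oType (F : Type*) [Field F] : Fin 16 → Set (V F) :=
  ![o4 F, o4T F, o5 F, o6 F, o7 F, o7T F, o8 F, o9 F, o10 F, o11 F, o11T F, o12 F, o13 F, o14 F,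
    o15 F, o16 F]

theorem exists_mem_oType {A : V F} (hA : A ∈ Omega F) : ∃ i, A ∈ oType F i := by
  rcases exists_type hA with (h | h | h) | (h | h | h | h | h) | (h | h | h | h | h | h | h | h)
  exacts [⟨0, h⟩, ⟨1, h⟩, ⟨2, h⟩, ⟨3, h⟩, ⟨4, h⟩, ⟨5, h⟩, ⟨6, h⟩, ⟨7, h⟩, ⟨8, h⟩, ⟨9, h⟩, ⟨10, h⟩,
    ⟨11, h⟩, ⟨12, h⟩, ⟨13, h⟩, ⟨14, h⟩, ⟨15, h⟩]

theorem oType_subset_orbit {γ δ : F} (i : Fin 16) (hi : i = 8 ∨ i = 14 → IsUniversal γ δ) :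
    oType F i ⊆ MulAction.orbit (H F) (canon γ δ i) := by
  fin_cases i
  exacts [o4_subset_orbit, o4T_subset_orbit, o5_subset_orbit, o6_subset_orbit, o7_subset_orbit,
    o7T_subset_orbit, o8_subset_orbit, o9_subset_orbit, o10_subset_orbit (hi (Or.inl rfl)),
    o11_subset_orbit, o11T_subset_orbit, o12_subset_orbit, o13_subset_orbit, o14_subset_orbit,
    o15_subset_orbit (hi (Or.inr rfl)), o16_subset_orbit]

/-- Since the types cover `Ω` and each lies in one orbit, with different orbits for different types,
every nonempty type is a whole orbit. -/
theorem oType_eq_orbit {γ δ : F} {I : Set (Fin 16)} (hI : ∀ i ∈ I, i = 8 ∨ i = 14 → IsUniversal γ δ)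
    (hempty : ∀ i ∉ I, oType F i = ∅) {i : Fin 16} (hi : i ∈ I) :
    oType F i = MulAction.orbit (H F) (canon γ δ i) := by
  refine (oType_subset_orbit i (hI i hi)).antisymm ?_
  rintro _ ⟨⟨h, hh⟩, rfl⟩
  obtain ⟨j, hj⟩ := exists_mem_oType (smul_mem_Omega (canon_mem_Omega γ δ i) hh)
  have hjI : j ∈ I := by
    by_contra hn
    rw [hempty j hn] at hj
    exact hj
  have := eq_of_canon_mem_orbit (fun h => (hI i hi h).1) (fun h => (hI j hjI h).1) ⟨⟨h, hh⟩, rfl⟩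
    (oType_subset_orbit j (hI j hjI) hj)
  subst this
  exact hj

/-! ### Anisotropic binary quadratic forms -/

theorem not_isSquare_discr (h2 : (2 : F) ≠ 0) {γ δ : F} (h : Anisotropic γ δ) :
    ¬ IsSquare (δ ^ 2 + 4 * γ) := by
  rintro ⟨r, hr⟩
  exact h2 (h (r - δ) 2 (by linear_combination -hr)).2

/-- Away from characteristic two, binary forms are classified by the square class of their
discriminant. -/
theorem isUniversal_of_not_isSquare (h2 : (2 : F) ≠ 0) {d : F} (hd : ¬ IsSquare d)
    (h : ∀ D : F, ¬ IsSquare D → IsSquare (d * D)) : IsUniversal d 0 := by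
  constructor
  · intro s t e
    have ht : t = 0 := by
      by_contra ht
      refine hd ⟨s / t, ?_⟩
      field_simp
      linear_combination -e
    subst ht
    exact ⟨by simpa using e, rfl⟩
  · intro γ δ hγ
    have hD := not_isSquare_discr h2 hγ
    obtain ⟨r, hr⟩ := h _ hD
    have hd0 : d ≠ 0 := by rintro rfl; exact hd ⟨0, by simp⟩
    have hD0 : δ ^ 2 + 4 * γ ≠ 0 := by intro h; rw [h] at hD; exact hD ⟨0, by simp⟩
    have hr0 : r ≠ 0 := by
      rintro rfl
      exact mul_ne_zero hd0 hD0 (by rw [hr, zero_mul])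
    refine ⟨2 * d / r, -(d * δ / r), div_ne_zero (mul_ne_zero h2 hd0) hr0, by ring, ?_⟩
    field_simp
    linear_combination -hr

/-- The Artin–Schreier map in characteristic two. -/
def artinSchreier (h2 : (2 : F) = 0) : F →+ F where
  toFun c := c ^ 2 + c
  map_zero' := by simp
  map_add' x y := by linear_combination x * y * h2

/-- The Artin–Schreier map of a finite field has a kernel of order two. -/
theorem index_range_artinSchreier [Finite F] (h2 : (2 : F) = 0) :
    (artinSchreier h2).range.index = 2 := by
  have hker : Nat.card (artinSchreier h2).ker = 2 := by
    have : ((artinSchreier h2).ker : Set F) = {0, 1} := by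
      ext c
      simp only [SetLike.mem_coe, AddMonoidHom.mem_ker, Set.mem_insert_iff, Set.mem_singleton_iff]
      change c ^ 2 + c = 0 ↔ _
      constructor
      · intro e
        have : c * (c - 1) = 0 := by linear_combination e - c * h2
        rcases mul_eq_zero.1 this with h | h
        exacts [Or.inl h, Or.inr (sub_eq_zero.1 h)]
      · rintro (rfl | rfl)
        · simp
        · linear_combination h2
    rw [← SetLike.coe_sort_coe, this, Nat.card_coe_set_eq, Set.ncard_pair zero_ne_one]
  have h1 := (artinSchreier h2).ker.card_mul_index
  have h3 := (artinSchreier h2).range.card_mul_index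
  rw [AddSubgroup.index_ker, hker] at h1
  have hpos : 0 < Nat.card (artinSchreier h2).range := Nat.card_pos
  refine Nat.eq_of_mul_eq_mul_left hpos ?_
  rw [h3, ← h1, mul_comm]

/-- Over a finite field of characteristic two, binary forms are classified by their Arf
invariant. -/
theorem exists_isUniversal_of_two_eq_zero [Finite F] (h2 : (2 : F) = 0) :
    ∃ γ₀ δ₀ : F, IsUniversal γ₀ δ₀ := by
  have hidx := index_range_artinSchreier h2
  obtain ⟨γ₀, hγ₀⟩ : ∃ γ₀, γ₀ ∉ (artinSchreier h2).range := by
    by_contra! h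
    rw [(AddSubgroup.eq_top_iff' _).2 h] at hidx
    simp at hidx
  refine ⟨γ₀, 1, ?_, ?_⟩
  · intro s t e
    have ht : t = 0 := by
      by_contra ht
      refine hγ₀ ⟨s / t, ?_⟩
      change (s / t) ^ 2 + s / t = γ₀
      field_simp
      linear_combination e
    subst ht
    exact ⟨by simpa using e, rfl⟩
  · intro γ δ hγ
    have hδ : δ ≠ 0 := by
      rintro rfl
      have := Fintype.ofFinite F
      have hc : ringChar F = 2 := by
        have : CharP F 2 := CharTwo.of_one_ne_zero_of_two_eq_zero one_ne_zero h2
        exact ringChar.eq F 2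
      -- every element is a square, so the form `s² - γ t²` is isotropic
      obtain ⟨c, hc⟩ := FiniteField.isSquare_of_char_two hc γ
      exact one_ne_zero (hγ c 1 (by rw [hc]; ring)).2
    have hout : γ / δ ^ 2 ∉ (artinSchreier h2).range := by
      rintro ⟨c, hc⟩
      change c ^ 2 + c = γ / δ ^ 2 at hc
      field_simp at hc
      exact one_ne_zero (hγ (c * δ) 1 (by linear_combination hc)).2
    have hin : γ / δ ^ 2 + γ₀ ∈ (artinSchreier h2).range :=
      (AddSubgroup.add_mem_iff_of_index_two hidx).2 (by simp [hout, hγ₀])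
    obtain ⟨c, hc⟩ := hin
    change c ^ 2 + c = γ / δ ^ 2 + γ₀ at hc
    refine ⟨1 / δ, c, one_div_ne_zero hδ, ?_, ?_⟩
    · field_simp
      linear_combination -c * h2
    · have : γ / δ ^ 2 = (1 / δ) ^ 2 * γ := by ring
      have h1 : 1 / δ * c * δ = c := by field_simp
      rw [← this, h1]
      linear_combination hc + γ₀ * h2

/-- A finite or real closed field has exactly one quadratic extension. Away from characteristic two the
reason is that a product of two nonsquares of a finite field is a square, respectively that every
nonsquare of a real closed field is minus a square. -/
theorem exists_isUniversal (hF : Finite F ∨ IsRealClosed F) : ∃ γ₀ δ₀ : F, IsUniversal γ₀ δ₀ := by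
  rcases hF with hF | hF
  · by_cases h2 : (2 : F) = 0
    · exact exists_isUniversal_of_two_eq_zero h2
    · classical
      have := Fintype.ofFinite F
      have hc : ringChar F ≠ 2 := by
        intro h
        have h' := ringChar.Nat.cast_ringChar (R := F)
        rw [h] at h'
        exact h2 (by exact_mod_cast h')
      obtain ⟨d, hd⟩ := FiniteField.exists_nonsquare hc
      refine ⟨d, 0, isUniversal_of_not_isSquare h2 hd fun D hD => ?_⟩
      by_contra hn
      rw [← quadraticChar_neg_one_iff_not_isSquare] at hd hD hn
      rw [map_mul, hd, hD] at hn
      norm_num at hn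
  · have hd : ¬ IsSquare (-1 : F) := fun h => IsSemireal.not_isSumSq_neg_one F h.isSumSq
    refine ⟨-1, 0, isUniversal_of_not_isSquare two_ne_zero hd fun D hD => ?_⟩
    rw [neg_one_mul]
    exact IsRealClosed.isSquare_neg_of_not_isSquare hD

theorem not_anisotropic [IsAlgClosed F] (γ δ : F) : ¬ Anisotropic γ δ := by
  intro h
  obtain ⟨s, hs⟩ := IsAlgClosed.exists_root
    (Polynomial.X ^ 2 + Polynomial.C δ * Polynomial.X - Polynomial.C γ : Polynomial F) (by
      have : (Polynomial.X ^ 2 + Polynomial.C δ * Polynomial.X - Polynomial.C γ :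
        Polynomial F).degree = 2 := by compute_degree!
      rw [this]; decide)
  simp [Polynomial.IsRoot] at hs
  exact one_ne_zero (h s 1 (by linear_combination hs)).2

/-! ### Linear maps that preserve pure tensors -/

section Pure

variable {W E₁ E₂ E₁' E₂' : Type*} [AddCommGroup W] [Module F W] [AddCommGroup E₁] [Module F E₁]
  [AddCommGroup E₂] [Module F E₂] [AddCommGroup E₁'] [Module F E₁'] [AddCommGroup E₂'] [Module F E₂']

theorem eq_top_or_eq_top_of_forall_mem {P Q : Submodule F W} (h : ∀ c, c ∈ P ∨ c ∈ Q) :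
    P = ⊤ ∨ Q = ⊤ := by
  by_contra! hn
  obtain ⟨p, hp⟩ : ∃ p, p ∉ P := by
    by_contra! h'
    exact hn.1 ((Submodule.eq_top_iff').2 h')
  obtain ⟨q, hq⟩ : ∃ q, q ∉ Q := by
    by_contra! h'
    exact hn.2 ((Submodule.eq_top_iff').2 h')
  have hpQ := (h p).resolve_left hp
  have hqP := (h q).resolve_right hq
  rcases h (p + q) with h' | h'
  · exact hp ((Submodule.add_mem_iff_left P hqP).1 h')
  · exact hq ((Submodule.add_mem_iff_right Q hpQ).1 h')

theorem exists_dual_eq_one {u : E₁} (hu : u ≠ 0) : ∃ f : Module.Dual F E₁, f u = 1 := by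
  obtain ⟨f, hf⟩ : ∃ f : Module.Dual F E₁, f u ≠ 0 := by
    by_contra! hf
    exact hu ((Module.forall_dual_apply_eq_zero_iff F u).1 hf)
  exact ⟨(f u)⁻¹ • f, by simp [hf]⟩

theorem exists_linearMap_of_forall_left {φ : W →ₗ[F] E₁ ⊗[F] E₂} {u : E₁} (hu : u ≠ 0)
    (h : ∀ c, ∃ w, φ c = u ⊗ₜ w) : ∃ ψ : W →ₗ[F] E₂, ∀ c, φ c = u ⊗ₜ ψ c := by
  obtain ⟨f, hf⟩ := exists_dual_eq_one (F := F) hu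
  refine ⟨(TensorProduct.lid F E₂).toLinearMap ∘ₗ LinearMap.rTensor E₂ f ∘ₗ φ, fun c => ?_⟩
  obtain ⟨w, hw⟩ := h c
  simp [hw, hf]

theorem exists_linearMap_of_forall_right {φ : W →ₗ[F] E₁ ⊗[F] E₂} {w : E₂} (hw : w ≠ 0)
    (h : ∀ c, ∃ u, φ c = u ⊗ₜ w) : ∃ ψ : W →ₗ[F] E₁, ∀ c, φ c = ψ c ⊗ₜ w := by
  obtain ⟨ψ, hψ⟩ := exists_linearMap_of_forall_left
    (φ := (TensorProduct.comm F E₁ E₂).toLinearMap ∘ₗ φ) hw fun c => by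
      obtain ⟨u, hu⟩ := h c
      exact ⟨u, by simp [hu]⟩
  refine ⟨ψ, fun c => (TensorProduct.comm F E₁ E₂).injective ?_⟩
  simpa using hψ c

theorem mem_span_of_not_linearIndependent {u v : E₁} (hu : u ≠ 0)
    (h : ¬ LinearIndependent F ![u, v]) : ∃ a : F, v = a • u := by
  rw [LinearIndependent.pair_iff' hu] at h
  push Not at h
  obtain ⟨a, ha⟩ := h
  exact ⟨a, ha.symm⟩

/-- A sum of two pure tensors with independent first factors and independent second factors is not
pure. -/
theorem tmul_add_tmul_ne {u₁ u₂ u : E₁} {w₁ w₂ w : E₂} (hu : LinearIndependent F ![u₁, u₂])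
    (hw : LinearIndependent F ![w₁, w₂]) : u₁ ⊗ₜ[F] w₁ + u₂ ⊗ₜ[F] w₂ ≠ u ⊗ₜ w := by
  intro h
  have := le_of_mem_span_tmul (F := F) (k := 2) (m := 1) hu hw (b := fun _ => u) (c := fun _ => w) (by
    simp only [Fin.sum_univ_two, Matrix.cons_val_zero, Matrix.cons_val_one, h]
    exact Submodule.subset_span ⟨0, rfl⟩)
  omega

/-- A linear map all of whose values are pure tensors has a constant first factor or a constant
second factor: the source is the union of two subspaces, on which one factor of the value is
proportional to that of a fixed value. -/
theorem exists_const_factor [Nontrivial W] {φ : W →ₗ[F] E₁ ⊗[F] E₂}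
    (h : ∀ c ≠ 0, ∃ u w, u ≠ 0 ∧ w ≠ 0 ∧ φ c = u ⊗ₜ w) :
    (∃ u ≠ 0, ∃ ψ : W →ₗ[F] E₂, ∀ c, φ c = u ⊗ₜ ψ c) ∨
      ∃ w ≠ 0, ∃ ψ : W →ₗ[F] E₁, ∀ c, φ c = ψ c ⊗ₜ w := by
  obtain ⟨c₀, hc₀⟩ := exists_ne (0 : W)
  obtain ⟨u₀, w₀, hu₀, hw₀, e₀⟩ := h c₀ hc₀
  have hpure : ∀ c, ∃ u w, φ c = u ⊗ₜ w := by
    intro c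
    by_cases hc : c = 0
    · exact ⟨0, 0, by simp [hc]⟩
    · obtain ⟨u, w, -, -, e⟩ := h c hc
      exact ⟨u, w, e⟩
  let P : Submodule F W := (LinearMap.range (TensorProduct.mk F E₁ E₂ u₀)).comap φ
  let Q : Submodule F W := (LinearMap.range ((TensorProduct.mk F E₁ E₂).flip w₀)).comap φ
  have hPQ : ∀ c, c ∈ P ∨ c ∈ Q := by
    intro c
    obtain ⟨u, w, e⟩ := hpure c
    by_cases hu : LinearIndependent F ![u₀, u]
    · by_cases hw : LinearIndependent F ![w₀, w]
      · obtain ⟨u', w', e'⟩ := hpure (c₀ + c)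
        rw [map_add, e₀, e] at e'
        exact absurd e' (tmul_add_tmul_ne hu hw)
      · obtain ⟨a, rfl⟩ := mem_span_of_not_linearIndependent hw₀ hw
        exact Or.inr ⟨a • u, by rw [e]; simp⟩
    · obtain ⟨a, rfl⟩ := mem_span_of_not_linearIndependent hu₀ hu
      exact Or.inl ⟨a • w, by rw [e]; simp [TensorProduct.smul_tmul]⟩
  rcases eq_top_or_eq_top_of_forall_mem hPQ with hP | hQ
  · refine Or.inl ⟨u₀, hu₀, exists_linearMap_of_forall_left hu₀ fun c => ?_⟩
    obtain ⟨w, hw⟩ : c ∈ P := hP ▸ Submodule.mem_top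
    exact ⟨w, hw.symm⟩
  · refine Or.inr ⟨w₀, hw₀, exists_linearMap_of_forall_right hw₀ fun c => ?_⟩
    obtain ⟨w, hw⟩ : c ∈ Q := hQ ▸ Submodule.mem_top
    exact ⟨w, hw.symm⟩

/-- An invertible linear map that sends every `a ⊗ E₂` into some `x ⊗ E₂'` is a tensor product of two
linear maps. -/
theorem exists_eq_tmul_of_forall_left [Nontrivial E₁] [Nontrivial E₂] [Nontrivial E₂']
    (hE : ∀ x : E₁', x ≠ 0 → ∃ y, LinearIndependent F ![x, y])
    (g : (E₁ ⊗[F] E₂) ≃ₗ[F] (E₁' ⊗[F] E₂'))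
    (h : ∀ a ≠ 0, ∃ x ≠ 0, ∃ ψ : E₂ →ₗ[F] E₂', ∀ t, g (a ⊗ₜ t) = x ⊗ₜ ψ t) :
    ∃ (σ : E₁ →ₗ[F] E₁') (τ : E₂ →ₗ[F] E₂'), ∀ a t, g (a ⊗ₜ t) = σ a ⊗ₜ τ t := by
  have hne : ∀ {a : E₁} {t : E₂}, a ≠ 0 → t ≠ 0 → g (a ⊗ₜ t) ≠ 0 := fun ha ht =>
    (LinearEquiv.map_ne_zero_iff g).2 (tmul_ne_zero ha ht)
  obtain ⟨t₀, ht₀⟩ := exists_ne (0 : E₂)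
  obtain ⟨a₀, ha₀⟩ := exists_ne (0 : E₁)
  have hpure : ∀ a ≠ 0, ∃ u w, u ≠ 0 ∧ w ≠ 0 ∧
      (g.toLinearMap ∘ₗ (TensorProduct.mk F E₁ E₂).flip t₀) a = u ⊗ₜ w := by
    intro a ha
    obtain ⟨x, hx, ψ, e⟩ := h a ha
    refine ⟨x, ψ t₀, hx, fun h0 => hne ha ht₀ ?_, by simp [e]⟩
    rw [e, h0, TensorProduct.tmul_zero]
  rcases exists_const_factor hpure with ⟨x₀, hx₀, ψ₀, e₀⟩ | ⟨m, hm, σ, e₀⟩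
  · exfalso
    simp only [LinearMap.comp_apply, LinearMap.flip_apply, TensorProduct.mk_apply,
      LinearEquiv.coe_coe] at e₀
    have hrange : ∀ s, ∃ w, g s = x₀ ⊗ₜ w := by
      intro s
      induction s using TensorProduct.induction_on with
      | zero => exact ⟨0, by simp⟩
      | add s s' hs hs' =>
        obtain ⟨w, hw⟩ := hs
        obtain ⟨w', hw'⟩ := hs'
        exact ⟨w + w', by rw [map_add, hw, hw', TensorProduct.tmul_add]⟩
      | tmul a t =>
        by_cases ha : a = 0
        · exact ⟨0, by simp [ha]⟩
        obtain ⟨x, hx, ψ, e⟩ := h a ha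
        have hψ : ψ t₀ ≠ 0 := fun h0 => hne ha ht₀ (by rw [e, h0, TensorProduct.tmul_zero])
        obtain ⟨c, -, hc⟩ := exists_smul_of_tmul_eq_right hx hψ ((e t₀).symm.trans (e₀ a))
        exact ⟨c • ψ t, by rw [e, hc, TensorProduct.smul_tmul]⟩
    obtain ⟨y, hy⟩ := hE x₀ hx₀
    obtain ⟨w, hw⟩ := exists_ne (0 : E₂')
    obtain ⟨w', hw'⟩ := hrange (g.symm (y ⊗ₜ w))
    rw [g.apply_symm_apply] at hw'
    have hy0 : y ≠ 0 := hy.ne_zero 1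
    obtain ⟨c, -, hc⟩ := exists_smul_of_tmul_eq_right hy0 hw hw'
    exact (LinearIndependent.pair_iff' hx₀).1 hy c hc.symm
  · simp only [LinearMap.comp_apply, LinearMap.flip_apply, TensorProduct.mk_apply,
      LinearEquiv.coe_coe] at e₀
    have hσ : ∀ a, a ≠ 0 → σ a ≠ 0 := fun a ha h0 => hne ha ht₀ (by rw [e₀, h0, TensorProduct.zero_tmul])
    -- After rescaling, the first factor of `g (a ⊗ t)` is `σ a`.
    have h' : ∀ a ≠ 0, ∃ ψ : E₂ →ₗ[F] E₂', ∀ t, g (a ⊗ₜ t) = σ a ⊗ₜ ψ t := by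
      intro a ha
      obtain ⟨x, hx, ψ, e⟩ := h a ha
      have hψ : ψ t₀ ≠ 0 := fun h0 => hne ha ht₀ (by rw [e, h0, TensorProduct.tmul_zero])
      obtain ⟨c, -, hc⟩ := exists_smul_of_tmul_eq_right hx hψ ((e t₀).symm.trans (e₀ a))
      exact ⟨c • ψ, fun t => by rw [e, hc, TensorProduct.smul_tmul, LinearMap.smul_apply]⟩
    obtain ⟨τ, hτ⟩ := h' a₀ ha₀
    refine ⟨σ, τ, fun a t => ?_⟩
    by_cases ha : LinearIndependent F ![a₀, a]
    · have ha0 : a ≠ 0 := ha.ne_zero 1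
      have hs0 : a₀ + a ≠ 0 := by
        intro h0
        have := (LinearIndependent.pair_iff.1 ha 1 1 (by simpa using h0)).1
        exact one_ne_zero this
      obtain ⟨ψ, hψ⟩ := h' a ha0
      obtain ⟨ψ', hψ'⟩ := h' _ hs0
      have hli : LinearIndependent F ![σ a₀, σ a] := by
        rw [LinearIndependent.pair_iff] at ha ⊢
        intro r s e
        refine ha r s ?_
        by_contra hn
        exact hσ _ hn (by simpa using e)
      have e := hψ' t
      rw [TensorProduct.add_tmul, map_add, hτ, hψ, map_add, TensorProduct.add_tmul] at e
      have e' : σ a₀ ⊗ₜ[F] (τ t - ψ' t) = σ a ⊗ₜ[F] (ψ' t - ψ t) := by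
        rw [TensorProduct.tmul_sub, TensorProduct.tmul_sub, sub_eq_sub_iff_add_eq_add, e, add_comm]
      have hτψ : τ t = ψ' t := by
        by_contra hn
        obtain ⟨c, hc0, hc⟩ := exists_smul_of_tmul_eq_right (hσ _ ha₀) (sub_ne_zero.2 hn) e'
        have := LinearIndependent.pair_iff.1 hli 1 (-c) (by rw [hc]; module)
        exact one_ne_zero this.1
      rw [hτψ, sub_self, TensorProduct.tmul_zero] at e'
      have hψψ : ψ' t = ψ t := by
        by_contra hn
        exact tmul_ne_zero (hσ _ ha0) (sub_ne_zero.2 hn) e'.symm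
      rw [hψ, hτψ, hψψ]
    · obtain ⟨c, rfl⟩ := mem_span_of_not_linearIndependent ha₀ ha
      rw [← TensorProduct.smul_tmul', map_smul, hτ, map_smul, TensorProduct.smul_tmul']

end Pure

/-! ### The group `G` -/

/-- Interchange of the two three-dimensional factors. -/
noncomputable def swap (F : Type*) [Field F] : V F ≃ₗ[F] V F :=
  TensorProduct.congr (LinearEquiv.refl F _) (TensorProduct.comm F (Fin 3 → F) (Fin 3 → F))

theorem swap_swap (A : V F) : swap F (swap F A) = A := by
  have : (swap F).toLinearMap ∘ₗ (swap F).toLinearMap = LinearMap.id := by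
    ext
    simp [swap]
  exact LinearMap.congr_fun this A

theorem mem_G_of_forall_mem {g : V F ≃ₗ[F] V F}
    (h : ∀ A ∈ fundamentalTensors F, g A ∈ fundamentalTensors F)
    (h' : ∀ A ∈ fundamentalTensors F, g.symm A ∈ fundamentalTensors F) : g ∈ G F := by
  rw [G, MulAction.mem_stabilizer_set]
  intro A
  refine ⟨fun hA => ?_, h A⟩
  have := h' _ hA
  rwa [LinearEquiv.smul_def, g.symm_apply_apply] at this

theorem H_le_G : H F ≤ G F := by
  have key : ∀ h ∈ H F, ∀ A ∈ fundamentalTensors F, h A ∈ fundamentalTensors F := by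
    rintro _ ⟨⟨g₁, g₂, g₃⟩, rfl⟩ _ ⟨a, b, c, ha, hb, hc, rfl⟩
    exact ⟨g₁ a, g₂ b, g₃ c, g₁.map_ne_zero_iff.2 ha, g₂.map_ne_zero_iff.2 hb,
      g₃.map_ne_zero_iff.2 hc, rfl⟩
  intro h hh
  exact mem_G_of_forall_mem (key h hh) (key h⁻¹ (inv_mem hh))

theorem swap_mem_G : swap F ∈ G F := by
  have key : ∀ A ∈ fundamentalTensors F, swap F A ∈ fundamentalTensors F := by
    rintro _ ⟨a, b, c, ha, hb, hc, rfl⟩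
    exact ⟨a, c, b, ha, hc, hb, by simp [swap]⟩
  have hsymm : (swap F).symm = swap F := by
    ext A : 1
    rw [LinearEquiv.symm_apply_eq, swap_swap]
  exact mem_G_of_forall_mem key (by rw [hsymm]; exact key)

theorem map_fundamental {g : V F ≃ₗ[F] V F} (hg : g ∈ G F) {a : Fin 2 → F} {b c : Fin 3 → F}
    (ha : a ≠ 0) (hb : b ≠ 0) (hc : c ≠ 0) : ∃ (a' : Fin 2 → F) (b' c' : Fin 3 → F),
      a' ≠ 0 ∧ b' ≠ 0 ∧ c' ≠ 0 ∧ g (a ⊗ₜ (b ⊗ₜ c)) = a' ⊗ₜ (b' ⊗ₜ c') := by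
  rw [G, MulAction.mem_stabilizer_set] at hg
  exact (hg _).2 ⟨a, b, c, ha, hb, hc, rfl⟩

/-- A linear map from `F³` all of whose values are fundamental tensors has a constant first factor,
as `F³` does not embed in `F²`. -/
theorem exists_const_first_factor (φ : (Fin 3 → F) →ₗ[F] V F) (h : ∀ c ≠ 0, ∃ (u : Fin 2 → F) (t : M F),
    u ≠ 0 ∧ t ≠ 0 ∧ φ c = u ⊗ₜ t) :
    ∃ u ≠ 0, ∃ ψ : (Fin 3 → F) →ₗ[F] M F, ∀ c, φ c = u ⊗ₜ ψ c := by
  rcases exists_const_factor h with h' | ⟨t, ht, ψ, hψ⟩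
  · exact h'
  · exfalso
    have hinj : Function.Injective ψ := by
      rw [← LinearMap.ker_eq_bot, LinearMap.ker_eq_bot']
      intro c hc
      by_contra hc0
      obtain ⟨u, t', hu, ht', e⟩ := h c hc0
      rw [hψ, hc, TensorProduct.zero_tmul] at e
      exact tmul_ne_zero hu ht' e.symm
    have := LinearMap.finrank_le_finrank_of_injective hinj
    simp at this

theorem exists_pair_of_ne_zero_two {x : Fin 2 → F} (h : x ≠ 0) :
    ∃ y, LinearIndependent F ![x, y] := by
  obtain ⟨y, -, hy⟩ := exists_pair_of_finrank_eq_two (F := F) (U := (⊤ : Submodule F (Fin 2 → F)))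
    (by simp) h
  exact ⟨y, hy⟩

instance : Nontrivial (M F) :=
  ⟨E 0 0, 0, tmul_ne_zero (by simp) (by simp)⟩

theorem exists_eq_tmul_of_mem_G {g : V F ≃ₗ[F] V F} (hg : g ∈ G F) :
    ∃ (σ : (Fin 2 → F) →ₗ[F] (Fin 2 → F)) (τ : M F →ₗ[F] M F), ∀ a t, g (a ⊗ₜ t) = σ a ⊗ₜ τ t := by
  have hE : ∀ x : Fin 2 → F, x ≠ 0 → ∃ y, LinearIndependent F ![x, y] :=
    fun _ hx => exists_pair_of_ne_zero_two hx
  refine exists_eq_tmul_of_forall_left hE g fun a ha => ?_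
  have hpure : ∀ b c : Fin 3 → F, b ≠ 0 → c ≠ 0 → ∃ (u : Fin 2 → F) (t : M F),
      u ≠ 0 ∧ t ≠ 0 ∧ g (a ⊗ₜ (b ⊗ₜ c)) = u ⊗ₜ t := by
    intro b c hb hc
    obtain ⟨a', b', c', ha', hb', hc', e⟩ := map_fundamental hg ha hb hc
    exact ⟨a', b' ⊗ₜ c', ha', tmul_ne_zero hb' hc', e⟩
  obtain ⟨b₀, hb₀⟩ := exists_ne (0 : Fin 3 → F)
  obtain ⟨x, hx, ψ, hψ⟩ := exists_const_first_factor
    (g.toLinearMap ∘ₗ TensorProduct.mk F _ _ a ∘ₗ TensorProduct.mk F _ _ b₀) fun c hc => hpure b₀ c hb₀ hc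
  refine ⟨x, hx, exists_linearMap_of_forall_left (φ := g.toLinearMap ∘ₗ TensorProduct.mk F _ _ a) hx
    fun t => ?_⟩
  change ∃ w, g (a ⊗ₜ t) = _
  induction t using TensorProduct.induction_on with
  | zero => exact ⟨0, by rw [TensorProduct.tmul_zero, g.map_zero, TensorProduct.tmul_zero]⟩
  | add s s' hs hs' =>
    obtain ⟨w, hw⟩ := hs
    obtain ⟨w', hw'⟩ := hs'
    exact ⟨w + w', by
      rw [TensorProduct.tmul_add, LinearEquiv.map_add, hw, hw', TensorProduct.tmul_add]⟩
  | tmul b c =>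
    by_cases hc : c = 0
    · exact ⟨0, by rw [hc, TensorProduct.tmul_zero, TensorProduct.tmul_zero, g.map_zero,
        TensorProduct.tmul_zero]⟩
    obtain ⟨x', hx', ψ', hψ'⟩ := exists_const_first_factor
      (g.toLinearMap ∘ₗ TensorProduct.mk F _ _ a ∘ₗ (TensorProduct.mk F _ _).flip c)
      fun b hb => hpure b c hb hc
    have e : g (a ⊗ₜ (b₀ ⊗ₜ c)) = x ⊗ₜ ψ c := hψ c
    have e' : g (a ⊗ₜ (b₀ ⊗ₜ c)) = x' ⊗ₜ ψ' b₀ := hψ' b₀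
    have hne : ψ' b₀ ≠ 0 := by
      intro h0
      rw [h0, TensorProduct.tmul_zero] at e'
      exact (LinearEquiv.map_ne_zero_iff g).2 (tmul_ne_zero ha (tmul_ne_zero hb₀ hc)) e'
    obtain ⟨k, -, hk⟩ := exists_smul_of_tmul_eq_right hx' hne (e'.symm.trans e)
    exact ⟨k • ψ' b, by rw [← TensorProduct.smul_tmul, ← hk]; exact hψ' b⟩

/-- The two kinds of linear maps `F³ → F³ ⊗ F³` with pure values cannot occur together in a linear map
of `F³ ⊗ F³` that preserves pure tensors. -/
theorem exists_not_pure {y z : Fin 3 → F} (hy : y ≠ 0) (hz : z ≠ 0)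
    {ψ ψ' : (Fin 3 → F) →ₗ[F] (Fin 3 → F)} (hψ : Function.Injective ψ) (hψ' : Function.Injective ψ') :
    ∃ c ≠ 0, ∀ u w : Fin 3 → F, y ⊗ₜ[F] ψ c + ψ' c ⊗ₜ[F] z ≠ u ⊗ₜ w := by
  have hntop : ∀ {v : Fin 3 → F} {χ : (Fin 3 → F) →ₗ[F] (Fin 3 → F)}, Function.Injective χ →
      v ≠ 0 → (Submodule.span F {v}).comap χ ≠ ⊤ := by
    intro v χ hχ hv h
    have h1 : LinearMap.range χ = ⊤ :=
      LinearMap.range_eq_top.2 (LinearMap.injective_iff_surjective.1 hχ)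
    have h2 : (⊤ : Submodule F (Fin 3 → F)) ≤ Submodule.span F {v} := by
      rw [← h1]
      rintro _ ⟨c, rfl⟩
      have : c ∈ (Submodule.span F {v}).comap χ := h ▸ Submodule.mem_top
      exact this
    have h3 := Submodule.finrank_mono h2
    rw [finrank_span_singleton hv] at h3
    simp at h3
  have hc : ∃ c, c ∉ (Submodule.span F {z}).comap ψ ∧ c ∉ (Submodule.span F {y}).comap ψ' := by
    by_contra! hn
    rcases eq_top_or_eq_top_of_forall_mem (fun c => or_iff_not_imp_left.2 (hn c)) with h | h
    exacts [hntop hψ hz h, hntop hψ' hy h]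
  obtain ⟨c, h1, h2⟩ := hc
  refine ⟨c, ?_, fun u w => tmul_add_tmul_ne ?_ ?_⟩
  · rintro rfl
    exact h1 (Submodule.zero_mem _)
  · by_contra hn
    obtain ⟨k, hk⟩ := mem_span_of_not_linearIndependent hy hn
    exact h2 (Submodule.mem_span_singleton.2 ⟨k, hk.symm⟩)
  · by_contra hn
    rw [LinearIndependent.pair_symm_iff] at hn
    obtain ⟨k, hk⟩ := mem_span_of_not_linearIndependent hz hn
    exact h1 (Submodule.mem_span_singleton.2 ⟨k, hk.symm⟩)

/-- A linear automorphism of `F³ ⊗ F³` that preserves pure tensors is a tensor product of two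
automorphisms, possibly composed with the interchange of the factors. -/
theorem exists_eq_congr_of_pure {τ : M F ≃ₗ[F] M F} (h : ∀ b c : Fin 3 → F, b ≠ 0 → c ≠ 0 →
    ∃ b' c' : Fin 3 → F, b' ≠ 0 ∧ c' ≠ 0 ∧ τ (b ⊗ₜ c) = b' ⊗ₜ c') :
    ∃ p q : (Fin 3 → F) →ₗ[F] (Fin 3 → F), (∀ b c, τ (b ⊗ₜ c) = p b ⊗ₜ q c) ∨
      ∀ b c, τ (b ⊗ₜ c) = q c ⊗ₜ p b := by
  have hE : ∀ x : Fin 3 → F, x ≠ 0 → ∃ y, LinearIndependent F ![x, y] :=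
    fun _ hx => exists_pair_of_ne_zero hx
  have htype : ∀ b ≠ 0,
      (∃ u ≠ 0, ∃ ψ : (Fin 3 → F) →ₗ[F] (Fin 3 → F), ∀ c, τ (b ⊗ₜ c) = u ⊗ₜ ψ c) ∨
      ∃ w ≠ 0, ∃ ψ : (Fin 3 → F) →ₗ[F] (Fin 3 → F), ∀ c, τ (b ⊗ₜ c) = ψ c ⊗ₜ w := fun b hb =>
    exists_const_factor (φ := τ.toLinearMap ∘ₗ TensorProduct.mk F _ _ b) fun c hc => h b c hb hc
  have hinj : ∀ {b : Fin 3 → F} (_ : b ≠ 0) {ψ : (Fin 3 → F) →ₗ[F] (Fin 3 → F)},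
      (∀ c, ψ c = 0 → τ (b ⊗ₜ c) = 0) → Function.Injective ψ := by
    intro b hb ψ hψ
    rw [← LinearMap.ker_eq_bot, LinearMap.ker_eq_bot']
    intro c hc
    by_contra hc0
    exact (LinearEquiv.map_ne_zero_iff τ).2 (tmul_ne_zero hb hc0) (hψ c hc)
  by_cases hall : ∀ b ≠ 0,
      ∃ u ≠ 0, ∃ ψ : (Fin 3 → F) →ₗ[F] (Fin 3 → F), ∀ c, τ (b ⊗ₜ c) = u ⊗ₜ ψ c
  · obtain ⟨p, q, hpq⟩ := exists_eq_tmul_of_forall_left hE τ hall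
    exact ⟨p, q, Or.inl hpq⟩
  · have hall' : ∀ b ≠ 0,
        ∃ w ≠ 0, ∃ ψ : (Fin 3 → F) →ₗ[F] (Fin 3 → F), ∀ c, τ (b ⊗ₜ c) = ψ c ⊗ₜ w := by
      push Not at hall
      obtain ⟨b', hb', hall⟩ := hall
      obtain ⟨z, hz, ψ', hψ'⟩ := (htype b' hb').resolve_left (by
        rintro ⟨u, hu, ψ, hψ⟩
        obtain ⟨c, hc⟩ := hall u hu ψ
        exact hc (hψ c))
      intro b hb
      refine (htype b hb).resolve_left ?_
      rintro ⟨y, hy, ψ, hψ⟩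
      obtain ⟨c, hc, hn⟩ := exists_not_pure hy hz
        (hinj hb fun c hc => by rw [hψ, hc, TensorProduct.tmul_zero])
        (hinj hb' fun c hc => by rw [hψ', hc, TensorProduct.zero_tmul])
      have e : τ ((b + b') ⊗ₜ c) = y ⊗ₜ[F] ψ c + ψ' c ⊗ₜ[F] z := by
        rw [TensorProduct.add_tmul, map_add, hψ, hψ']
      by_cases h0 : b + b' = 0
      · refine hn 0 0 ?_
        rw [← e, h0, TensorProduct.zero_tmul, map_zero, TensorProduct.zero_tmul]
      · obtain ⟨u, w, -, -, e'⟩ := h _ c h0 hc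
        exact hn u w (e.symm.trans e')
    obtain ⟨p, q, hpq⟩ := exists_eq_tmul_of_forall_left hE
      (τ.trans (TensorProduct.comm F (Fin 3 → F) (Fin 3 → F))) fun b hb => by
        obtain ⟨w, hw, ψ, hψ⟩ := hall' b hb
        exact ⟨w, hw, ψ, fun c => by simp [hψ]⟩
    refine ⟨p, q, Or.inr fun b c => (TensorProduct.comm F (Fin 3 → F) (Fin 3 → F)).injective ?_⟩
    simpa using hpq b c

theorem mem_H_of_forall {g : V F ≃ₗ[F] V F} {σ : (Fin 2 → F) →ₗ[F] (Fin 2 → F)}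
    {p q : (Fin 3 → F) →ₗ[F] (Fin 3 → F)} (h : ∀ a b c, g (a ⊗ₜ (b ⊗ₜ c)) = σ a ⊗ₜ (p b ⊗ₜ q c)) :
    g ∈ H F := by
  obtain ⟨a₀, ha₀⟩ := exists_ne (0 : Fin 2 → F)
  obtain ⟨b₀, hb₀⟩ := exists_ne (0 : Fin 3 → F)
  have hne : ∀ a b c, a ≠ 0 → b ≠ 0 → c ≠ 0 → σ a ⊗ₜ[F] (p b ⊗ₜ[F] q c) ≠ 0 := by
    intro a b c ha hb hc
    rw [← h]
    exact (LinearEquiv.map_ne_zero_iff g).2 (tmul_ne_zero ha (tmul_ne_zero hb hc))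
  have hσ : Function.Injective σ := by
    rw [← LinearMap.ker_eq_bot, LinearMap.ker_eq_bot']
    intro a ha
    by_contra ha0
    exact hne a b₀ b₀ ha0 hb₀ hb₀ (by rw [ha, TensorProduct.zero_tmul])
  have hp : Function.Injective p := by
    rw [← LinearMap.ker_eq_bot, LinearMap.ker_eq_bot']
    intro b hb
    by_contra hb0
    exact hne a₀ b b₀ ha₀ hb0 hb₀ (by rw [hb, TensorProduct.zero_tmul, TensorProduct.tmul_zero])
  have hq : Function.Injective q := by
    rw [← LinearMap.ker_eq_bot, LinearMap.ker_eq_bot']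
    intro c hc
    by_contra hc0
    exact hne a₀ b₀ c ha₀ hb₀ hc0 (by rw [hc, TensorProduct.tmul_zero, TensorProduct.tmul_zero])
  refine ⟨(LinearEquiv.ofInjectiveEndo σ hσ, LinearEquiv.ofInjectiveEndo p hp,
    LinearEquiv.ofInjectiveEndo q hq), ?_⟩
  apply LinearEquiv.toLinearMap_injective
  apply TensorProduct.ext
  apply LinearMap.ext
  intro a
  apply TensorProduct.ext
  apply LinearMap.ext₂
  intro b c
  exact (h a b c).symm

/-- `G` is generated by `H` and the interchange of the two three-dimensional factors. -/
theorem mem_H_or_mul_swap_mem_H {g : V F ≃ₗ[F] V F} (hg : g ∈ G F) : g ∈ H F ∨ g * swap F ∈ H F := by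
  obtain ⟨σ, τ, h⟩ := exists_eq_tmul_of_mem_G hg
  obtain ⟨a₀, ha₀⟩ := exists_ne (0 : Fin 2 → F)
  have hτ : Function.Injective τ := by
    rw [← LinearMap.ker_eq_bot, LinearMap.ker_eq_bot']
    intro t ht
    by_contra ht0
    refine (LinearEquiv.map_ne_zero_iff g).2 (tmul_ne_zero ha₀ ht0) ?_
    rw [h, ht, TensorProduct.tmul_zero]
  obtain ⟨p, q, hpq⟩ := exists_eq_congr_of_pure (τ := LinearEquiv.ofInjectiveEndo τ hτ) (by
    intro b c hb hc
    obtain ⟨a', b', c', ha', hb', hc', e⟩ := map_fundamental hg ha₀ hb hc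
    rw [h] at e
    obtain ⟨k, hk, e'⟩ := exists_smul_of_tmul_eq_left ha' (tmul_ne_zero hb' hc') e.symm
    refine ⟨k⁻¹ • b', c', smul_ne_zero (inv_ne_zero hk) hb', hc', ?_⟩
    rw [← TensorProduct.smul_tmul', e', smul_smul, inv_mul_cancel₀ hk, one_smul]
    rfl)
  rcases hpq with hpq | hpq
  · refine Or.inl (mem_H_of_forall (σ := σ) (p := p) (q := q) fun a b c => ?_)
    rw [h]
    exact congrArg _ (hpq b c)
  · refine Or.inr (mem_H_of_forall (σ := σ) (p := q) (q := p) fun a b c => ?_)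
    have : (g * swap F) (a ⊗ₜ (b ⊗ₜ c)) = g (a ⊗ₜ (c ⊗ₜ b)) := by simp [swap]
    rw [this, h]
    exact congrArg _ (hpq c b)

/-- A `G`-orbit is the union of the `H`-orbits of a tensor and of its transpose. -/
theorem orbit_G (A : V F) : MulAction.orbit (G F) A =
    MulAction.orbit (H F) A ∪ MulAction.orbit (H F) (swap F A) := by
  ext B
  constructor
  · rintro ⟨⟨g, hg⟩, rfl⟩
    rcases mem_H_or_mul_swap_mem_H hg with h | h
    · exact Or.inl ⟨⟨g, h⟩, rfl⟩
    · refine Or.inr ⟨⟨_, h⟩, ?_⟩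
      change g (swap F (swap F A)) = g A
      rw [swap_swap]
  · rintro (⟨⟨h, hh⟩, rfl⟩ | ⟨⟨h, hh⟩, rfl⟩)
    · exact ⟨⟨h, H_le_G hh⟩, rfl⟩
    · exact ⟨⟨h * swap F, mul_mem (H_le_G hh) swap_mem_G⟩, rfl⟩

/-- The action of the interchange of factors on the types. -/
def transposeType : Equiv.Perm (Fin 16) := Equiv.swap 0 1 * Equiv.swap 4 5 * Equiv.swap 9 10

theorem comm_E (i j : Fin 3) : TensorProduct.comm F (Fin 3 → F) (Fin 3 → F) (E i j) = E j i := by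
  simp [E]

theorem swap_tens (x y : M F) : swap F (tens x y) =
    tens (TensorProduct.comm F _ _ x) (TensorProduct.comm F _ _ y) := by
  rw [tens, LinearEquiv.map_add]
  rfl

theorem swap_canon (γ δ : F) (i : Fin 16) : swap F (canon γ δ i) = canon γ δ (transposeType i) := by
  rw [canon, swap_tens, canon]
  congr 1
  · fin_cases i <;> simp [canonLeft, comm_E, transposeType, Equiv.swap_apply_def, add_comm]
  · fin_cases i <;>
      simp [canonRight, comm_E, transposeType, Equiv.swap_apply_def, add_comm, add_left_comm]

/-! ### Counting orbits -/

theorem transposeType_transposeType : ∀ i, transposeType (transposeType i) = i := by decide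

/-! In this section `I` consists of the types that occur over `F`. -/

section Counting

variable {γ δ : F} {I : Finset (Fin 16)} (hI : ∀ i ∈ I, i = 8 ∨ i = 14 → IsUniversal γ δ)
  (hempty : ∀ i ∉ I, oType F i = ∅)

include hI hempty

theorem canon_mem_oType {i : Fin 16} (hi : i ∈ I) : canon γ δ i ∈ oType F i := by
  rw [oType_eq_orbit (I := (I : Set (Fin 16))) hI hempty hi]
  exact MulAction.mem_orbit_self _

theorem eq_of_canon_mem_oType {i j : Fin 16} (hi : i ∈ I) (hj : j ∈ I)
    (h : canon γ δ i ∈ oType F j) : i = j := by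
  rw [oType_eq_orbit (I := (I : Set (Fin 16))) hI hempty hj] at h
  exact eq_of_canon_mem_orbit (fun h => (hI i hi h).1) (fun h => (hI j hj h).1)
    (MulAction.mem_orbit_self _) h

theorem orbitsOn_H_eq : orbitsOn (H F) (Omega F) = oType F '' I := by
  ext O
  constructor
  · rintro ⟨A, hA, rfl⟩
    obtain ⟨i, hi⟩ := exists_mem_oType hA
    have hiI : i ∈ I := by
      by_contra hn
      rw [hempty i hn] at hi
      exact hi
    refine ⟨i, hiI, ?_⟩
    have e := oType_eq_orbit (I := (I : Set (Fin 16))) hI hempty hiI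
    rw [e] at hi ⊢
    exact (MulAction.orbit_eq_iff.2 hi).symm
  · rintro ⟨i, hi, rfl⟩
    exact ⟨canon γ δ i, canon_mem_Omega γ δ i, oType_eq_orbit (I := (I : Set (Fin 16))) hI hempty hi⟩

theorem encard_orbitsOn_H : (orbitsOn (H F) (Omega F)).encard = I.card := by
  rw [orbitsOn_H_eq hI hempty, Set.InjOn.encard_image, Set.encard_coe_eq_coe_finsetCard]
  intro i hi j hj e
  refine eq_of_canon_mem_oType hI hempty hi hj ?_
  rw [← e]
  exact canon_mem_oType hI hempty hi

theorem orbit_G_canon (hIt : ∀ i ∈ I, transposeType i ∈ I) {i : Fin 16} (hi : i ∈ I) :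
    MulAction.orbit (G F) (canon γ δ i) = oType F i ∪ oType F (transposeType i) := by
  rw [orbit_G, swap_canon, oType_eq_orbit (I := (I : Set (Fin 16))) hI hempty hi,
    oType_eq_orbit (I := (I : Set (Fin 16))) hI hempty (hIt i hi)]

theorem orbitsOn_G_eq (hIt : ∀ i ∈ I, transposeType i ∈ I) {J : Finset (Fin 16)} (hJI : J ⊆ I)
    (hJ : ∀ i ∈ I, i ∈ J ∨ transposeType i ∈ J) : orbitsOn (G F) (Omega F) =
      (fun i => oType F i ∪ oType F (transposeType i)) '' J := by
  ext O
  constructor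
  · rintro ⟨A, hA, rfl⟩
    obtain ⟨i, hi⟩ := exists_mem_oType hA
    have hiI : i ∈ I := by
      by_contra hn
      rw [hempty i hn] at hi
      exact hi
    have hA' : MulAction.orbit (G F) A = MulAction.orbit (G F) (canon γ δ i) := by
      rw [MulAction.orbit_eq_iff, orbit_G_canon hI hempty hIt hiI]
      exact Or.inl hi
    rw [hA', orbit_G_canon hI hempty hIt hiI]
    rcases hJ i hiI with h | h
    · exact ⟨i, h, rfl⟩
    · refine ⟨_, h, ?_⟩
      simp only [transposeType_transposeType, Set.union_comm]
  · rintro ⟨i, hi, rfl⟩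
    exact ⟨canon γ δ i, canon_mem_Omega γ δ i, (orbit_G_canon hI hempty hIt (hJI hi)).symm⟩

/-- `J` contains one type from each class under transposition. -/
theorem encard_orbitsOn_G (hIt : ∀ i ∈ I, transposeType i ∈ I) {J : Finset (Fin 16)} (hJI : J ⊆ I)
    (hJ : ∀ i ∈ I, i ∈ J ∨ transposeType i ∈ J)
    (hJt : ∀ i ∈ J, transposeType i ∈ J → transposeType i = i) :
    (orbitsOn (G F) (Omega F)).encard = J.card := by
  rw [orbitsOn_G_eq hI hempty hIt hJI hJ, Set.InjOn.encard_image, Set.encard_coe_eq_coe_finsetCard]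
  intro i hi j hj e
  have h : canon γ δ i ∈ oType F j ∪ oType F (transposeType j) := by
    have e : oType F i ∪ oType F (transposeType i) = oType F j ∪ oType F (transposeType j) := e
    rw [← e]
    exact Or.inl (canon_mem_oType hI hempty (hJI hi))
  rcases h with h | h
  · exact eq_of_canon_mem_oType hI hempty (hJI hi) (hJI hj) h
  · have := eq_of_canon_mem_oType hI hempty (hJI hi) (hIt j (hJI hj)) h
    rw [this]
    exact hJt j hj (this ▸ hi)

end Counting

end

end Tensor233

theorem mainTheorem2 (F : Type*) [Field F] :
    (Finite F ∨ IsRealClosed F →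
      (orbitsOn (H F) (Omega F)).encard = 16 ∧
      (orbitsOn (G F) (Omega F)).encard = 13 ∧
      orbitsOn (H F) (Omega F) =
        {o4 F, o4T F, o5 F, o6 F, o7 F, o7T F, o8 F, o9 F, o10 F, o11 F, o11T F, o12 F, o13 F,
          o14 F, o15 F, o16 F} ∧
      orbitsOn (G F) (Omega F) =
        {o4 F ∪ o4T F, o5 F, o6 F, o7 F ∪ o7T F, o8 F, o9 F, o10 F, o11 F ∪ o11T F, o12 F,
          o13 F, o14 F, o15 F, o16 F}) ∧
    (IsAlgClosed F →
      (orbitsOn (H F) (Omega F)).encard = 14 ∧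
      (orbitsOn (G F) (Omega F)).encard = 11 ∧
      orbitsOn (H F) (Omega F) =
        {o4 F, o4T F, o5 F, o6 F, o7 F, o7T F, o8 F, o9 F, o11 F, o11T F, o12 F, o13 F,
          o14 F, o16 F} ∧
      orbitsOn (G F) (Omega F) =
        {o4 F ∪ o4T F, o5 F, o6 F, o7 F ∪ o7T F, o8 F, o9 F, o11 F ∪ o11T F, o12 F,
          o13 F, o14 F, o16 F} ∧
      o10 F = ∅ ∧ o15 F = ∅) := by
  have t0 : transposeType 0 = 1 := by decide
  have t4 : transposeType 4 = 5 := by decide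
  have t9 : transposeType 9 = 10 := by decide
  have tfix : ∀ i, i ∈ ({2, 3, 6, 7, 8, 11, 12, 13, 14, 15} : Finset (Fin 16)) →
      transposeType i = i := by decide
  constructor
  · intro hF
    obtain ⟨γ, δ, h⟩ := exists_isUniversal hF
    let I : Finset (Fin 16) := {0, 1, 2, 3, 4, 5, 6, 7, 8, 9, 10, 11, 12, 13, 14, 15}
    let J : Finset (Fin 16) := {0, 2, 3, 4, 6, 7, 8, 9, 11, 12, 13, 14, 15}
    have hI : ∀ i ∈ I, i = 8 ∨ i = 14 → IsUniversal γ δ := fun _ _ _ => h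
    have hempty : ∀ i ∉ I, oType F i = ∅ := fun i hi => absurd (by revert i; decide) hi
    have hIt : ∀ i ∈ I, transposeType i ∈ I := by decide
    have hJI : J ⊆ I := by decide
    have hJ : ∀ i ∈ I, i ∈ J ∨ transposeType i ∈ J := by decide
    have hJt : ∀ i ∈ J, transposeType i ∈ J → transposeType i = i := by decide
    refine ⟨encard_orbitsOn_H hI hempty, encard_orbitsOn_G hI hempty hIt hJI hJ hJt, ?_, ?_⟩
    · rw [orbitsOn_H_eq hI hempty]
      simp only [I, Finset.coe_insert, Finset.coe_singleton, Set.image_insert_eq, Set.image_singleton]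
      rfl
    · rw [orbitsOn_G_eq hI hempty hIt hJI hJ]
      simp only [J, Finset.coe_insert, Finset.coe_singleton, Set.image_insert_eq,
        Set.image_singleton, t0, t4, t9, tfix 2 (by decide), tfix 3 (by decide), tfix 6 (by decide),
        tfix 7 (by decide), tfix 8 (by decide), tfix 11 (by decide), tfix 12 (by decide),
        tfix 13 (by decide), tfix 14 (by decide), tfix 15 (by decide), Set.union_self]
      rfl
  · intro hF
    have h10 : o10 F = ∅ := o10_eq_empty not_anisotropic
    have h15 : o15 F = ∅ := o15_eq_empty not_anisotropic
    let I : Finset (Fin 16) := {0, 1, 2, 3, 4, 5, 6, 7, 9, 10, 11, 12, 13, 15}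
    let J : Finset (Fin 16) := {0, 2, 3, 4, 6, 7, 9, 11, 12, 13, 15}
    have hI : ∀ i ∈ I, i = 8 ∨ i = 14 → IsUniversal (0 : F) 0 := by
      intro i hi h
      exact absurd h (by revert i; decide)
    have hempty : ∀ i ∉ I, oType F i = ∅ := by
      intro i hi
      have : i = 8 ∨ i = 14 := by revert i; decide
      rcases this with rfl | rfl
      exacts [h10, h15]
    have hIt : ∀ i ∈ I, transposeType i ∈ I := by decide
    have hJI : J ⊆ I := by decide
    have hJ : ∀ i ∈ I, i ∈ J ∨ transposeType i ∈ J := by decide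
    have hJt : ∀ i ∈ J, transposeType i ∈ J → transposeType i = i := by decide
    refine ⟨encard_orbitsOn_H hI hempty, encard_orbitsOn_G hI hempty hIt hJI hJ hJt, ?_, ?_, h10,
      h15⟩
    · rw [orbitsOn_H_eq hI hempty]
      simp only [I, Finset.coe_insert, Finset.coe_singleton, Set.image_insert_eq, Set.image_singleton]
      rfl
    · rw [orbitsOn_G_eq hI hempty hIt hJI hJ]
      simp only [J, Finset.coe_insert, Finset.coe_singleton, Set.image_insert_eq,
        Set.image_singleton, t0, t4, t9, tfix 2 (by decide), tfix 3 (by decide), tfix 6 (by decide),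
        tfix 7 (by decide), tfix 11 (by decide), tfix 12 (by decide), tfix 13 (by decide),
        tfix 15 (by decide), Set.union_self]
      rfl
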